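/- Let $n\ge 2$ and fix an even, non-negative function $\chi\in C_0^\infty((-2,2))$ with $\chi(s)=1$ for $|s|\le 1$. Put $\psi(\xi)=\chi(|\xi|)-\chi(2|\xi|)$ for $\xi\in\mathbb{R}^n$ and, for $j\in\mathbb{Z}$, let $P_j$ be the frequency projection in the variable $x\in\mathbb{R}^n$ given by $\widehat{P_jf}(\xi)=\psi(2^{-j}\xi)\widehat f(\xi)$, where $\widehat f(\xi)=c_0\int_{\mathbb{R}^n}e^{-ix\cdot\xi}f(x)\,dx$. For signs $\varepsilon_1,\dots,\varepsilon_n\in\{1,-1\}$ write $\Delta_\pm=\sum_{i=1}^n\varepsilon_i\partial_{x_i}^2$, $|\xi|_\pm^2=\sum_{i=1}^n\varepsilon_i\xi_i^2$, and $\widehat{W_\pm(t)\phi}(\xi)=e^{-it|\xi|_\pm^2}\widehat\phi(\xi)$. For $\mathbf e\in\mathbb{S}^{n-1}$ let $P_{\mathbf e}=\{v\in\mathbb{R}^n: v\cdot\mathbf e=0\}$ and, for $p,q\in[1,\infty]$, $$\|u\|_{L^{p,q}_{\mathbf e}}=\Big[\int_{\mathbb{R}}\Big[\int_{P_{\mathbf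 e}\times\mathbb{R}}|u(t,r\mathbf e+v)|^q\,dv\,dt\Big]^{p/q}dr\Big]^{1/p},$$ with the usual modification for infinite exponents. For $F\in\mathcal S(\mathbb{R}\times\mathbb{R}^n)$ let $u(t)=-i\int_0^tW_\pm(t-s)F(s)\,ds$, $t\in\mathbb{R}$. Then $u$ is a classical solution of $$(i\partial_t+\Delta_\pm)u=F,\qquad u(0,\cdot)=0,$$ and there is a constant $C$, depending only on $n$ and $\chi$, such that for all signs $\varepsilon_1,\dots,\varepsilon_n$, all $p\in[2,\infty]$ if $n\ge 3$ and all $p\in[3,\infty]$ if $n=2$, all $j\in\mathbb{Z}$, all $F\in\mathcal S(\mathbb{R}\times\mathbb{R}^n)$ and all $\mathbf e'\in\mathbb{S}^{n-1}$, $$2^{-\left(\frac n2-\frac1p\right)j}\,\|P_ju\|_{L^{p,\infty}_{\mathbf e'}}\le C\,2^{-j/2}\sup_{\mathbf e\in\mathbb{S}^{n-1}}\|P_jF\|_{L^{1,2}_{\mathbf e}},$$ where $1/\infty=0$. -/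

import Mathlib

open MeasureTheory FourierTransform
open scoped SchwartzMap ENNReal NNReal ContDiff

noncomputable section

namespace UltraSchrodinger

/-- `ℝⁿ` with its Euclidean structure. -/
abbrev Space (n : ℕ) : Type := EuclideanSpace ℝ (Fin n)

/-- A vector of signs `ε₁, …, εₙ ∈ {1, -1}`. -/
def IsSigns {n : ℕ} (ε : Fin n → ℝ) : Prop := ∀ i, ε i = 1 ∨ ε i = -1

/-- The quadratic form `|ξ|²_± = ∑ εᵢ ξᵢ²`. -/
def quadForm {n : ℕ} (ε : Fin n → ℝ) (ξ : Space n) : ℝ := ∑ i, ε i * ξ i ^ 2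

/-- The operator `Δ_± f = ∑ εᵢ ∂²_{xᵢ} f`. -/
def ultraLaplacian {n : ℕ} (ε : Fin n → ℝ) (f : Space n → ℂ) (x : Space n) : ℂ :=
  ∑ i, (ε i : ℂ) *
    lineDeriv ℝ (fun y => lineDeriv ℝ f y (EuclideanSpace.single i 1)) x
      (EuclideanSpace.single i 1)

/-- The Fourier multiplier operator with symbol `m`, for the Fourier transform
`f̂(ξ) = c₀ ∫ e^{-i x·ξ} f(x) dx`. Mathlib's `𝓕` is `∫ e^{-2π i x·ξ} f(x) dx`, so that the frequency
`ξ` of the former is `2π` times the frequency of the latter; the constant `c₀` cancels. -/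
def fourierMult {n : ℕ} (m : Space n → ℂ) (f : Space n → ℂ) : Space n → ℂ :=
  𝓕⁻ (fun ξ : Space n => m ((2 * Real.pi) • ξ) * 𝓕 f ξ)

/-- `χ ∈ C_c^∞((-2, 2))` is even and non-negative, and `χ = 1` on `[-1, 1]`. -/
structure IsCutoff (χ : ℝ → ℝ) : Prop where
  smooth : ContDiff ℝ ∞ χ
  compactSupport : HasCompactSupport χ
  support : tsupport χ ⊆ Set.Ioo (-2) 2
  even : ∀ s, χ (-s) = χ s
  nonneg : ∀ s, 0 ≤ χ s
  eq_one : ∀ s, |s| ≤ 1 → χ s = 1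

/-- `ψ(ξ) = χ(|ξ|) - χ(2|ξ|)`. -/
def psi {n : ℕ} (χ : ℝ → ℝ) (ξ : Space n) : ℝ := χ ‖ξ‖ - χ (2 * ‖ξ‖)

/-- The dyadic frequency projection `P_j`, with symbol `ψ_j = ψ(2^{-j} ·)`, on functions of `x`. -/
def dyadicProj {n : ℕ} (χ : ℝ → ℝ) (j : ℤ) (f : Space n → ℂ) : Space n → ℂ :=
  fourierMult (fun ξ => (psi χ ((2 : ℝ) ^ (-j) • ξ) : ℂ)) f

/-- The linear group `W_±(t)`, with symbol `e^{-i t |ξ|²_±}`. -/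
def propagator {n : ℕ} (ε : Fin n → ℝ) (t : ℝ) (φ : Space n → ℂ) : Space n → ℂ :=
  fourierMult (fun ξ => Complex.exp (-Complex.I * t * quadForm ε ξ)) φ

/-- The Duhamel solution `u(t) = -i ∫₀ᵗ W_±(t - s) F(s) ds`. -/
def duhamel {n : ℕ} (ε : Fin n → ℝ) (F : ℝ → Space n → ℂ) (t : ℝ) (x : Space n) : ℂ :=
  -Complex.I * ∫ s in (0 : ℝ)..t, propagator ε (t - s) (F s) x

/-- `u` is a classical solution on `ℝ × ℝⁿ` of `(i ∂_t + Δ_±) u = F`, `u(0, ·) = 0`. -/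
structure SolvesIVP {n : ℕ} (ε : Fin n → ℝ) (F u : ℝ → Space n → ℂ) : Prop where
  contDiff_space : ∀ t, ContDiff ℝ 2 (u t)
  differentiable_time : ∀ x, Differentiable ℝ (fun t => u t x)
  equation : ∀ t x,
    Complex.I * deriv (fun s => u s x) t + ultraLaplacian ε (u t) x = F t x
  initial : ∀ x, u 0 x = 0

/-- The `(n-1)`-dimensional Lebesgue measure on the hyperplane `P_e = {v : v · e = 0}`. (It is written
out because the default measure on a subtype is the restriction of the ambient one, which is `0`.) -/
def hyperplaneMeasure {n : ℕ} (e : Space n) : Measure (ℝ ∙ e)ᗮ :=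
  (stdOrthonormalBasis ℝ (ℝ ∙ e)ᗮ).toBasis.addHaar

/-- The norm `‖u‖_{L^{p,q}_e} = [∫_ℝ [∫_{P_e × ℝ} |u(t, r e + v)|^q dv dt]^{p/q} dr]^{1/p}`, for a
unit vector `e`, with the essential supremum in place of an integral for an infinite exponent. -/
def anisoNorm {n : ℕ} (p q : ℝ≥0∞) (e : Space n) (u : ℝ → Space n → ℂ) : ℝ≥0∞ :=
  eLpNorm (fun r : ℝ =>
    eLpNorm (fun z : ℝ × (ℝ ∙ e)ᗮ => u z.1 (r • e + (z.2 : Space n))) q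
      ((volume : Measure ℝ).prod (hyperplaneMeasure e))) p volume

end UltraSchrodinger

end

/-! Scaling by 2^j reduces the estimate to frequencies |ξ| ~ 1. There the Duhamel operator is a
time-truncated convolution with K(t, x) = ∫ e^{i(x·ξ - t|ξ|²_±)} m(ξ) dξ. The symbol m is split into
finitely many nonnegative pieces, each supported in a half-space {c ≤ σ ξ_i} with σ = ±1, and two
facts about the kernel of a piece suffice (`KernelBounds`).

First, |K| ≲ (1+|x|)^{-n/2} uniformly in t. Gaussian integrals give |K| ≲ (1+|t|)^{-n/2} for any
signs, integrations by parts give |x|^n |K| ≲ (1+|t|)^{n/2}, and the product of the two bounds no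
longer contains t (`exists_norm_kernel_le_uniform`). Second, the ξ_i-derivative of the phase is x_i
- 2tε_iξ_i. If ε_i σ t x_i ≤ 0 its two terms cannot cancel, so K decays rapidly in (t, x) there
(`exists_norm_kernel_le_rapid`). This region contains the hyperplane x_i = 0, on which K is
therefore integrable in time and the tangential variables.

The L^{p,∞} norm is dualised: g(r) is paired with u along a measurable choice r ↦ (t(r), x(r)) of
points with x(r) in the slice r e' + P_{e'}, and the source is cut into slices f on {x_i = y}.
Without time truncation, m ≥ 0 and Cauchy–Schwarz in L²(m dξ), the T T* argument, bound the pairing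
of g and f by the geometric mean of two quadratic forms (`enorm_integral_mul_mul_kernel_le`). The
one in f is ≲ ‖f‖₂² by the second fact. The one in g is ≲ ‖g‖²_{p'} by the first fact and Young's
inequality, since |x(r) - x(r')| ≥ |r - r'| and (1+|r|)^{-n/2} lies in L^{p/2}; this is the step
that excludes p = 2 when n = 2.

The time truncation costs nothing. On a slice, 1_{s ≤ t} differs from the indicator of {κ(x_i - y) >
0}, κ = ε_i σ, only where K decays rapidly. That indicator depends on the point of the curve alone
and 1_{s ≤ 0} on the source point alone, so they are absorbed into g and f, and the error is
estimated with absolute values (`enorm_integral_timeCutoff_slice_le`). Integration in y produces the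
L^{1,2} norm in the direction e_i, so only coordinate directions of the supremum are used.

That u is a classical solution follows on the Fourier side: the slices F(s, ·) form a bounded family
of Schwartz functions, which justifies differentiation under the integral sign. -/

noncomputable section

namespace UltraSchrodinger

/-! ### Oscillatory kernels and integration by parts in frequency. -/

section

variable {n : ℕ}

/-- The phase `x · ξ - t |ξ|²_±`. -/
def phase (ε : Fin n → ℝ) (t : ℝ) (x ξ : Space n) : ℝ := inner ℝ x ξ - t * quadForm ε ξ

/-- The plane wave `e^{i (x · ξ - t |ξ|²_±)}`. -/
@[irreducible] def wave (ε : Fin n → ℝ) (t : ℝ) (x ξ : Space n) : ℂ :=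
  Complex.exp (phase ε t x ξ * Complex.I)

/-- The convolution kernel of `W_±(t) m(D)`, up to a constant factor. -/
def kernel (ε : Fin n → ℝ) (m : Space n → ℂ) (t : ℝ) (x : Space n) : ℂ :=
  ∫ ξ, wave ε t x ξ * m ξ

/-- Multiplication of a Schwartz function by the `k`-th coordinate. -/
def coordMul (k : Fin n) : 𝓢(Space n, ℂ) →L[ℂ] 𝓢(Space n, ℂ) :=
  SchwartzMap.smulLeftCLM ℂ (fun ξ : Space n => ((ξ k : ℝ) : ℂ))

/-- The derivative of a Schwartz function in the `k`-th coordinate. -/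
def coordDeriv (k : Fin n) : 𝓢(Space n, ℂ) →L[ℂ] 𝓢(Space n, ℂ) :=
  LineDeriv.lineDerivOpCLM ℂ 𝓢(Space n, ℂ) (EuclideanSpace.single k (1 : ℝ))

lemma hasTemperateGrowth_coord (k : Fin n) :
    (fun ξ : Space n => ((ξ k : ℝ) : ℂ)).HasTemperateGrowth := by
  have : (fun ξ : Space n => ((ξ k : ℝ) : ℂ)) =
      (Complex.ofRealCLM ∘L (EuclideanSpace.proj k : Space n →L[ℝ] ℝ)) := by
    ext; simp
  rw [this]
  exact ContinuousLinearMap.hasTemperateGrowth _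

lemma coordMul_apply (k : Fin n) (m : 𝓢(Space n, ℂ)) (ξ : Space n) :
    coordMul k m ξ = (ξ k : ℂ) * m ξ := by
  rw [coordMul, SchwartzMap.smulLeftCLM_apply_apply (hasTemperateGrowth_coord k), smul_eq_mul]

lemma continuous_quadForm (ε : Fin n → ℝ) : Continuous (quadForm ε) := by
  unfold quadForm; fun_prop

lemma continuous_wave (ε : Fin n → ℝ) :
    Continuous fun p : ℝ × Space n × Space n => wave ε p.1 p.2.1 p.2.2 := by
  have := continuous_quadForm ε
  unfold wave phase
  fun_prop

lemma continuous_wave_right (ε : Fin n → ℝ) (t : ℝ) (x : Space n) :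
    Continuous (wave ε t x) :=
  (continuous_wave ε).comp (by fun_prop : Continuous fun ξ => (t, x, ξ))

lemma norm_wave (ε : Fin n → ℝ) (t : ℝ) (x ξ : Space n) : ‖wave ε t x ξ‖ = 1 := by
  simp [wave, Complex.norm_exp_ofReal_mul_I]

lemma integrable_wave_mul (ε : Fin n → ℝ) (t : ℝ) (x : Space n) {f : Space n → ℂ}
    (hf : Integrable f) : Integrable fun ξ => wave ε t x ξ * f ξ :=
  hf.bdd_mul (c := 1) (continuous_wave_right ε t x).aestronglyMeasurable
    (Filter.Eventually.of_forall fun ξ => (norm_wave ε t x ξ).le)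

lemma norm_kernel_le (ε : Fin n → ℝ) (m : Space n → ℂ) (t : ℝ) (x : Space n) :
    ‖kernel ε m t x‖ ≤ ∫ ξ, ‖m ξ‖ := by
  refine (norm_integral_le_integral_norm _).trans_eq ?_
  simp [norm_wave]

lemma phase_add_smul (ε : Fin n → ℝ) (t : ℝ) (x ξ : Space n) (k : Fin n) (s : ℝ) :
    phase ε t x (ξ + s • EuclideanSpace.single k (1 : ℝ)) =
      phase ε t x ξ + s * (x k - 2 * t * ε k * ξ k) - s ^ 2 * (t * ε k) := by
  have h : quadForm ε (ξ + s • EuclideanSpace.single k (1 : ℝ)) =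
      quadForm ε ξ + 2 * s * ε k * ξ k + s ^ 2 * ε k := by
    unfold quadForm
    have : ∀ i, ε i * (ξ + s • EuclideanSpace.single k (1 : ℝ)) i ^ 2 =
        ε i * ξ i ^ 2 + if i = k then 2 * s * ε k * ξ k + s ^ 2 * ε k else 0 := by
      intro i
      by_cases hi : i = k
      · subst hi; simp; ring
      · simp [hi]
    simp_rw [this, Finset.sum_add_distrib]
    simp
    ring
  rw [phase, phase, h, inner_add_right, inner_smul_right, EuclideanSpace.inner_single_right]
  simp
  ring

lemma hasLineDerivAt_wave (ε : Fin n → ℝ) (t : ℝ) (x ξ : Space n) (k : Fin n) :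
    HasLineDerivAt ℝ (wave ε t x)
      (Complex.I * (x k - 2 * t * ε k * ξ k : ℝ) * wave ε t x ξ) ξ
      (EuclideanSpace.single k (1 : ℝ)) := by
  have h1 : HasDerivAt (fun s : ℝ => phase ε t x (ξ + s • EuclideanSpace.single k (1 : ℝ)))
      (x k - 2 * t * ε k * ξ k) 0 := by
    simp_rw [phase_add_smul]
    have := (((hasDerivAt_id (0 : ℝ)).mul_const (x k - 2 * t * ε k * ξ k)).const_add
      (phase ε t x ξ)).sub ((hasDerivAt_pow 2 (0 : ℝ)).mul_const (t * ε k))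
    exact this.congr_deriv (by simp)
  have h2 := (h1.ofReal_comp.mul_const Complex.I).cexp
  unfold HasLineDerivAt wave
  refine h2.congr_deriv ?_
  rw [zero_smul, add_zero]
  ring

lemma hasLineDerivAt_coordDeriv (m : 𝓢(Space n, ℂ)) (ξ : Space n) (k : Fin n) :
    HasLineDerivAt ℝ m (coordDeriv k m ξ) ξ (EuclideanSpace.single k (1 : ℝ)) := by
  rw [coordDeriv, LineDeriv.lineDerivOpCLM_apply, SchwartzMap.lineDerivOp_apply_eq_fderiv]
  exact (m.hasFDerivAt ξ).hasLineDerivAt _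

/-- Integration by parts in ξ_k, where the phase has derivative x_k - 2tε_kξ_k. A factor x_k is
exchanged for a derivative of the symbol and a term that costs one factor t. -/
lemma coord_mul_kernel (ε : Fin n → ℝ) (m : 𝓢(Space n, ℂ)) (t : ℝ) (x : Space n)
    (k : Fin n) :
    (x k : ℂ) * kernel ε m t x =
      Complex.I * kernel ε (coordDeriv k m) t x +
        2 * t * ε k * kernel ε (coordMul k m) t x := by
  have hX : Integrable fun ξ => wave ε t x ξ * coordMul k m ξ :=
    integrable_wave_mul ε t x (coordMul k m).integrable
  have hm : Integrable fun ξ => wave ε t x ξ * m ξ := integrable_wave_mul ε t x m.integrable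
  have key : ∀ ξ : Space n, ContinuousLinearMap.mul ℝ ℂ
      (Complex.I * (x k - 2 * t * ε k * ξ k : ℝ) * wave ε t x ξ) (m ξ) =
      Complex.I * x k * (wave ε t x ξ * m ξ) -
        Complex.I * (2 * t * ε k) * (wave ε t x ξ * coordMul k m ξ) := by
    intro ξ
    rw [coordMul_apply]
    push_cast
    simp only [ContinuousLinearMap.mul_apply']
    ring
  have h := integral_bilinear_hasLineDerivAt_right_eq_neg_left_of_integrable
    (μ := (volume : Measure (Space n))) (B := ContinuousLinearMap.mul ℝ ℂ)
    (f := wave ε t x) (f' := fun ξ => Complex.I * (x k - 2 * t * ε k * ξ k : ℝ) * wave ε t x ξ)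
    (g := m) (g' := fun ξ => (coordDeriv k m) ξ)
    (v := EuclideanSpace.single k (1 : ℝ))
    (by simp_rw [key]; exact (hm.const_mul _).sub (hX.const_mul _))
    (integrable_wave_mul ε t x (SchwartzMap.integrable _))
    (integrable_wave_mul ε t x m.integrable)
    (fun ξ _ => hasLineDerivAt_wave ε t x ξ k)
    (fun ξ _ => hasLineDerivAt_coordDeriv m ξ k)
  simp_rw [key] at h
  rw [integral_sub (hm.const_mul _) (hX.const_mul _), integral_const_mul, integral_const_mul] at h
  simp only [ContinuousLinearMap.mul_apply'] at h
  simp only [kernel]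
  rw [h]
  linear_combination (x k * ∫ ξ, wave ε t x ξ * m ξ) * Complex.I_sq -
    (2 * t * ε k * ∫ ξ, wave ε t x ξ * coordMul k m ξ) * Complex.I_sq

lemma norm_le_sum_abs (x : Space n) : ‖x‖ ≤ ∑ k, |x k| := by
  have h : x = ∑ k, x k • EuclideanSpace.single k (1 : ℝ) := by
    ext i
    simp [Finset.sum_apply, Pi.single_apply]
  conv_lhs => rw [h]
  refine (norm_sum_le _ _).trans_eq ?_
  simp [norm_smul]

lemma norm_mul_norm_kernel_le {ε : Fin n → ℝ} (hε : IsSigns ε) (m : 𝓢(Space n, ℂ)) (t : ℝ)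
    (x : Space n) :
    ‖x‖ * ‖kernel ε m t x‖ ≤
      ∑ k, (‖kernel ε (coordDeriv k m) t x‖ +
        2 * |t| * ‖kernel ε (coordMul k m) t x‖) := by
  refine (mul_le_mul_of_nonneg_right (norm_le_sum_abs x) (norm_nonneg _)).trans ?_
  rw [Finset.sum_mul]
  refine Finset.sum_le_sum fun k _ => ?_
  have : |x k| * ‖kernel ε m t x‖ = ‖(x k : ℂ) * kernel ε m t x‖ := by simp
  rw [this, coord_mul_kernel]
  refine (norm_add_le _ _).trans_eq ?_
  have h1 : |ε k| = 1 := by rcases hε k with h | h <;> simp [h]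
  simp [h1]

/-- A bound `|K_m(t,x)| ≤ C w(t)` for a class of families of symbols that is stable under
differentiation and multiplication by coordinates improves to a weighted bound. -/
lemma exists_pow_mul_norm_kernel_le {ι : Type*} {S : Set (ι → 𝓢(Space n, ℂ))}
    (hD : ∀ m ∈ S, ∀ k, (fun α => coordDeriv k (m α)) ∈ S)
    (hX : ∀ m ∈ S, ∀ k, (fun α => coordMul k (m α)) ∈ S)
    {R : (Fin n → ℝ) → ℝ → Space n → Prop} (hR : ∀ ε t x, R ε t x → IsSigns ε)
    {w : ℝ → ℝ} (hw : ∀ t, 0 ≤ w t)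
    (h : ∀ m ∈ S, ∃ C, ∀ α ε t x, R ε t x → ‖kernel ε (m α) t x‖ ≤ C * w t)
    (N : ℕ) :
    ∀ m ∈ S, ∃ C, ∀ α ε t x, R ε t x →
      ‖x‖ ^ N * ‖kernel ε (m α) t x‖ ≤ C * ((1 + |t|) ^ N * w t) := by
  induction N with
  | zero => simpa using h
  | succ N ih =>
    intro m hm
    choose C₁ hC₁ using fun k => ih _ (hD m hm k)
    choose C₂ hC₂ using fun k => ih _ (hX m hm k)
    -- One factor ‖x‖ is traded by `norm_mul_norm_kernel_le`, and the induction hypothesis is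
    -- applied to the new symbols. Since ε, t and x stay fixed throughout, the bound may be
    -- restricted to any region `R`.
    refine ⟨∑ k, (|C₁ k| + 2 * |C₂ k|), fun α ε t x hr => ?_⟩
    have hp : 0 ≤ (1 + |t|) ^ N * w t := mul_nonneg (by positivity) (hw t)
    calc ‖x‖ ^ (N + 1) * ‖kernel ε (m α) t x‖
        = ‖x‖ ^ N * (‖x‖ * ‖kernel ε (m α) t x‖) := by ring
      _ ≤ ‖x‖ ^ N * _ :=
        mul_le_mul_of_nonneg_left (norm_mul_norm_kernel_le (hR _ _ _ hr) _ _ _) (by positivity)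
      _ ≤ (∑ k, (|C₁ k| + 2 * |C₂ k|)) * ((1 + |t|) ^ (N + 1) * w t) := by
        rw [Finset.mul_sum, Finset.sum_mul]
        refine Finset.sum_le_sum fun k _ => ?_
        have h1 := (hC₁ k α ε t x hr).trans (mul_le_mul_of_nonneg_right (le_abs_self _) hp)
        have h2 := (hC₂ k α ε t x hr).trans (mul_le_mul_of_nonneg_right (le_abs_self _) hp)
        have h3 := mul_le_mul_of_nonneg_left h2 (by positivity : 0 ≤ 2 * |t|)
        have h4 : 0 ≤ |C₁ k| * ((1 + |t|) ^ N * w t) := by positivity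
        have h5 : 0 ≤ |C₂ k| * ((1 + |t|) ^ N * w t) := by positivity
        rw [pow_succ]
        nlinarith [abs_nonneg t, mul_nonneg h4 (abs_nonneg t)]

end

/-! ### Dispersive decay of the kernel. -/

section

variable {n : ℕ}

lemma integrable_gaussian {b : Fin n → ℂ} (hb : ∀ i, 0 < (b i).re) (c : Fin n → ℂ) :
    Integrable fun ξ : Space n => Complex.exp (-∑ i, b i * (ξ i : ℂ) ^ 2 + ∑ i, c i * ξ i) := by
  rw [← (PiLp.volume_preserving_toLp (Fin n)).integrable_comp_emb
    (MeasurableEquiv.toLp 2 _).measurableEmbedding]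
  exact GaussianFourier.integrable_cexp_neg_sum_mul_add hb c

/-- The integral is a product of factors (π/b_i)^{1/2} e^{-κ_i²/(4b_i)}, whose exponentials have
modulus at most 1 because Re b_i > 0. Only |b_i| enters, which is why the signature of the quadratic
form plays no role. -/
lemma norm_integral_gaussian_le {b : Fin n → ℂ} (hb : ∀ i, 0 < (b i).re) (κ : Fin n → ℝ) {T : ℝ}
    (hT : 0 < T) (hbT : ∀ i, T ≤ ‖b i‖) :
    ‖∫ ξ : Space n, Complex.exp (-∑ i, b i * (ξ i : ℂ) ^ 2 + ∑ i, (Complex.I * κ i) * ξ i)‖ ≤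
      (Real.pi / T) ^ ((n : ℝ) / 2) := by
  rw [← (PiLp.volume_preserving_toLp (Fin n)).integral_comp
    (MeasurableEquiv.toLp 2 _).measurableEmbedding]
  have := GaussianFourier.integral_cexp_neg_sum_mul_add hb (fun i => Complex.I * κ i)
  simp only at this ⊢
  rw [this, norm_prod]
  have hfac : ∀ i, ‖((Real.pi : ℂ) / b i) ^ (1 / 2 : ℂ) *
      Complex.exp ((Complex.I * κ i) ^ 2 / (4 * b i))‖ ≤ (Real.pi / T) ^ (1 / 2 : ℝ) := by
    intro i
    rw [norm_mul]
    have h1 : ‖((Real.pi : ℂ) / b i) ^ (1 / 2 : ℂ)‖ ≤ (Real.pi / T) ^ (1 / 2 : ℝ) := by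
      have : (1 / 2 : ℂ) = ((1 / 2 : ℝ) : ℂ) := by push_cast; rfl
      rw [this, Complex.norm_cpow_real]
      refine Real.rpow_le_rpow (norm_nonneg _) ?_ (by norm_num)
      rw [norm_div, Complex.norm_real, Real.norm_of_nonneg Real.pi_pos.le]
      exact div_le_div_of_nonneg_left Real.pi_pos.le hT (hbT i)
    have h2 : ‖Complex.exp ((Complex.I * κ i) ^ 2 / (4 * b i))‖ ≤ 1 := by
      rw [Complex.norm_exp, Real.exp_le_one_iff]
      have : (Complex.I * κ i) ^ 2 / (4 * b i) = ((-(κ i ^ 2 / 4) : ℝ) : ℂ) * (b i)⁻¹ := by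
        rw [mul_pow, Complex.I_sq]
        push_cast
        field_simp
      rw [this, Complex.re_ofReal_mul, Complex.inv_re]
      have := div_nonneg (hb i).le (Complex.normSq_nonneg (b i))
      nlinarith [sq_nonneg (κ i)]
    calc _ ≤ (Real.pi / T) ^ (1 / 2 : ℝ) * 1 := mul_le_mul h1 h2 (norm_nonneg _) (by positivity)
      _ = _ := mul_one _
  refine (Finset.prod_le_prod (fun i _ => norm_nonneg _) fun i _ => hfac i).trans_eq ?_
  rw [Finset.prod_const, Finset.card_univ, Fintype.card_fin, ← Real.rpow_natCast,
    ← Real.rpow_mul (by positivity)]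
  congr 1
  ring

/-- The damping e^{-δ|ξ|²} makes the wave integrable, so the multiplication formula moves the
Fourier transform from 𝓕⁻ m to a Gaussian of complex width δ + itε_i. Its modulus is at least |t|,
so the bound does not depend on δ. -/
lemma norm_integral_wave_gaussian_mul_le {ε : Fin n → ℝ} (hε : IsSigns ε) (m : 𝓢(Space n, ℂ))
    {t : ℝ} (ht : t ≠ 0) (x : Space n) {δ : ℝ} (hδ : 0 < δ) :
    ‖∫ ξ, wave ε t x ξ * (Complex.exp (-δ * ∑ i, (ξ i : ℂ) ^ 2) * m ξ)‖ ≤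
      (Real.pi / |t|) ^ ((n : ℝ) / 2) * ∫ y, ‖𝓕⁻ m y‖ := by
  set b : Fin n → ℂ := fun i => δ + t * ε i * Complex.I
  have hb : ∀ i, 0 < (b i).re := by intro i; simp [b, hδ]
  have hbT : ∀ i, |t| ≤ ‖b i‖ := by
    intro i
    refine le_trans ?_ (Complex.abs_im_le_norm _)
    rcases hε i with h | h <;> simp [b, h]
  set γ : Space n → ℂ := fun ξ => wave ε t x ξ * Complex.exp (-δ * ∑ i, (ξ i : ℂ) ^ 2)
  have hγ : ∀ ξ y : Space n, Complex.exp (↑(-2 * Real.pi * inner ℝ ξ y) * Complex.I) * γ ξ =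
      Complex.exp (-∑ i, b i * (ξ i : ℂ) ^ 2 +
        ∑ i, (Complex.I * ((x i - 2 * Real.pi * y i : ℝ) : ℂ)) * ξ i) := by
    intro ξ y
    simp only [γ, wave, phase, quadForm, b]
    rw [← Complex.exp_add, ← Complex.exp_add]
    congr 1
    simp only [PiLp.inner_apply, RCLike.inner_apply, conj_trivial]
    push_cast
    simp only [Finset.mul_sum, Finset.sum_mul, mul_sub, sub_mul, ← Finset.sum_neg_distrib,
      ← Finset.sum_add_distrib, ← Finset.sum_sub_distrib]
    refine Finset.sum_congr rfl fun i _ => ?_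
    ring
  have hγi : Integrable γ := by
    have := integrable_gaussian hb (fun i => Complex.I * ((x i : ℝ) : ℂ))
    refine this.congr (Filter.Eventually.of_forall fun ξ => ?_)
    simpa using (hγ ξ 0).symm
  have hFγ : ∀ y, ‖𝓕 γ y‖ ≤ (Real.pi / |t|) ^ ((n : ℝ) / 2) := by
    intro y
    rw [Real.fourier_eq']
    simp only [smul_eq_mul, hγ]
    exact norm_integral_gaussian_le hb _ (abs_pos.2 ht) hbT
  have hm : 𝓕 ((𝓕⁻ m : 𝓢(Space n, ℂ)) : Space n → ℂ) = m := by
    rw [← SchwartzMap.fourier_coe, FourierTransform.fourier_fourierInv_eq]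
  have hflip := VectorFourier.integral_bilin_fourierIntegral_eq_flip (ContinuousLinearMap.mul ℂ ℂ)
    (μ := (volume : Measure (Space n))) (ν := (volume : Measure (Space n))) (L := innerₗ (Space n))
    Real.continuous_fourierChar continuous_inner hγi (𝓕⁻ m : 𝓢(Space n, ℂ)).integrable
  simp only [ContinuousLinearMap.mul_apply', flip_innerₗ] at hflip
  have h1 : ∫ ξ, wave ε t x ξ * (Complex.exp (-δ * ∑ i, (ξ i : ℂ) ^ 2) * m ξ) =
      ∫ y, 𝓕 γ y * (𝓕⁻ m : 𝓢(Space n, ℂ)) y := by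
    refine Eq.trans ?_ hflip.symm
    refine integral_congr_ae (Filter.Eventually.of_forall fun ξ => ?_)
    change _ = γ ξ * 𝓕 ((𝓕⁻ m : 𝓢(Space n, ℂ)) : Space n → ℂ) ξ
    rw [hm]
    simp only [γ]
    ring
  rw [h1]
  refine (norm_integral_le_integral_norm _).trans ?_
  rw [← integral_const_mul]
  refine integral_mono_of_nonneg (Filter.Eventually.of_forall fun y => norm_nonneg _)
    ((𝓕⁻ m : 𝓢(Space n, ℂ)).integrable.norm.const_mul _) (Filter.Eventually.of_forall fun y => ?_)
  simp only [norm_mul]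
  exact mul_le_mul_of_nonneg_right (hFγ y) (norm_nonneg _)

lemma norm_kernel_le_dispersive {ε : Fin n → ℝ} (hε : IsSigns ε) (m : 𝓢(Space n, ℂ))
    {t : ℝ} (ht : t ≠ 0) (x : Space n) :
    ‖kernel ε m t x‖ ≤ (Real.pi / |t|) ^ ((n : ℝ) / 2) * ∫ y, ‖𝓕⁻ m y‖ := by
  have hexp : ∀ (δ : ℝ) (ξ : Space n), Complex.exp (-δ * ∑ i, (ξ i : ℂ) ^ 2) =
      ((Real.exp (-δ * ∑ i, ξ i ^ 2) : ℝ) : ℂ) := by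
    intro δ ξ; push_cast; rfl
  have hlim : Filter.Tendsto
      (fun δ : ℝ => ∫ ξ, wave ε t x ξ * (Complex.exp (-δ * ∑ i, (ξ i : ℂ) ^ 2) * m ξ))
      (nhdsWithin 0 (Set.Ioi 0)) (nhds (kernel ε m t x)) := by
    refine tendsto_integral_filter_of_dominated_convergence (fun ξ => ‖m ξ‖) ?_ ?_
      m.integrable.norm ?_
    · refine Filter.Eventually.of_forall fun δ => Continuous.aestronglyMeasurable ?_
      have := continuous_wave_right ε t x
      fun_prop
    · filter_upwards [self_mem_nhdsWithin] with δ hδ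
      refine Filter.Eventually.of_forall fun ξ => ?_
      rw [norm_mul, norm_mul, norm_wave, one_mul, hexp, Complex.norm_real,
        Real.norm_of_nonneg (Real.exp_pos _).le]
      refine mul_le_of_le_one_left (norm_nonneg _) (Real.exp_le_one_iff.2 ?_)
      have : 0 ≤ ∑ i, ξ i ^ 2 := Finset.sum_nonneg fun i _ => sq_nonneg _
      have hδ' : (0 : ℝ) < δ := hδ
      nlinarith
    · refine Filter.Eventually.of_forall fun ξ => ?_
      have : Continuous fun δ : ℝ =>
          wave ε t x ξ * (Complex.exp (-δ * ∑ i, (ξ i : ℂ) ^ 2) * m ξ) := by fun_prop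
      have h0 := (this.tendsto 0).mono_left (nhdsWithin_le_nhds (s := Set.Ioi 0))
      simpa using h0
  refine le_of_tendsto hlim.norm ?_
  filter_upwards [self_mem_nhdsWithin] with δ hδ
  exact norm_integral_wave_gaussian_mul_le hε m ht x hδ

lemma exists_norm_kernel_le_rpow (m : 𝓢(Space n, ℂ)) :
    ∃ C : ℝ, ∀ ε : Fin n → ℝ, IsSigns ε → ∀ t x,
      ‖kernel ε m t x‖ ≤ C * (1 + |t|) ^ (-((n : ℝ) / 2)) := by
  set A := ∫ ξ, ‖m ξ‖
  set B := ∫ y, ‖𝓕⁻ m y‖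
  have hA : 0 ≤ A := integral_nonneg fun _ => norm_nonneg _
  have hB : 0 ≤ B := integral_nonneg fun _ => norm_nonneg _
  refine ⟨A * 2 ^ ((n : ℝ) / 2) + (2 * Real.pi) ^ ((n : ℝ) / 2) * B, fun ε hε t x => ?_⟩
  have hn : (0 : ℝ) ≤ (n : ℝ) / 2 := by positivity
  have hpos : 0 < 1 + |t| := by positivity
  rw [add_mul]
  rcases le_total |t| 1 with h | h
  · refine (norm_kernel_le ε m t x).trans (le_add_of_le_of_nonneg ?_ (by positivity))
    rw [mul_assoc]
    refine le_mul_of_one_le_right hA ?_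
    rw [Real.rpow_neg hpos.le, ← div_eq_mul_inv, one_le_div (by positivity)]
    exact Real.rpow_le_rpow hpos.le (by linarith) hn
  · have ht : t ≠ 0 := by rintro rfl; simp at h; linarith
    refine (norm_kernel_le_dispersive hε m ht x).trans (le_add_of_nonneg_of_le (by positivity) ?_)
    rw [mul_right_comm, Real.rpow_neg hpos.le, ← div_eq_mul_inv, ← Real.div_rpow (by positivity)
      hpos.le]
    refine mul_le_mul_of_nonneg_right (Real.rpow_le_rpow (by positivity) ?_ hn) hB
    rw [div_le_div_iff₀ (by positivity) hpos]
    nlinarith [Real.pi_pos]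

/-- Uniform in time decay of the kernel of `W_±(t) m(D)`. -/
lemma exists_norm_kernel_le_uniform (m : 𝓢(Space n, ℂ)) :
    ∃ C : ℝ, 0 ≤ C ∧ ∀ ε : Fin n → ℝ, IsSigns ε → ∀ t x,
      ‖kernel ε m t x‖ ≤ C * (1 + ‖x‖) ^ (-((n : ℝ) / 2)) := by
  obtain ⟨C₁, h₁⟩ := exists_norm_kernel_le_rpow m
  obtain ⟨C₂, h₂⟩ := exists_pow_mul_norm_kernel_le (S := (Set.univ : Set (Unit → 𝓢(Space n, ℂ))))
    (fun _ _ _ => Set.mem_univ _) (fun _ _ _ => Set.mem_univ _)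
    (R := fun ε _ _ => IsSigns ε) (fun _ _ _ h => h)
    (w := fun t => (1 + |t|) ^ (-((n : ℝ) / 2))) (fun t => by positivity)
    (fun m _ => by
      obtain ⟨C, hC⟩ := exists_norm_kernel_le_rpow (m ())
      exact ⟨C, fun _ ε t x h => hC ε h t x⟩) n (fun _ => m) (Set.mem_univ _)
  set A := ∫ ξ, ‖m ξ‖
  have hA : 0 ≤ A := integral_nonneg fun _ => norm_nonneg _
  refine ⟨2 ^ ((n : ℝ) / 2) * (A + |C₁| + |C₂|), by positivity, fun ε hε t x => ?_⟩
  have h1 := h₁ ε hε t x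
  have h2 := h₂ () ε t x hε
  set K := ‖kernel ε m t x‖
  have hK : 0 ≤ K := norm_nonneg _
  have hpos : 0 < 1 + |t| := by positivity
  set T := (1 + |t|) ^ (-((n : ℝ) / 2))
  have hT : 0 < T := by positivity
  have hTT : (1 + |t|) ^ n * (T * T) = 1 := by
    simp only [T]
    rw [← Real.rpow_add hpos, ← Real.rpow_natCast, ← Real.rpow_add hpos]
    ring_nf
    simp
  -- The bounds K ≲ (1+|t|)^{-n/2} and ‖x‖^n K ≲ (1+|t|)^{n/2} are multiplied and the time factors
  -- cancel. A square root then gives decay in x uniform in t.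
  have hprod : ‖x‖ ^ n * (K * K) ≤ |C₁| * |C₂| := by
    have h1' : K ≤ |C₁| * T := h1.trans (mul_le_mul_of_nonneg_right (le_abs_self _) hT.le)
    have h2' : ‖x‖ ^ n * K ≤ |C₂| * ((1 + |t|) ^ n * T) :=
      h2.trans (mul_le_mul_of_nonneg_right (le_abs_self _) (by positivity))
    calc ‖x‖ ^ n * (K * K) = (‖x‖ ^ n * K) * K := by ring
      _ ≤ (|C₂| * ((1 + |t|) ^ n * T)) * (|C₁| * T) :=
        mul_le_mul h2' h1' hK (by positivity)
      _ = |C₁| * |C₂| * ((1 + |t|) ^ n * (T * T)) := by ring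
      _ = _ := by rw [hTT, mul_one]
  have hmain : (1 + ‖x‖) ^ ((n : ℝ) / 2) * K ≤ 2 ^ ((n : ℝ) / 2) * (A + |C₁| + |C₂|) := by
    have hn : (0 : ℝ) ≤ (n : ℝ) / 2 := by positivity
    rcases le_total ‖x‖ 1 with h | h
    · have : K ≤ A := norm_kernel_le ε m t x
      refine mul_le_mul (Real.rpow_le_rpow (by positivity) (by linarith) hn) ?_ hK (by positivity)
      linarith [abs_nonneg C₁, abs_nonneg C₂]
    · have h3 : (1 + ‖x‖) ^ ((n : ℝ) / 2) ≤ 2 ^ ((n : ℝ) / 2) * ‖x‖ ^ ((n : ℝ) / 2) := by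
        rw [← Real.mul_rpow (by norm_num) (norm_nonneg _)]
        exact Real.rpow_le_rpow (by positivity) (by linarith) hn
      have h4 : ‖x‖ ^ ((n : ℝ) / 2) * K ≤ |C₁| + |C₂| := by
        refine abs_le_of_sq_le_sq' ?_ (by positivity) |>.2
        have : (‖x‖ ^ ((n : ℝ) / 2) * K) ^ 2 = ‖x‖ ^ n * (K * K) := by
          have h5 : (‖x‖ ^ ((n : ℝ) / 2)) ^ 2 = ‖x‖ ^ n := by
            rw [← Real.rpow_natCast (‖x‖ ^ _), ← Real.rpow_mul (norm_nonneg _), Nat.cast_ofNat,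
              div_mul_cancel₀ _ two_ne_zero, Real.rpow_natCast]
          rw [mul_pow, h5, pow_two]
        rw [this]
        nlinarith [abs_nonneg C₁, abs_nonneg C₂]
      calc _ ≤ 2 ^ ((n : ℝ) / 2) * ‖x‖ ^ ((n : ℝ) / 2) * K := mul_le_mul_of_nonneg_right h3 hK
        _ = 2 ^ ((n : ℝ) / 2) * (‖x‖ ^ ((n : ℝ) / 2) * K) := by ring
        _ ≤ _ := mul_le_mul_of_nonneg_left (by linarith) (by positivity)
  rw [Real.rpow_neg (by positivity), ← div_eq_mul_inv, le_div_iff₀ (by positivity)]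
  linarith

end

/-! ### Non-stationary phase on a half-space. -/

section

variable {n : ℕ}

lemma tsupport_coordDeriv_subset (k : Fin n) (m : 𝓢(Space n, ℂ)) :
    tsupport (coordDeriv k m) ⊆ tsupport m :=
  SchwartzMap.tsupport_lineDerivOp_subset _ m

lemma tsupport_coordMul_subset (k : Fin n) (m : 𝓢(Space n, ℂ)) :
    tsupport (coordMul k m) ⊆ tsupport m :=
  (SchwartzMap.tsupport_smulLeftCLM_subset _ m).trans Set.inter_subset_left

/-- The derivative of the phase in the `i`-th direction is bounded below on the half-space
`{c ≤ σ ξᵢ}` when `x` lies on the side that is not reached by the flow. -/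
lemma le_abs_deriv_phase {a b c σ y : ℝ} (hc : 0 < c) (hσ : |σ| = 1)
    (hab : σ * (a * b) ≤ 0) (hy : c ≤ σ * y) : c * |b| ≤ |a - b * y| := by
  have h1 : a * b * y ≤ 0 := by
    have h2 : σ * (a * b) * (σ * y) ≤ 0 := mul_nonpos_of_nonpos_of_nonneg hab (hc.le.trans hy)
    have h3 : σ * σ = 1 := by rw [← abs_mul_abs_self, hσ, one_mul]
    have h4 : σ * (a * b) * (σ * y) = (σ * σ) * (a * b * y) := by ring
    rwa [h4, h3, one_mul] at h2
  have h5 : c ≤ |y| := by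
    have := hy.trans (le_abs_self _)
    rwa [abs_mul, hσ, one_mul] at this
  refine (mul_le_mul_of_nonneg_right h5 (abs_nonneg b)).trans ?_
  rw [← abs_mul]
  refine sq_le_sq.1 ?_
  nlinarith [sq_nonneg a]

/-- Non-stationary phase in the `i`-th direction. -/
lemma exists_norm_integral_wave_mul_inv_pow_le {i : Fin n} {c σ : ℝ} (hc : 0 < c) (hσ : |σ| = 1)
    (N : ℕ) :
    ∀ m : 𝓢(Space n, ℂ), tsupport m ⊆ {ξ | c ≤ σ * ξ i} → ∀ k : ℕ, ∃ C, 0 ≤ C ∧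
      ∀ ε, IsSigns ε → ∀ (t : ℝ) (x : Space n), t ≠ 0 → ε i * σ * (t * x i) ≤ 0 →
        ‖∫ ξ, wave ε t x ξ * ((((x i - 2 * t * ε i * ξ i)⁻¹ ^ k : ℝ) : ℂ) * m ξ)‖ ≤
          C * (|t|⁻¹) ^ (N + k) := by
  have hlow : ∀ ε : Fin n → ℝ, IsSigns ε → ∀ (t : ℝ) (x ξ : Space n),
      ε i * σ * (t * x i) ≤ 0 → c ≤ σ * ξ i → 2 * c * |t| ≤ |x i - 2 * t * ε i * ξ i| := by
    intro ε hε t x ξ h hξ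
    have h1 : |ε i| = 1 := by rcases hε i with h | h <;> simp [h]
    have := le_abs_deriv_phase (a := x i) (b := 2 * t * ε i) hc hσ (by nlinarith) hξ
    rw [abs_mul, abs_mul, h1, abs_two] at this
    linarith
  have hbd : ∀ m : 𝓢(Space n, ℂ), tsupport m ⊆ {ξ | c ≤ σ * ξ i} → ∀ k : ℕ, 
      ∀ ε, IsSigns ε → ∀ (t : ℝ) (x : Space n), t ≠ 0 → ε i * σ * (t * x i) ≤ 0 → ∀ ξ,
        ‖wave ε t x ξ * ((((x i - 2 * t * ε i * ξ i)⁻¹ ^ k : ℝ) : ℂ) * m ξ)‖ ≤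
          ((2 * c * |t|)⁻¹) ^ k * ‖m ξ‖ := by
    intro m hm k ε hε t x ht h ξ
    rw [norm_mul, norm_wave, one_mul, norm_mul]
    by_cases hξ : ξ ∈ tsupport m
    · refine mul_le_mul_of_nonneg_right ?_ (norm_nonneg _)
      rw [Complex.norm_real, norm_pow, norm_inv, Real.norm_eq_abs]
      have := abs_pos.2 ht
      exact pow_le_pow_left₀ (by positivity)
        (inv_anti₀ (by positivity) (hlow ε hε t x ξ h (hm hξ))) _
    · simp [image_eq_zero_of_notMem_tsupport hξ]
  have hint : ∀ m : 𝓢(Space n, ℂ), tsupport m ⊆ {ξ | c ≤ σ * ξ i} → ∀ k : ℕ, 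
      ∀ ε, IsSigns ε → ∀ (t : ℝ) (x : Space n), t ≠ 0 → ε i * σ * (t * x i) ≤ 0 →
        Integrable fun ξ => wave ε t x ξ * ((((x i - 2 * t * ε i * ξ i)⁻¹ ^ k : ℝ) : ℂ) * m ξ) := by
    intro m hm k ε hε t x ht h
    refine (m.integrable.norm.const_mul (((2 * c * |t|)⁻¹) ^ k)).mono' ?_
      (Filter.Eventually.of_forall (hbd m hm k ε hε t x ht h))
    refine (continuous_wave_right ε t x).aestronglyMeasurable.mul
      (Measurable.aestronglyMeasurable ?_ |>.mul m.continuous.aestronglyMeasurable)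
    have : Measurable fun ξ : Space n => ξ i := by fun_prop
    fun_prop
  -- Writing D = x_i - 2tε_iξ_i, each integration by parts against e^{iφ} replaces D^{-k} m by
  -- D^{-k-1} ∂_i m and t D^{-k-2} m. As |D| ≳ |t| on the support, both gain a factor 1/|t|; the
  -- exponent k is left general so that the induction closes.
  induction N with
  | zero =>
    intro m hm k
    refine ⟨((2 * c)⁻¹) ^ k * ∫ ξ, ‖m ξ‖, by positivity, fun ε hε t x ht h => ?_⟩
    refine (norm_integral_le_of_norm_le (m.integrable.norm.const_mul _)
      (Filter.Eventually.of_forall (hbd m hm k ε hε t x ht h))).trans_eq ?_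
    rw [integral_const_mul, mul_inv, mul_pow, zero_add]
    ring
  | succ N ih =>
    intro m hm k
    have hm' := (tsupport_coordDeriv_subset i m).trans hm
    obtain ⟨C₁, hC₁, h₁⟩ := ih (coordDeriv i m) hm' (k + 1)
    obtain ⟨C₂, hC₂, h₂⟩ := ih m hm (k + 2)
    refine ⟨C₁ + 2 * (k + 1) * C₂, by positivity, fun ε hε t x ht h => ?_⟩
    have hε1 : |ε i| = 1 := by rcases hε i with h | h <;> simp [h]
    have htpos := abs_pos.2 ht
    set D : Space n → ℝ := fun ξ => x i - 2 * t * ε i * ξ i with hDdef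
    have hD0 : ∀ ξ ∈ tsupport m, D ξ ≠ 0 := by
      intro ξ hξ
      have := hlow ε hε t x ξ h (hm hξ)
      exact abs_pos.1 (lt_of_lt_of_le (by positivity) this)
    have hDd : ∀ ξ, HasLineDerivAt ℝ D (-(2 * t * ε i)) ξ (EuclideanSpace.single i (1 : ℝ)) := by
      intro ξ
      unfold HasLineDerivAt
      have h1 : HasDerivAt (fun s : ℝ => x i - 2 * t * ε i * (ξ i + s)) (-(2 * t * ε i)) 0 := by
        have := (((hasDerivAt_id (0 : ℝ)).const_add (ξ i)).const_mul (2 * t * ε i)).const_sub (x i)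
        exact this.congr_deriv (by simp)
      simpa [D] using h1
    -- D may vanish off the support of m, where its inverse is 0 by convention; the identity
    -- survives because m vanishes there.
    have key : ∀ ξ, ContinuousLinearMap.mul ℝ ℂ
        (Complex.I * (D ξ : ℝ) * wave ε t x ξ * (((D ξ)⁻¹ ^ (k + 1) : ℝ) : ℂ) +
          wave ε t x ξ * (((k + 1) * (2 * t * ε i) * (D ξ)⁻¹ ^ (k + 2) : ℝ) : ℂ)) (m ξ) =
        Complex.I * (wave ε t x ξ * ((((D ξ)⁻¹ ^ k : ℝ) : ℂ) * m ξ)) +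
          ((k + 1) * (2 * t * ε i) : ℝ) *
            (wave ε t x ξ * ((((D ξ)⁻¹ ^ (k + 2) : ℝ) : ℂ) * m ξ)) := by
      intro ξ
      rw [ContinuousLinearMap.mul_apply']
      by_cases hξ : ξ ∈ tsupport m
      · have := hD0 ξ hξ
        have h3 : (D ξ : ℂ) * (((D ξ)⁻¹ ^ (k + 1) : ℝ) : ℂ) = (((D ξ)⁻¹ ^ k : ℝ) : ℂ) := by
          rw [← Complex.ofReal_mul, pow_succ', ← mul_assoc, mul_inv_cancel₀ this, one_mul]
        rw [← h3]
        push_cast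
        ring
      · simp [image_eq_zero_of_notMem_tsupport hξ]
    have hI1 : Integrable fun ξ => wave ε t x ξ * ((((D ξ)⁻¹ ^ k : ℝ) : ℂ) * m ξ) :=
      hint m hm k ε hε t x ht h
    have hI2 : Integrable fun ξ => wave ε t x ξ * ((((D ξ)⁻¹ ^ (k + 2) : ℝ) : ℂ) * m ξ) :=
      hint m hm (k + 2) ε hε t x ht h
    have hI3 : Integrable fun ξ =>
        wave ε t x ξ * ((((D ξ)⁻¹ ^ (k + 1) : ℝ) : ℂ) * coordDeriv i m ξ) :=
      hint _ hm' (k + 1) ε hε t x ht h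
    have hI4 : Integrable fun ξ => wave ε t x ξ * ((((D ξ)⁻¹ ^ (k + 1) : ℝ) : ℂ) * m ξ) :=
      hint m hm (k + 1) ε hε t x ht h
    have hparts := integral_bilinear_hasLineDerivAt_right_eq_neg_left_of_integrable
      (μ := (volume : Measure (Space n))) (B := ContinuousLinearMap.mul ℝ ℂ)
      (f := fun ξ => wave ε t x ξ * (((D ξ)⁻¹ ^ (k + 1) : ℝ) : ℂ))
      (f' := fun ξ => Complex.I * (D ξ : ℝ) * wave ε t x ξ * (((D ξ)⁻¹ ^ (k + 1) : ℝ) : ℂ) +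
          wave ε t x ξ * (((k + 1) * (2 * t * ε i) * (D ξ)⁻¹ ^ (k + 2) : ℝ) : ℂ))
      (g := m) (g' := coordDeriv i m) (v := EuclideanSpace.single i (1 : ℝ))
      (by simp_rw [key]; exact (hI1.const_mul _).add (hI2.const_mul _))
      (by simpa only [ContinuousLinearMap.mul_apply', mul_assoc] using hI3)
      (by simpa only [ContinuousLinearMap.mul_apply', mul_assoc] using hI4)
      (fun ξ hξ => by
        have h1 := hasLineDerivAt_wave ε t x ξ i
        have h2 := hDd ξ
        have h0 := hD0 ξ hξ
        unfold HasLineDerivAt at h1 h2 ⊢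
        have h00 : D (ξ + (0 : ℝ) • EuclideanSpace.single i (1 : ℝ)) = D ξ := by simp
        have h3 : HasDerivAt (fun s : ℝ =>
            (D (ξ + s • EuclideanSpace.single i (1 : ℝ)))⁻¹ ^ (k + 1))
            ((k + 1) * (2 * t * ε i) * (D ξ)⁻¹ ^ (k + 2)) 0 := by
          refine ((h2.inv (by rwa [h00])).pow (k + 1)).congr_deriv ?_
          simp only [Pi.inv_apply, h00, Nat.add_sub_cancel, neg_neg]
          push_cast
          rw [pow_add (D ξ)⁻¹ k 2, inv_pow (D ξ) 2]
          ring
        refine (h1.mul h3.ofReal_comp).congr_deriv ?_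
        rw [zero_smul, add_zero])
      (fun ξ _ => hasLineDerivAt_coordDeriv m ξ i)
    simp_rw [key] at hparts
    rw [integral_add (hI1.const_mul _) (hI2.const_mul _), integral_const_mul,
      integral_const_mul] at hparts
    simp only [ContinuousLinearMap.mul_apply', mul_assoc] at hparts
    set J₁ := ∫ ξ, wave ε t x ξ * ((((D ξ)⁻¹ ^ k : ℝ) : ℂ) * m ξ) with hJ₁
    set J₂ := ∫ ξ, wave ε t x ξ * ((((D ξ)⁻¹ ^ (k + 2) : ℝ) : ℂ) * m ξ) with hJ₂
    set J₃ := ∫ ξ, wave ε t x ξ * ((((D ξ)⁻¹ ^ (k + 1) : ℝ) : ℂ) * coordDeriv i m ξ) with hJ₃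
    have hJ : J₁ = Complex.I * (J₃ + ((k + 1) * (2 * (t * ε i)) : ℝ) * J₂) := by
      rw [hparts]
      linear_combination J₁ * Complex.I_sq
    have e₁ : ‖J₃‖ ≤ C₁ * (|t|⁻¹) ^ (N + (k + 1)) := h₁ ε hε t x ht h
    have e₂ : ‖J₂‖ ≤ C₂ * (|t|⁻¹) ^ (N + (k + 2)) := h₂ ε hε t x ht h
    rw [hJ, norm_mul, Complex.norm_I, one_mul]
    refine (norm_add_le _ _).trans ?_
    rw [norm_mul, Complex.norm_real, Real.norm_eq_abs, abs_mul, abs_mul, abs_mul, hε1,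
      abs_of_nonneg (by positivity : (0 : ℝ) ≤ (k : ℝ) + 1), abs_two, mul_one]
    have e₃ : |t| * (|t|⁻¹) ^ (N + (k + 2)) = (|t|⁻¹) ^ (N + (k + 1)) := by
      rw [← add_assoc N k 2, pow_succ' _ (N + k + 1), ← mul_assoc, mul_inv_cancel₀ htpos.ne',
        one_mul]
      rfl
    calc ‖J₃‖ + (k + 1) * (2 * |t|) * ‖J₂‖
        ≤ C₁ * (|t|⁻¹) ^ (N + (k + 1)) +
          (k + 1) * (2 * |t|) * (C₂ * (|t|⁻¹) ^ (N + (k + 2))) := by gcongr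
      _ = C₁ * (|t|⁻¹) ^ (N + (k + 1)) +
          2 * (k + 1) * C₂ * (|t| * (|t|⁻¹) ^ (N + (k + 2))) := by ring
      _ = _ := by rw [e₃, add_right_comm N 1 k, add_assoc N k 1]; ring

lemma exists_norm_kernel_le_inv_pow {i : Fin n} {c σ : ℝ} (hc : 0 < c) (hσ : |σ| = 1)
    (N : ℕ) (m : 𝓢(Space n, ℂ)) (hm : tsupport m ⊆ {ξ | c ≤ σ * ξ i}) :
    ∃ C, ∀ ε, IsSigns ε → ∀ (t : ℝ) (x : Space n), ε i * σ * (t * x i) ≤ 0 →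
      ‖kernel ε m t x‖ ≤ C * ((1 + |t|)⁻¹) ^ N := by
  obtain ⟨C, hC, h⟩ := exists_norm_integral_wave_mul_inv_pow_le hc hσ N m hm 0
  set A := ∫ ξ, ‖m ξ‖
  have hA : 0 ≤ A := integral_nonneg fun _ => norm_nonneg _
  refine ⟨2 ^ N * (A + C), fun ε hε t x hx => ?_⟩
  have hpos : 0 < 1 + |t| := by positivity
  rcases le_total |t| 1 with ht | ht
  · refine (norm_kernel_le ε m t x).trans ?_
    have : 1 ≤ 2 ^ N * ((1 + |t|)⁻¹) ^ N := by
      rw [← mul_pow, ← div_eq_mul_inv]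
      exact one_le_pow₀ ((one_le_div hpos).2 (by linarith))
    have h2 : 0 ≤ C * (2 ^ N * ((1 + |t|)⁻¹) ^ N) := by positivity
    nlinarith
  · have ht0 : t ≠ 0 := by rintro rfl; simp at ht; linarith
    have h1 := h ε hε t x ht0 hx
    simp only [pow_zero, Complex.ofReal_one, one_mul, add_zero] at h1
    refine h1.trans ?_
    have : |t|⁻¹ ^ N ≤ 2 ^ N * ((1 + |t|)⁻¹) ^ N := by
      rw [← mul_pow, ← div_eq_mul_inv]
      refine pow_le_pow_left₀ (by positivity) ?_ _
      rw [inv_eq_one_div, div_le_div_iff₀ (by linarith) hpos]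
      linarith
    calc C * |t|⁻¹ ^ N ≤ C * (2 ^ N * ((1 + |t|)⁻¹) ^ N) := by gcongr
      _ ≤ (A + C) * (2 ^ N * ((1 + |t|)⁻¹) ^ N) := by gcongr; linarith
      _ = _ := by ring

/-- Rapid decay of the kernel of `W_±(t) m(D)` on the side that is not reached by the flow. -/
lemma exists_norm_kernel_le_rapid {i : Fin n} {c σ : ℝ} (hc : 0 < c) (hσ : |σ| = 1)
    (N : ℕ) (m : 𝓢(Space n, ℂ)) (hm : tsupport m ⊆ {ξ | c ≤ σ * ξ i}) :
    ∃ C, 0 ≤ C ∧ ∀ ε, IsSigns ε → ∀ (t : ℝ) (x : Space n), ε i * σ * (t * x i) ≤ 0 →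
      ‖kernel ε m t x‖ ≤ C * (((1 + |t|)⁻¹) ^ N * ((1 + ‖x‖)⁻¹) ^ N) := by
  -- Of the 2N powers of decay in t, N are spent on the factor (1+|t|)^N that buys N powers of decay
  -- in x.
  obtain ⟨C₁, h₁⟩ := exists_norm_kernel_le_inv_pow hc hσ (N + N) m hm
  obtain ⟨C₂, h₂⟩ := exists_pow_mul_norm_kernel_le
    (S := {f : Unit → 𝓢(Space n, ℂ) | tsupport (f ()) ⊆ {ξ | c ≤ σ * ξ i}})
    (fun f hf k => (tsupport_coordDeriv_subset k (f ())).trans hf)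
    (fun f hf k => (tsupport_coordMul_subset k (f ())).trans hf)
    (R := fun ε t x => IsSigns ε ∧ ε i * σ * (t * x i) ≤ 0) (fun _ _ _ h => h.1)
    (w := fun t => ((1 + |t|)⁻¹) ^ (N + N)) (fun t => by positivity)
    (fun m hm => by
      obtain ⟨C, hC⟩ := exists_norm_kernel_le_inv_pow hc hσ (N + N) (m ()) hm
      exact ⟨C, fun _ ε t x h => hC ε h.1 t x h.2⟩) N (fun _ => m) hm
  refine ⟨2 ^ N * (|C₁| + |C₂|), by positivity, fun ε hε t x hx => ?_⟩
  have hpos : 0 < 1 + |t| := by positivity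
  have hposx : 0 < 1 + ‖x‖ := by positivity
  have h1 := h₁ ε hε t x hx
  have h2 := h₂ () ε t x ⟨hε, hx⟩
  set K := ‖kernel ε m t x‖
  have hK : 0 ≤ K := norm_nonneg _
  set T := ((1 + |t|)⁻¹) ^ N with hT
  have hT0 : 0 < T := by positivity
  have hT1 : T ≤ 1 := pow_le_one₀ (by positivity) (inv_le_one_of_one_le₀ (by linarith [abs_nonneg t]))
  have hTT : ((1 + |t|)⁻¹) ^ (N + N) = T * T := pow_add _ _ _
  have hT2 : (1 + |t|) ^ N * (T * T) = T := by
    rw [← mul_assoc, hT, ← mul_pow, mul_inv_cancel₀ hpos.ne', one_pow, one_mul]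
  simp only [hTT, hT2] at h1 h2
  have h1' : K ≤ |C₁| * T := by
    refine h1.trans ?_
    have : T * T ≤ T := mul_le_of_le_one_left hT0.le hT1
    exact mul_le_mul (le_abs_self _) this (by positivity) (abs_nonneg _)
  have h2' : ‖x‖ ^ N * K ≤ |C₂| * T := by
    refine h2.trans ?_
    exact mul_le_mul_of_nonneg_right (le_abs_self _) hT0.le
  have h3 : (1 + ‖x‖) ^ N ≤ 2 ^ N * (1 + ‖x‖ ^ N) := by
    rcases le_total ‖x‖ 1 with h | h
    · calc (1 + ‖x‖) ^ N ≤ 2 ^ N := pow_le_pow_left₀ hposx.le (by linarith) _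
        _ ≤ _ := le_mul_of_one_le_right (by positivity) (by linarith [pow_nonneg (norm_nonneg x) N])
    · calc (1 + ‖x‖) ^ N ≤ (2 * ‖x‖) ^ N := pow_le_pow_left₀ hposx.le (by linarith) _
        _ = 2 ^ N * ‖x‖ ^ N := mul_pow _ _ _
        _ ≤ _ := mul_le_mul_of_nonneg_left (by linarith) (by positivity)
  have h4 : (1 + ‖x‖) ^ N * K ≤ 2 ^ N * (|C₁| + |C₂|) * T := by
    calc (1 + ‖x‖) ^ N * K ≤ 2 ^ N * (1 + ‖x‖ ^ N) * K := mul_le_mul_of_nonneg_right h3 hK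
      _ = 2 ^ N * (K + ‖x‖ ^ N * K) := by ring
      _ ≤ 2 ^ N * (|C₁| * T + |C₂| * T) := by gcongr
      _ = _ := by ring
  rw [inv_pow (1 + ‖x‖), ← mul_assoc, ← div_eq_mul_inv, le_div_iff₀ (by positivity)]
  linarith

end

/-! ### Young's inequality and the T T* argument. -/

section

variable {n : ℕ}

/-- Young's inequality in trilinear form, with one exponent repeated. -/
lemma lintegral_mul_mul_sub_le {E : Type*} [AddCommGroup E] [MeasurableSpace E] [MeasurableAdd₂ E]
    [MeasurableNeg E] {μ : Measure E} [SFinite μ] [μ.IsAddLeftInvariant] [μ.IsNegInvariant]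
    {p : ℝ} (hp : 2 ≤ p) {f k : E → ℝ≥0∞} (hf : AEMeasurable f μ) (hk : Measurable k) :
    ∫⁻ z, f z.1 * f z.2 * k (z.1 - z.2) ∂(μ.prod μ) ≤
      (∫⁻ x, f x ^ (p / (p - 1)) ∂μ) ^ (2 - 2 / p) * (∫⁻ x, k x ^ (p / 2) ∂μ) ^ (2 / p) := by
  have hp0 : 0 < p := by linarith
  have hp1 : 0 < p - 1 := by linarith
  set q := p / (p - 1) with hq
  have hq0 : 0 < q := div_pos hp0 hp1
  set J := ∫⁻ x, f x ^ q ∂μ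
  set κ := ∫⁻ x, k x ^ (p / 2) ∂μ
  have hk' : Measurable fun z : E × E => k (z.1 - z.2) := by
    have : Measurable fun z : E × E => z.1 - z.2 := by
      simp_rw [sub_eq_add_neg]; fun_prop
    exact hk.comp this
  have hf1 : AEMeasurable (fun z : E × E => f z.1) (μ.prod μ) :=
    hf.comp_quasiMeasurePreserving Measure.quasiMeasurePreserving_fst
  have hf2 : AEMeasurable (fun z : E × E => f z.2) (μ.prod μ) :=
    hf.comp_quasiMeasurePreserving Measure.quasiMeasurePreserving_snd
  -- The integrand is factored as F₀^{1-2/p} F₁^{1/p} F₂^{1/p}, with q = p'. Hölder then leaves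
  -- three double integrals, each of which splits by translation invariance.
  let F : Fin 3 → E × E → ℝ≥0∞ := ![fun z => f z.1 ^ q * f z.2 ^ q,
    fun z => f z.1 ^ q * k (z.1 - z.2) ^ (p / 2), fun z => f z.2 ^ q * k (z.1 - z.2) ^ (p / 2)]
  let w : Fin 3 → ℝ := ![1 - 2 / p, 1 / p, 1 / p]
  have h2p : 0 ≤ 1 - 2 / p := by rw [sub_nonneg, div_le_one hp0]; exact hp
  have h1p : 0 ≤ 1 / p := by positivity
  have holder := ENNReal.lintegral_prod_norm_pow_le (μ := μ.prod μ) (Finset.univ : Finset (Fin 3))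
    (f := F) (p := w)
    (by
      intro i _
      fin_cases i
      · exact (hf1.pow_const _).mul (hf2.pow_const _)
      · exact (hf1.pow_const _).mul (hk'.aemeasurable.pow_const _)
      · exact (hf2.pow_const _).mul (hk'.aemeasurable.pow_const _))
    (by simp [w, Fin.sum_univ_three]; ring)
    (by
      intro i _
      fin_cases i
      · exact h2p
      · exact h1p
      · exact h1p)
  simp only [Fin.prod_univ_three] at holder
  have e0 : ∫⁻ z, F 0 z ∂(μ.prod μ) = J * J :=
    lintegral_prod_mul (hf.pow_const _) (hf.pow_const _)
  have e1 : ∫⁻ z, F 1 z ∂(μ.prod μ) = J * κ := by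
    change ∫⁻ z, f z.1 ^ q * k (z.1 - z.2) ^ (p / 2) ∂(μ.prod μ) = _
    rw [lintegral_prod (fun z : E × E => f z.1 ^ q * k (z.1 - z.2) ^ (p / 2)) ((hf1.pow_const _).mul (hk'.aemeasurable.pow_const _))]
    have : ∀ x, ∫⁻ y, f x ^ q * k (x - y) ^ (p / 2) ∂μ = f x ^ q * κ := by
      intro x
      rw [lintegral_const_mul]
      · rw [lintegral_sub_left_eq_self (fun y => k y ^ (p / 2)) x]
      · exact (hk'.comp measurable_prodMk_left).pow_const _
    simp_rw [this]
    rw [lintegral_mul_const'' _ (hf.pow_const _)]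
  have e2 : ∫⁻ z, F 2 z ∂(μ.prod μ) = J * κ := by
    change ∫⁻ z, f z.2 ^ q * k (z.1 - z.2) ^ (p / 2) ∂(μ.prod μ) = _
    rw [lintegral_prod_symm (fun z : E × E => f z.2 ^ q * k (z.1 - z.2) ^ (p / 2)) ((hf2.pow_const _).mul (hk'.aemeasurable.pow_const _))]
    have : ∀ y, ∫⁻ x, f y ^ q * k (x - y) ^ (p / 2) ∂μ = f y ^ q * κ := by
      intro y
      rw [lintegral_const_mul]
      · rw [lintegral_sub_right_eq_self (fun x => k x ^ (p / 2)) y]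
      · exact (hk'.comp measurable_prodMk_right).pow_const _
    simp_rw [this]
    rw [lintegral_mul_const'' _ (hf.pow_const _)]
  rw [e0, e1, e2] at holder
  have hpt : ∀ z : E × E, f z.1 * f z.2 * k (z.1 - z.2) =
      F 0 z ^ w 0 * F 1 z ^ w 1 * F 2 z ^ w 2 := by
    intro z
    have hr : ∀ a : ℝ≥0∞, a = (a ^ q) ^ (1 - 2 / p) * (a ^ q) ^ (1 / p) := by
      intro a
      rw [← ENNReal.rpow_add_of_nonneg _ _ h2p h1p, ← ENNReal.rpow_mul]
      have : q * (1 - 2 / p + 1 / p) = 1 := by rw [hq]; field_simp; ring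
      rw [this, ENNReal.rpow_one]
    have hr2 : ∀ a : ℝ≥0∞, a = (a ^ (p / 2)) ^ (1 / p) * (a ^ (p / 2)) ^ (1 / p) := by
      intro a
      rw [← ENNReal.rpow_add_of_nonneg _ _ h1p h1p, ← ENNReal.rpow_mul]
      have : p / 2 * (1 / p + 1 / p) = 1 := by field_simp; ring
      rw [this, ENNReal.rpow_one]
    change _ = (f z.1 ^ q * f z.2 ^ q) ^ (1 - 2 / p) *
      (f z.1 ^ q * k (z.1 - z.2) ^ (p / 2)) ^ (1 / p) *
      (f z.2 ^ q * k (z.1 - z.2) ^ (p / 2)) ^ (1 / p)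
    rw [ENNReal.mul_rpow_of_nonneg _ _ h2p, ENNReal.mul_rpow_of_nonneg _ _ h1p,
      ENNReal.mul_rpow_of_nonneg _ _ h1p]
    conv_lhs => rw [hr (f z.1), hr (f z.2), hr2 (k (z.1 - z.2))]
    ring
  simp_rw [hpt]
  refine holder.trans_eq ?_
  change (J * J) ^ (1 - 2 / p) * (J * κ) ^ (1 / p) * (J * κ) ^ (1 / p) = _
  rw [ENNReal.mul_rpow_of_nonneg _ _ h2p, ENNReal.mul_rpow_of_nonneg _ _ h1p]
  have eJ : J ^ (2 - 2 / p) = J ^ (1 - 2 / p) * J ^ (1 - 2 / p) * (J ^ (1 / p) * J ^ (1 / p)) := by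
    rw [← ENNReal.rpow_add_of_nonneg _ _ h2p h2p, ← ENNReal.rpow_add_of_nonneg _ _ h1p h1p,
      ← ENNReal.rpow_add_of_nonneg _ _ (by positivity) (by positivity)]
    congr 1
    ring
  have eκ : κ ^ (2 / p) = κ ^ (1 / p) * κ ^ (1 / p) := by
    rw [← ENNReal.rpow_add_of_nonneg _ _ h1p h1p]
    congr 1
    ring
  rw [eJ, eκ]
  ring

/-- The factorisation behind T T*: the convolution kernel is a superposition over ξ of rank-one
kernels. -/
lemma wave_sub (ε : Fin n → ℝ) (t s : ℝ) (x z ξ : Space n) :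
    wave ε (t - s) (x - z) ξ = wave ε t x ξ * (starRingEnd ℂ) (wave ε s z ξ) := by
  unfold wave
  rw [← Complex.exp_conj, ← Complex.exp_add]
  congr 1
  simp [phase, inner_sub_left]
  ring

lemma continuous_kernel (ε : Fin n → ℝ) (m : 𝓢(Space n, ℂ)) :
    Continuous fun p : ℝ × Space n => kernel ε m p.1 p.2 := by
  refine continuous_of_dominated (bound := fun ξ => ‖m ξ‖) (fun p => ?_) (fun p => ?_)
    m.integrable.norm ?_
  · exact ((continuous_wave_right ε p.1 p.2).mul m.continuous).aestronglyMeasurable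
  · exact Filter.Eventually.of_forall fun ξ => by rw [norm_mul, norm_wave, one_mul]
  · refine Filter.Eventually.of_forall fun ξ => ?_
    exact ((continuous_wave ε).comp
      (by fun_prop : Continuous fun p : ℝ × Space n => (p.1, p.2, ξ))).mul continuous_const

section TTstar

lemma enorm_conj (z : ℂ) : ‖(starRingEnd ℂ) z‖ₑ = ‖z‖ₑ := by
  rw [← ofReal_norm, RCLike.norm_conj, ofReal_norm]

variable {X Y : Type*} [MeasurableSpace X] [MeasurableSpace Y] {μ : Measure X} {ν : Measure Y}

lemma integrable_conj {g : X → ℂ} (hg : Integrable g μ) :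
    Integrable (fun r => (starRingEnd ℂ) (g r)) μ :=
  hg.congr' (Complex.continuous_conj.comp_aestronglyMeasurable hg.1)
    (Filter.Eventually.of_forall fun r => (RCLike.norm_conj (g r)).symm)

lemma measurable_wave_comp (ε : Fin n → ℝ) {a : X → ℝ} {b c : X → Space n}
    (ha : Measurable a) (hb : Measurable b) (hc : Measurable c) :
    Measurable fun r => wave ε (a r) (b r) (c r) := by
  have h : Measurable fun r => (a r, b r, c r) := ha.prodMk (hb.prodMk hc)
  have h2 : Measurable fun p : ℝ × Space n × Space n => wave ε p.1 p.2.1 p.2.2 :=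
    (continuous_wave ε).measurable
  exact h2.comp h

lemma integrable_mul_wave {ε : Fin n → ℝ} {g : X → ℂ} (hg : Integrable g μ) {a : X → ℝ}
    {b : X → Space n} (ha : Measurable a) (hb : Measurable b) (ξ : Space n) :
    Integrable (fun r => g r * wave ε (a r) (b r) ξ) μ :=
  hg.mul_bdd (c := 1) (measurable_wave_comp ε ha hb measurable_const).aestronglyMeasurable
    (Filter.Eventually.of_forall fun _ => (norm_wave _ _ _ _).le)

lemma continuous_integral_mul_wave {ε : Fin n → ℝ} {g : X → ℂ} (hg : Integrable g μ) {a : X → ℝ}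
    {b : X → Space n} (ha : Measurable a) (hb : Measurable b) :
    Continuous fun ξ => ∫ r, g r * wave ε (a r) (b r) ξ ∂μ := by
  refine continuous_of_dominated (bound := fun r => ‖g r‖) (fun ξ => ?_) (fun ξ => ?_)
    hg.norm ?_
  · exact (integrable_mul_wave hg ha hb ξ).1
  · exact Filter.Eventually.of_forall fun r => by rw [norm_mul, norm_wave, mul_one]
  · exact Filter.Eventually.of_forall fun r =>
      continuous_const.mul (continuous_wave_right ε _ _)

variable [SFinite μ] [SFinite ν]

/-- Fubini and `wave_sub` diagonalise the bilinear form in frequency. The space-time points are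
arbitrary measurable functions of parameters, so that one side can be a curve and the other a
hyperplane. -/
lemma integral_mul_mul_kernel (ε : Fin n → ℝ) (m : 𝓢(Space n, ℂ)) {g : X → ℂ} {f : Y → ℂ}
    (hg : Integrable g μ) (hf : Integrable f ν) {a : X → ℝ} {b : X → Space n}
    {a' : Y → ℝ} {b' : Y → Space n} (ha : Measurable a) (hb : Measurable b)
    (ha' : Measurable a') (hb' : Measurable b') :
    ∫ p, g p.1 * f p.2 * kernel ε m (a p.1 - a' p.2) (b p.1 - b' p.2) ∂(μ.prod ν) =
      ∫ ξ, m ξ * ((∫ r, g r * wave ε (a r) (b r) ξ ∂μ) *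
        ∫ z, f z * (starRingEnd ℂ) (wave ε (a' z) (b' z) ξ) ∂ν) := by
  have h1 : ∀ p : X × Y, g p.1 * f p.2 * kernel ε m (a p.1 - a' p.2) (b p.1 - b' p.2) =
      ∫ ξ, wave ε (a p.1 - a' p.2) (b p.1 - b' p.2) ξ * ((g p.1 * f p.2) * m ξ) := by
    intro p
    rw [kernel, ← integral_const_mul]
    congr with ξ
    ring
  simp_rw [h1]
  rw [integral_integral_swap]
  · refine integral_congr_ae (Filter.Eventually.of_forall fun ξ => ?_)
    simp only
    rw [← integral_prod_mul, ← integral_const_mul]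
    congr with p
    rw [wave_sub]
    ring
  · refine ((hg.mul_prod hf).mul_prod m.integrable).bdd_mul (c := 1)
      (Measurable.aestronglyMeasurable ?_)
      (Filter.Eventually.of_forall fun r => (norm_wave _ _ _ _).le)
    exact measurable_wave_comp ε (by fun_prop) (by fun_prop) measurable_snd

/-- The diagonal case, with g paired against its conjugate. Nonnegativity of m makes the frequency
integral equal to its own modulus, so absolute values need only be taken on the kernel side. -/
lemma lintegral_mul_sq_norm_le {ε : Fin n → ℝ} {m : 𝓢(Space n, ℂ)} {w : Space n → ℝ}
    (hw : ∀ ξ, 0 ≤ w ξ) (hmw : ∀ ξ, m ξ = w ξ) {g : X → ℂ}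
    (hg : Integrable g μ) {a : X → ℝ} {b : X → Space n} (ha : Measurable a) (hb : Measurable b) :
    ∫⁻ ξ, ‖m ξ‖ₑ * ‖∫ r, g r * wave ε (a r) (b r) ξ ∂μ‖ₑ ^ 2 ≤
      ∫⁻ p, ‖g p.1‖ₑ * ‖g p.2‖ₑ * ‖kernel ε m (a p.1 - a p.2) (b p.1 - b p.2)‖ₑ ∂(μ.prod μ) := by
  set Γ : Space n → ℂ := fun ξ => ∫ r, g r * wave ε (a r) (b r) ξ ∂μ
  have hg' := integrable_conj hg
  have hid := integral_mul_mul_kernel ε m hg hg' ha hb ha hb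
  have hconj : ∀ ξ, ∫ z, (starRingEnd ℂ) (g z) * (starRingEnd ℂ) (wave ε (a z) (b z) ξ) ∂μ =
      (starRingEnd ℂ) (Γ ξ) := by
    intro ξ
    rw [← integral_conj]
    simp
  simp_rw [hconj] at hid
  have hΓc : Continuous Γ := continuous_integral_mul_wave hg ha hb
  have hreal : ∀ ξ, m ξ * (Γ ξ * (starRingEnd ℂ) (Γ ξ)) = ((w ξ * ‖Γ ξ‖ ^ 2 : ℝ) : ℂ) := by
    intro ξ
    rw [Complex.mul_conj', hmw]
    push_cast
    rfl
  have hΓb : ∀ ξ, ‖Γ ξ‖ ≤ ∫ r, ‖g r‖ ∂μ := by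
    intro ξ
    refine (norm_integral_le_integral_norm _).trans_eq ?_
    simp [norm_wave]
  have hint : Integrable fun ξ => w ξ * ‖Γ ξ‖ ^ 2 := by
    have hwi : Integrable w := by
      refine m.integrable.re.congr (Filter.Eventually.of_forall fun ξ => ?_)
      simp [hmw]
    refine hwi.mul_bdd (c := (∫ r, ‖g r‖ ∂μ) ^ 2) (hΓc.norm.pow 2).aestronglyMeasurable
      (Filter.Eventually.of_forall fun ξ => ?_)
    rw [norm_pow, norm_norm]
    exact pow_le_pow_left₀ (norm_nonneg _) (hΓb ξ) 2
  have hl : ∫⁻ ξ, ‖m ξ‖ₑ * ‖Γ ξ‖ₑ ^ 2 = ‖∫ ξ, m ξ * (Γ ξ * (starRingEnd ℂ) (Γ ξ))‖ₑ := by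
    simp_rw [hreal]
    rw [integral_complex_ofReal, ← ofReal_norm, Complex.norm_real, Real.norm_of_nonneg (integral_nonneg fun ξ => mul_nonneg (hw ξ) (sq_nonneg _)),
      ofReal_integral_eq_lintegral_ofReal hint
        (Filter.Eventually.of_forall fun ξ => mul_nonneg (hw ξ) (sq_nonneg _))]
    refine lintegral_congr fun ξ => ?_
    rw [ENNReal.ofReal_mul (hw ξ), ENNReal.ofReal_pow (norm_nonneg _), ofReal_norm,
      hmw, ← ofReal_norm, Complex.norm_real, Real.norm_of_nonneg (hw ξ)]
  rw [hl, ← hid]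
  refine (enorm_integral_le_lintegral_enorm _).trans_eq ?_
  refine lintegral_congr fun p => ?_
  rw [enorm_mul, enorm_mul, enorm_conj]

/-- The `T T*` bound for the bilinear form of the kernel of `W_±(t) m(D)` with `m ≥ 0`. -/
lemma enorm_integral_mul_mul_kernel_le {ε : Fin n → ℝ} {m : 𝓢(Space n, ℂ)} {w : Space n → ℝ}
    (hw : ∀ ξ, 0 ≤ w ξ) (hmw : ∀ ξ, m ξ = w ξ) {g : X → ℂ} {f : Y → ℂ}
    (hg : Integrable g μ) (hf : Integrable f ν) {a : X → ℝ} {b : X → Space n}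
    {a' : Y → ℝ} {b' : Y → Space n} (ha : Measurable a) (hb : Measurable b)
    (ha' : Measurable a') (hb' : Measurable b') :
    ‖∫ p, g p.1 * f p.2 * kernel ε m (a p.1 - a' p.2) (b p.1 - b' p.2) ∂(μ.prod ν)‖ₑ ≤
      (∫⁻ p, ‖g p.1‖ₑ * ‖g p.2‖ₑ *
        ‖kernel ε m (a p.1 - a p.2) (b p.1 - b p.2)‖ₑ ∂(μ.prod μ)) ^ (1 / 2 : ℝ) *
      (∫⁻ p, ‖f p.1‖ₑ * ‖f p.2‖ₑ *
        ‖kernel ε m (a' p.1 - a' p.2) (b' p.1 - b' p.2)‖ₑ ∂(ν.prod ν)) ^ (1 / 2 : ℝ) := by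
  have hf' := integrable_conj hf
  rw [integral_mul_mul_kernel ε m hg hf ha hb ha' hb']
  set Γ : Space n → ℂ := fun ξ => ∫ r, g r * wave ε (a r) (b r) ξ ∂μ with hΓ
  set Φ : Space n → ℂ := fun ξ => ∫ z, f z * (starRingEnd ℂ) (wave ε (a' z) (b' z) ξ) ∂ν with hΦ
  have hΦ' : ∀ ξ, Φ ξ =
      (starRingEnd ℂ) (∫ z, (starRingEnd ℂ) (f z) * wave ε (a' z) (b' z) ξ ∂ν) := by
    intro ξ
    rw [← integral_conj]
    simp [hΦ]
  have b1 := lintegral_mul_sq_norm_le (ε := ε) hw hmw hg ha hb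
  have b2 := lintegral_mul_sq_norm_le (ε := ε) hw hmw hf' ha' hb'
  have c1 := continuous_integral_mul_wave (ε := ε) hg ha hb
  have c2 := continuous_integral_mul_wave (ε := ε) hf' ha' hb'
  refine (enorm_integral_le_lintegral_enorm _).trans ?_
  set Ψ : Space n → ℂ := fun ξ => ∫ z, (starRingEnd ℂ) (f z) * wave ε (a' z) (b' z) ξ ∂ν
  have e : ∀ ξ, ‖m ξ * (Γ ξ * Φ ξ)‖ₑ = (‖m ξ‖ₑ ^ (1 / 2 : ℝ) * ‖Γ ξ‖ₑ) *
      (‖m ξ‖ₑ ^ (1 / 2 : ℝ) * ‖Ψ ξ‖ₑ) := by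
    intro ξ
    have h1 : ‖Φ ξ‖ₑ = ‖Ψ ξ‖ₑ := by
      rw [hΦ' ξ, enorm_conj]
    have h2 : ‖m ξ‖ₑ = ‖m ξ‖ₑ ^ (1 / 2 : ℝ) * ‖m ξ‖ₑ ^ (1 / 2 : ℝ) := by
      rw [← ENNReal.rpow_add_of_nonneg _ _ (by norm_num) (by norm_num)]
      norm_num
    rw [enorm_mul, enorm_mul, h1]
    conv_lhs => rw [h2]
    ring
  rw [lintegral_congr e]
  have hsq : ∀ (ξ : Space n) (A : ℝ≥0∞), (‖m ξ‖ₑ ^ (1 / 2 : ℝ) * A) ^ (2 : ℝ) = ‖m ξ‖ₑ * A ^ 2 := by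
    intro ξ A
    rw [ENNReal.mul_rpow_of_nonneg _ _ (by norm_num), ← ENNReal.rpow_mul]
    norm_num
  refine (ENNReal.lintegral_mul_le_Lp_mul_Lq volume (p := 2) (q := 2) ⟨by norm_num, by norm_num, by norm_num⟩
    ?_ ?_).trans ?_
  · exact (m.continuous.enorm.measurable.pow_const _).mul c1.enorm.measurable |>.aemeasurable
  · exact (m.continuous.enorm.measurable.pow_const _).mul c2.enorm.measurable |>.aemeasurable
  · simp_rw [hsq]
    refine mul_le_mul' (ENNReal.rpow_le_rpow b1 (by norm_num))
      (ENNReal.rpow_le_rpow (b2.trans_eq ?_) (by norm_num))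
    refine lintegral_congr fun p => ?_
    rw [enorm_conj, enorm_conj]

end TTstar

end

/-! ### Slices by hyperplanes, weights, and the absolutely convergent error term. -/

section

variable {n : ℕ}

instance (e : Space n) : (hyperplaneMeasure e).IsAddHaarMeasure := by
  unfold hyperplaneMeasure; infer_instance

instance (e : Space n) :
    ((volume : Measure ℝ).prod (hyperplaneMeasure e)).IsNegInvariant := by
  apply Measure.IsAddHaarMeasure.isNegInvariant_of_regular

section Slices

variable {e : Space n}

lemma inner_coe_orthogonal (v : (ℝ ∙ e)ᗮ) : inner ℝ e (v : Space n) = 0 :=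
  Submodule.mem_orthogonal_singleton_iff_inner_right.1 v.2

/-- The coordinates `(r, v) ↦ r e + v` adapted to a unit vector `e`. -/
def sliceEquiv (he : ‖e‖ = 1) : (ℝ × (ℝ ∙ e)ᗮ) ≃L[ℝ] Space n :=
  LinearEquiv.toContinuousLinearEquiv
    { toFun := fun z => z.1 • e + (z.2 : Space n)
      map_add' := fun z w => by simp [add_smul]; abel
      map_smul' := fun c z => by simp [mul_smul]
      invFun := fun x => (inner ℝ e x, ⟨x - (inner ℝ e x) • e, by
        rw [Submodule.mem_orthogonal_singleton_iff_inner_right, inner_sub_right, inner_smul_right,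
          real_inner_self_eq_norm_sq, he]
        ring⟩)
      left_inv := fun z => by
        have h : inner ℝ e (z.1 • e + (z.2 : Space n)) = z.1 := by
          rw [inner_add_right, inner_smul_right, real_inner_self_eq_norm_sq, he,
            inner_coe_orthogonal]
          ring
        ext1
        · exact h
        · apply Subtype.ext
          simp [h]
      right_inv := fun x => by simp }

/-- Lebesgue measure in the coordinates adapted to `e`, up to a normalisation. -/
lemma exists_volume_eq_smul_map (he : ‖e‖ = 1) :
    ∃ c : ℝ≥0, c ≠ 0 ∧ (volume : Measure (Space n)) =
      c • ((volume : Measure ℝ).prod (hyperplaneMeasure e)).map (sliceEquiv he) := by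
  have := (sliceEquiv he).isAddHaarMeasure_map ((volume : Measure ℝ).prod (hyperplaneMeasure e))
  have h := Measure.isAddLeftInvariant_eq_smul (volume : Measure (Space n))
    (((volume : Measure ℝ).prod (hyperplaneMeasure e)).map (sliceEquiv he))
  refine ⟨_, fun hc => ?_, h⟩
  rw [hc, zero_smul] at h
  exact NeZero.ne _ h

end Slices

/-- The weight `(1 + |x|)^{-N}`. -/
def weight {E : Type*} [Norm E] (N : ℕ) (x : E) : ℝ≥0∞ := ENNReal.ofReal (((1 + ‖x‖)⁻¹) ^ N)

/-- The weight `(1 + |x|)^{-n/2}` on `ℝⁿ`. -/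
def dispWeight (x : Space n) : ℝ≥0∞ := ENNReal.ofReal ((1 + ‖x‖) ^ (-((n : ℝ) / 2)))

lemma measurable_weight {E : Type*} [NormedAddCommGroup E] [MeasurableSpace E] [BorelSpace E]
    (N : ℕ) : Measurable (weight N : E → ℝ≥0∞) := by
  unfold weight
  have : Measurable fun x : E => ‖x‖ := measurable_norm
  fun_prop

lemma measurable_dispWeight : Measurable (dispWeight : Space n → ℝ≥0∞) := by
  unfold dispWeight
  have : Measurable fun x : Space n => ‖x‖ := measurable_norm
  fun_prop

lemma lintegral_weight_lt_top {E : Type*} [NormedAddCommGroup E] [NormedSpace ℝ E]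
    [FiniteDimensional ℝ E] [MeasurableSpace E] [BorelSpace E] (μ : Measure E)
    [μ.IsAddHaarMeasure] {N : ℕ} (hN : Module.finrank ℝ E < N) :
    ∫⁻ x : E, weight N x ∂μ < ⊤ := by
  have h := finite_integral_one_add_norm (μ := μ) (E := E) (r := (N : ℝ)) (by exact_mod_cast hN)
  refine lt_of_eq_of_lt (lintegral_congr fun x => ?_) h
  rw [weight, Real.rpow_neg (by positivity), Real.rpow_natCast, inv_pow]

lemma finrank_orthogonal_lt {e : Space n} (he : ‖e‖ = 1) :
    Module.finrank ℝ (ℝ ∙ e)ᗮ < n := by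
  have h1 := Submodule.finrank_add_finrank_orthogonal (ℝ ∙ e)
  rw [finrank_euclideanSpace, Fintype.card_fin, finrank_span_singleton
    (by rintro rfl; simp at he)] at h1
  omega

/-- The weight on `ℝ × P_e` that dominates the kernels on the hyperplane. -/
def sliceWeight {e : Space n} (z : ℝ × (ℝ ∙ e)ᗮ) : ℝ≥0∞ := weight (2 * n) z.1 * weight n z.2

lemma measurable_sliceWeight {e : Space n} :
    Measurable (sliceWeight : ℝ × (ℝ ∙ e)ᗮ → ℝ≥0∞) :=
  ((measurable_weight _).comp measurable_fst).mul ((measurable_weight _).comp measurable_snd)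

lemma lintegral_sliceWeight_lt_top (hn : 2 ≤ n) {e : Space n} (he : ‖e‖ = 1) :
    ∫⁻ z, sliceWeight z ∂((volume : Measure ℝ).prod (hyperplaneMeasure e)) < ⊤ := by
  unfold sliceWeight
  rw [lintegral_prod_mul (measurable_weight _).aemeasurable (measurable_weight _).aemeasurable]
  exact ENNReal.mul_lt_top
    (lintegral_weight_lt_top (N := 2 * n) volume (by rw [Module.finrank_self]; omega))
    (lintegral_weight_lt_top _ (finrank_orthogonal_lt he))

lemma weight_le_one {E : Type*} [NormedAddCommGroup E] (N : ℕ) (x : E) : weight N x ≤ 1 := by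
  rw [weight, ENNReal.ofReal_le_one]
  exact pow_le_one₀ (by positivity) (inv_le_one_of_one_le₀ (by linarith [norm_nonneg x]))

/-- With z = y e + v, the inequality 1+|x-x'| ≤ (1+|x-z|)(1+|x'-z|) uses n powers of each weight.
Another n powers at x give decay in v, because the orthogonal projection is a contraction. The
result is uniform in y. -/
lemma weight_mul_weight_le {e : Space n} (x x' : Space n) (y : ℝ) (v : (ℝ ∙ e)ᗮ) :
    weight (2 * n) (x - (y • e + (v : Space n))) * weight (2 * n) (x' - (y • e + (v : Space n))) ≤
      dispWeight (x - x') * weight n ((ℝ ∙ e)ᗮ.orthogonalProjectionOnto x - v) := by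
  set z : Space n := y • e + (v : Space n)
  set P := (ℝ ∙ e)ᗮ.orthogonalProjectionOnto
  have hPz : P z = v := by
    simp only [z, map_add, map_smul]
    have h1 : P e = 0 := by
      rw [Submodule.orthogonalProjectionOnto_eq_zero_iff, Submodule.orthogonal_orthogonal]
      exact Submodule.mem_span_singleton_self e
    have h2 : P (v : Space n) = v := Submodule.orthogonalProjectionOnto_mem_subspace_eq_self v
    rw [h1, h2]; simp
  have hP : ‖P x - v‖ ≤ ‖x - z‖ := by
    rw [← hPz, ← map_sub]
    exact Submodule.norm_orthogonalProjectionOnto_apply_le _ _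
  unfold weight dispWeight
  rw [← ENNReal.ofReal_mul (by positivity), ← ENNReal.ofReal_mul (by positivity)]
  refine ENNReal.ofReal_le_ofReal ?_
  set a := 1 + ‖x - z‖
  set b := 1 + ‖x' - z‖
  set q := 1 + ‖x - x'‖
  have ha : 1 ≤ a := by simp [a]
  have hb : 1 ≤ b := by simp [b]
  have hq1 : 1 ≤ q := by simp [q]
  have hq : q ≤ a * b := by
    have : ‖x - x'‖ ≤ ‖x - z‖ + ‖x' - z‖ := by
      have h := norm_sub_le (x - z) (x' - z)
      rwa [sub_sub_sub_cancel_right] at h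
    simp only [a, b, q]
    nlinarith [norm_nonneg (x - z), norm_nonneg (x' - z)]
  have h1 : (a⁻¹ * b⁻¹) ^ n ≤ q ^ (-((n : ℝ) / 2)) := by
    have h2 : (a⁻¹ * b⁻¹) ^ n ≤ (q⁻¹) ^ n := by
      refine pow_le_pow_left₀ (by positivity) ?_ n
      rw [← mul_inv]
      exact inv_anti₀ (by positivity) hq
    refine h2.trans ?_
    rw [inv_pow, ← Real.rpow_natCast, ← Real.rpow_neg (by positivity)]
    refine Real.rpow_le_rpow_of_exponent_le hq1 ?_
    have : (0 : ℝ) ≤ n := by positivity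
    linarith
  have h3 : (a⁻¹) ^ n ≤ ((1 + ‖P x - v‖)⁻¹) ^ n :=
    pow_le_pow_left₀ (by positivity) (inv_anti₀ (by positivity) (by simpa [a] using hP)) n
  have h4 : (b⁻¹) ^ n ≤ 1 := pow_le_one₀ (by positivity) (inv_le_one_of_one_le₀ hb)
  calc a⁻¹ ^ (2 * n) * b⁻¹ ^ (2 * n) = ((a⁻¹ * b⁻¹) ^ n * a⁻¹ ^ n) * b⁻¹ ^ n := by
        rw [mul_pow]; ring
    _ ≤ ((a⁻¹ * b⁻¹) ^ n * a⁻¹ ^ n) * 1 := mul_le_mul_of_nonneg_left h4 (by positivity)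
    _ ≤ _ := by
      rw [mul_one]
      exact mul_le_mul h1 h3 (by positivity) (by positivity)

variable {R : Type*} [MeasurableSpace R]

/-- The quadratic form in `g` that controls the bilinear forms. -/
def dispEnergy (ρ : Measure R) (g : R → ℂ) (x : R → Space n) : ℝ≥0∞ :=
  ∫⁻ p, ‖g p.1‖ₑ * ‖g p.2‖ₑ * dispWeight (x p.1 - x p.2) ∂(ρ.prod ρ)

/-- For a rapidly decaying kernel, oscillation is not needed. Cauchy–Schwarz in z isolates ‖f‖₂, and
expanding the square of the remaining integral gives a double integral in g whose inner z-integral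
is controlled by `weight_mul_weight_le`. The quadratic form in g is the same as in the T T* bound.
-/
lemma lintegral_mul_weight_le {e : Space n} {ρ : Measure R} [SFinite ρ] {g : R → ℂ}
    (hg : AEMeasurable g ρ) {t : R → ℝ} {x : R → Space n} (ht : Measurable t) (hx : Measurable x)
    (y : ℝ) {f : ℝ × (ℝ ∙ e)ᗮ → ℂ}
    (hf : AEMeasurable f ((volume : Measure ℝ).prod (hyperplaneMeasure e))) :
    ∫⁻ p, ‖g p.1‖ₑ * ‖f p.2‖ₑ * (weight (2 * n) (t p.1 - p.2.1) *
        weight (2 * n) (x p.1 - (y • e + (p.2.2 : Space n))))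
        ∂(ρ.prod ((volume : Measure ℝ).prod (hyperplaneMeasure e))) ≤
      (∫⁻ z, ‖f z‖ₑ ^ 2 ∂((volume : Measure ℝ).prod (hyperplaneMeasure e))) ^ (1 / 2 : ℝ) *
      (dispEnergy ρ g x * ∫⁻ z, sliceWeight z
        ∂((volume : Measure ℝ).prod (hyperplaneMeasure e))) ^ (1 / 2 : ℝ) := by
  set ν := (volume : Measure ℝ).prod (hyperplaneMeasure e)
  set k : R × (ℝ × (ℝ ∙ e)ᗮ) → ℝ≥0∞ := fun p => weight (2 * n) (t p.1 - p.2.1) *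
        weight (2 * n) (x p.1 - (y • e + (p.2.2 : Space n))) with hk
  have hkm : Measurable k := by
    refine ((measurable_weight _).comp ?_).mul ((measurable_weight _).comp ?_)
    · fun_prop
    · fun_prop
  have hν : ν.IsNegInvariant := by
    simp only [ν]; infer_instance
  have hν' : ν.IsAddLeftInvariant := by
    simp only [ν]; infer_instance
  have hge : AEMeasurable (fun r => ‖g r‖ₑ) ρ := hg.enorm
  have hfe : AEMeasurable (fun z => ‖f z‖ₑ) ν := hf.enorm
  have hg1 : AEMeasurable (fun p : R × (ℝ × (ℝ ∙ e)ᗮ) => ‖g p.1‖ₑ) (ρ.prod ν) :=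
    hge.comp_quasiMeasurePreserving Measure.quasiMeasurePreserving_fst
  have hf2 : AEMeasurable (fun p : R × (ℝ × (ℝ ∙ e)ᗮ) => ‖f p.2‖ₑ) (ρ.prod ν) :=
    hfe.comp_quasiMeasurePreserving Measure.quasiMeasurePreserving_snd
  have hgk : AEMeasurable (fun p : R × (ℝ × (ℝ ∙ e)ᗮ) => ‖g p.1‖ₑ * k p) (ρ.prod ν) :=
    hg1.mul hkm.aemeasurable
  rw [lintegral_prod_symm (fun p => ‖g p.1‖ₑ * ‖f p.2‖ₑ * k p) ((hg1.mul hf2).mul hkm.aemeasurable)]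
  set Φ : ℝ × (ℝ ∙ e)ᗮ → ℝ≥0∞ := fun z => ∫⁻ r, ‖g r‖ₑ * k (r, z) ∂ρ with hΦ
  have hΦm : AEMeasurable Φ ν := hgk.prod_swap.lintegral_prod_right'
  have hgz : ∀ z, AEMeasurable (fun r => ‖g r‖ₑ * k (r, z)) ρ := fun z =>
    hge.mul (hkm.comp measurable_prodMk_right).aemeasurable
  have h1 : ∀ z, ∫⁻ r, ‖g r‖ₑ * ‖f z‖ₑ * k (r, z) ∂ρ = ‖f z‖ₑ * Φ z := by
    intro z
    rw [hΦ, ← lintegral_const_mul'' _ (hgz z)]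
    refine lintegral_congr fun r => ?_
    ring
  simp_rw [h1]
  refine (ENNReal.lintegral_mul_le_Lp_mul_Lq ν (p := 2) (q := 2)
    ⟨by norm_num, by norm_num, by norm_num⟩ hfe hΦm).trans ?_
  simp_rw [ENNReal.rpow_two]
  refine mul_le_mul' le_rfl (ENNReal.rpow_le_rpow ?_ (by norm_num))
  have h2 : ∀ z, Φ z ^ 2 =
      ∫⁻ q, (‖g q.1‖ₑ * k (q.1, z)) * (‖g q.2‖ₑ * k (q.2, z)) ∂(ρ.prod ρ) := by
    intro z
    rw [lintegral_prod_mul (hgz z) (hgz z), pow_two]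
  simp_rw [h2]
  rw [lintegral_lintegral_swap]
  · unfold dispEnergy
    have hDm : AEMeasurable (fun p : R × R => ‖g p.1‖ₑ * ‖g p.2‖ₑ * dispWeight (x p.1 - x p.2))
        (ρ.prod ρ) := by
      refine ((hge.comp_quasiMeasurePreserving Measure.quasiMeasurePreserving_fst).mul
        (hge.comp_quasiMeasurePreserving Measure.quasiMeasurePreserving_snd)).mul
        (measurable_dispWeight.comp ?_).aemeasurable
      fun_prop
    rw [← lintegral_mul_const'' _ hDm]
    refine lintegral_mono fun q => ?_
    have h3 : ∀ z : ℝ × (ℝ ∙ e)ᗮ, (‖g q.1‖ₑ * k (q.1, z)) * (‖g q.2‖ₑ * k (q.2, z)) ≤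
        (‖g q.1‖ₑ * ‖g q.2‖ₑ * dispWeight (x q.1 - x q.2)) *
          sliceWeight ((t q.1, (ℝ ∙ e)ᗮ.orthogonalProjectionOnto (x q.1)) - z) := by
      intro z
      have h4 := weight_mul_weight_le (x q.1) (x q.2) y z.2
      have h5 : weight (2 * n) (t q.2 - z.1) ≤ 1 := weight_le_one _ _
      calc (‖g q.1‖ₑ * k (q.1, z)) * (‖g q.2‖ₑ * k (q.2, z))
          = ‖g q.1‖ₑ * ‖g q.2‖ₑ * weight (2 * n) (t q.1 - z.1) *
            (weight (2 * n) (x q.1 - (y • e + (z.2 : Space n))) *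
            weight (2 * n) (x q.2 - (y • e + (z.2 : Space n)))) *
            weight (2 * n) (t q.2 - z.1) := by simp only [hk]; ring
        _ ≤ ‖g q.1‖ₑ * ‖g q.2‖ₑ * weight (2 * n) (t q.1 - z.1) *
            (dispWeight (x q.1 - x q.2) *
              weight n ((ℝ ∙ e)ᗮ.orthogonalProjectionOnto (x q.1) - z.2)) * 1 := by gcongr
        _ = _ := by rw [sliceWeight, Prod.fst_sub, Prod.snd_sub]; ring
    refine (lintegral_mono h3).trans_eq ?_
    rw [lintegral_const_mul, lintegral_sub_left_eq_self (fun z => sliceWeight z)]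
    refine measurable_sliceWeight.comp ?_
    exact measurable_const.sub measurable_id
  · have hm1 : AEMeasurable (fun p : (ℝ × (ℝ ∙ e)ᗮ) × (R × R) => ‖g p.2.1‖ₑ) (ν.prod (ρ.prod ρ)) :=
      (hge.comp_quasiMeasurePreserving Measure.quasiMeasurePreserving_fst
        ).comp_quasiMeasurePreserving Measure.quasiMeasurePreserving_snd
    have hm2 : AEMeasurable (fun p : (ℝ × (ℝ ∙ e)ᗮ) × (R × R) => ‖g p.2.2‖ₑ) (ν.prod (ρ.prod ρ)) :=
      (hge.comp_quasiMeasurePreserving Measure.quasiMeasurePreserving_snd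
        ).comp_quasiMeasurePreserving Measure.quasiMeasurePreserving_snd
    refine (hm1.mul (hkm.comp ?_).aemeasurable).mul (hm2.mul (hkm.comp ?_).aemeasurable)
    · fun_prop
    · fun_prop

end

/-! ### Removing the time cutoff on a single slice. -/

section

variable {n : ℕ}

/-- The time cutoff `1_{s ≤ t} - 1_{s ≤ 0}`, which turns an integral over `ℝ` into one over `[0, t]`. -/
def timeCutoff (t s : ℝ) : ℝ := (if s ≤ t then 1 else 0) - (if s ≤ 0 then 1 else 0)

lemma abs_timeCutoff_le (t s : ℝ) : |timeCutoff t s| ≤ 1 := by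
  unfold timeCutoff; split_ifs <;> simp

lemma measurable_timeCutoff : Measurable fun p : ℝ × ℝ => timeCutoff p.1 p.2 := by
  unfold timeCutoff
  refine (Measurable.ite (measurableSet_le measurable_snd measurable_fst) measurable_const
    measurable_const).sub (Measurable.ite (measurableSet_le measurable_snd measurable_const)
    measurable_const measurable_const)

variable {R : Type*} [MeasurableSpace R]

lemma dispEnergy_mono {ρ : Measure R} {g g' : R → ℂ} (x : R → Space n)
    (h : ∀ r, ‖g r‖ ≤ ‖g' r‖) : dispEnergy ρ g x ≤ dispEnergy ρ g' x := by
  have h' : ∀ r, ‖g r‖ₑ ≤ ‖g' r‖ₑ := fun r => enorm_le_iff_norm_le.2 (h r)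
  exact lintegral_mono fun p => by gcongr <;> apply h'

/-- Pointwise bounds for the kernel of `W_±(t) m(D)`: the uniform dispersive decay, and the rapid
decay on the side of the hyperplane `{xᵢ = 0}` that is not reached by the flow. -/
structure KernelBounds (ε : Fin n → ℝ) (m : Space n → ℂ) (i : Fin n) (κ : ℝ) (C : ℝ≥0) : Prop where
  disp : ∀ t x, ‖kernel ε m t x‖ₑ ≤ C * dispWeight x
  rapid : ∀ (t : ℝ) (x : Space n), κ * (t * x i) ≤ 0 →
    ‖kernel ε m t x‖ₑ ≤ C * (weight (2 * n) t * weight (2 * n) x)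

lemma weight_anti {E : Type*} [NormedAddCommGroup E] {M N : ℕ} (h : M ≤ N) (x : E) :
    weight N x ≤ weight M x :=
  ENNReal.ofReal_le_ofReal
    (pow_le_pow_of_le_one (by positivity)
      (inv_le_one_of_one_le₀ (by linarith [norm_nonneg x])) h)

section

variable {i : Fin n}

/-- The `i`-th coordinate vector. -/
abbrev coordVec (i : Fin n) : Space n := EuclideanSpace.single i (1 : ℝ)

/-- The measure on `ℝ × P_e` for `e` the `i`-th coordinate vector. -/
def sliceMeasure (i : Fin n) : Measure (ℝ × (ℝ ∙ coordVec i)ᗮ) :=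
  (volume : Measure ℝ).prod (hyperplaneMeasure (coordVec i))

instance : SFinite (sliceMeasure i) := by unfold sliceMeasure; infer_instance

lemma coord_coe_orthogonal (v : (ℝ ∙ coordVec i)ᗮ) : (v : Space n) i = 0 := by
  simpa [EuclideanSpace.inner_single_left] using inner_coe_orthogonal v

lemma coord_slice (y : ℝ) (v : (ℝ ∙ coordVec i)ᗮ) : (y • coordVec i + (v : Space n)) i = y := by
  simp [coord_coe_orthogonal v]

lemma integrable_mul_mul_kernel {ε : Fin n → ℝ} {m : 𝓢(Space n, ℂ)} {ρ : Measure R} [SFinite ρ]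
    {Y : Type*} [MeasurableSpace Y] {ν : Measure Y} [SFinite ν] {g : R → ℂ} {f : Y → ℂ}
    (hg : Integrable g ρ) (hf : Integrable f ν) {t : R → ℝ} {x : R → Space n}
    (ht : Measurable t) (hx : Measurable x) {s : Y → ℝ} {z : Y → Space n}
    (hs : Measurable s) (hz : Measurable z) :
    Integrable (fun p : R × Y => g p.1 * f p.2 * kernel ε m (t p.1 - s p.2) (x p.1 - z p.2))
      (ρ.prod ν) := by
  refine (hg.mul_prod hf).mul_bdd (c := ∫ ξ, ‖m ξ‖) ?_
    (Filter.Eventually.of_forall fun p => norm_kernel_le _ _ _ _)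
  have h : Measurable fun p : ℝ × Space n => kernel ε m p.1 p.2 :=
    (continuous_kernel ε m).measurable
  have h2 : Measurable fun p : R × Y => (t p.1 - s p.2, x p.1 - z p.2) := by fun_prop
  exact (h.comp h2).aestronglyMeasurable

/-- The T T* bound between a curve and a slice, without time cutoff. On the curve the dispersive
bound is used. Two points of the slice differ by a vector with vanishing i-th coordinate, so the
rapid bound applies and the form in f is bounded on L² by Young's inequality with p = 2. -/
lemma enorm_integral_slice_le {ε : Fin n → ℝ} {m : 𝓢(Space n, ℂ)} {w : Space n → ℝ}
    (hw : ∀ ξ, 0 ≤ w ξ) (hmw : ∀ ξ, m ξ = w ξ) {κ : ℝ} {C : ℝ≥0}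
    (hK : KernelBounds ε m i κ C) {ρ : Measure R} [SFinite ρ] {g : R → ℂ} (hg : Integrable g ρ)
    {t : R → ℝ} {x : R → Space n} (ht : Measurable t) (hx : Measurable x) (y : ℝ)
    {f : ℝ × (ℝ ∙ coordVec i)ᗮ → ℂ} (hf : Integrable f (sliceMeasure i)) :
    ‖∫ p, g p.1 * f p.2 * kernel ε m (t p.1 - p.2.1) (x p.1 - (y • coordVec i + (p.2.2 : Space n)))
        ∂(ρ.prod (sliceMeasure i))‖ₑ ≤
      C * ((∫⁻ z, ‖f z‖ₑ ^ 2 ∂(sliceMeasure i)) ^ (1 / 2 : ℝ) *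
        (dispEnergy ρ g x * ∫⁻ z, sliceWeight z ∂(sliceMeasure i)) ^ (1 / 2 : ℝ)) := by
  have hs : Measurable fun z : ℝ × (ℝ ∙ coordVec i)ᗮ => z.1 := measurable_fst
  have hz : Measurable fun z : ℝ × (ℝ ∙ coordVec i)ᗮ => y • coordVec i + (z.2 : Space n) := by fun_prop
  refine (enorm_integral_mul_mul_kernel_le (ε := ε) hw hmw hg hf ht hx hs hz).trans ?_
  have b1 : ∫⁻ p, ‖g p.1‖ₑ * ‖g p.2‖ₑ * ‖kernel ε m (t p.1 - t p.2) (x p.1 - x p.2)‖ₑ ∂(ρ.prod ρ) ≤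
      C * dispEnergy ρ g x := by
    unfold dispEnergy
    rw [← lintegral_const_mul' _ _ ENNReal.coe_ne_top]
    refine lintegral_mono fun p => ?_
    refine (mul_le_mul_right (hK.disp _ _) _).trans_eq ?_
    ring
  have b2 : ∫⁻ p, ‖f p.1‖ₑ * ‖f p.2‖ₑ * ‖kernel ε m (p.1.1 - p.2.1)
      (y • coordVec i + (p.1.2 : Space n) - (y • coordVec i + (p.2.2 : Space n)))‖ₑ
        ∂((sliceMeasure i).prod (sliceMeasure i)) ≤
      C * ((∫⁻ z, ‖f z‖ₑ ^ 2 ∂(sliceMeasure i)) * ∫⁻ z, sliceWeight z ∂(sliceMeasure i)) := by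
    have hY := lintegral_mul_mul_sub_le (μ := (volume : Measure ℝ).prod (hyperplaneMeasure (coordVec i)))
      (p := 2) le_rfl (f := fun z => ‖f z‖ₑ) (k := sliceWeight) hf.1.aemeasurable.enorm
      measurable_sliceWeight
    have e2 : (2 : ℝ) - 1 = 1 := by norm_num
    have e3 : (2 : ℝ) / 2 = 1 := by norm_num
    simp only [e2, e3, div_one, ENNReal.rpow_one, ENNReal.rpow_two] at hY
    refine le_trans ?_ (mul_le_mul_right hY _)
    rw [← lintegral_const_mul' _ _ ENNReal.coe_ne_top]
    refine lintegral_mono fun p => ?_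
    have h1 : y • coordVec i + (p.1.2 : Space n) - (y • coordVec i + (p.2.2 : Space n)) =
        ((p.1.2 - p.2.2 : (ℝ ∙ coordVec i)ᗮ) : Space n) := by
      simp
    have h2 := hK.rapid (p.1.1 - p.2.1) ((p.1.2 - p.2.2 : (ℝ ∙ coordVec i)ᗮ) : Space n)
      (by rw [coord_coe_orthogonal]; simp)
    have h3 : weight (2 * n) ((p.1.2 - p.2.2 : (ℝ ∙ coordVec i)ᗮ) : Space n) ≤ weight n (p.1.2 - p.2.2) :=
      weight_anti (by omega) (p.1.2 - p.2.2)
    rw [h1]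
    calc _ ≤ ‖f p.1‖ₑ * ‖f p.2‖ₑ * (C * (weight (2 * n) (p.1.1 - p.2.1) *
          weight n (p.1.2 - p.2.2))) := by gcongr; exact h2.trans (by gcongr)
      _ = C * (‖f p.1‖ₑ * ‖f p.2‖ₑ * sliceWeight (p.1 - p.2)) := by
          rw [sliceWeight, Prod.fst_sub, Prod.snd_sub]; ring
  refine (mul_le_mul' (ENNReal.rpow_le_rpow b1 (by norm_num))
    (ENNReal.rpow_le_rpow b2 (by norm_num))).trans_eq ?_
  have hh : (0 : ℝ) ≤ 1 / 2 := by norm_num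
  have hC : (C : ℝ≥0∞) ^ (1 / 2 : ℝ) * (C : ℝ≥0∞) ^ (1 / 2 : ℝ) = C := by
    rw [← ENNReal.rpow_add_of_nonneg _ _ hh hh]; norm_num
  simp only [ENNReal.mul_rpow_of_nonneg _ _ hh]
  conv_rhs => rw [← hC]
  ring

lemma enorm_integral_le_of_eq_sub_add {X : Type*} [MeasurableSpace X] {μ : Measure X}
    {H A B D : X → ℂ} (h : ∀ p, H p = A p - B p + D p) (hA : Integrable A μ) (hB : Integrable B μ)
    {a b d : ℝ≥0∞} (ha : ‖∫ p, A p ∂μ‖ₑ ≤ a) (hb : ‖∫ p, B p ∂μ‖ₑ ≤ b)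
    (hD : Integrable D μ) (hd : ∫⁻ p, ‖D p‖ₑ ∂μ ≤ d) : ‖∫ p, H p ∂μ‖ₑ ≤ a + b + d := by
  have e : ∫ p, H p ∂μ = (∫ p, A p ∂μ) - (∫ p, B p ∂μ) + ∫ p, D p ∂μ := by
    rw [← integral_sub' hA hB, ← integral_add' (hA.sub hB) hD]
    exact integral_congr_ae (Filter.Eventually.of_forall h)
  rw [e]
  exact (enorm_add_le _ _).trans (add_le_add (enorm_sub_le.trans (add_le_add ha hb))
    ((enorm_integral_le_lintegral_enorm _).trans hd))

/-- The discrepancy between the time cutoff `1_{s ≤ t}` and the half space `{κ (xᵢ - y) > 0}`. -/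
def cutoffError (κ : ℝ) (a b : ℝ) : ℂ :=
  (if 0 ≤ a then 1 else 0) - (if 0 < κ * b then 1 else 0)

lemma measurable_cutoffError (κ : ℝ) : Measurable fun p : ℝ × ℝ => cutoffError κ p.1 p.2 := by
  unfold cutoffError
  exact (Measurable.ite (measurableSet_le measurable_const measurable_fst) measurable_const
    measurable_const).sub (Measurable.ite (measurableSet_lt measurable_const
      (measurable_snd.const_mul κ)) measurable_const measurable_const)

lemma norm_cutoffError_le (κ a b : ℝ) : ‖cutoffError κ a b‖ ≤ 1 := by
  unfold cutoffError; split_ifs <;> simp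

/-- Under the hypothesis a and κb have the same sign, hence the error lives exactly where
`KernelBounds.rapid` is available. -/
lemma cutoffError_eq_zero {κ a b : ℝ} (h : 0 < κ * (a * b)) : cutoffError κ a b = 0 := by
  have h' : 0 < a * (κ * b) := by linarith
  unfold cutoffError
  rcases pos_and_pos_or_neg_and_neg_of_mul_pos h' with ⟨h1, h2⟩ | ⟨h1, h2⟩
  · rw [if_pos h1.le, if_pos h2]; simp
  · rw [if_neg (by linarith), if_neg (by linarith)]; simp

lemma KernelBounds.enorm_mul_cutoffError_le {ε : Fin n → ℝ} {m : Space n → ℂ} {κ : ℝ} {C : ℝ≥0}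
    (hK : KernelBounds ε m i κ C) (t : ℝ) (x : Space n) :
    ‖kernel ε m t x * cutoffError κ t (x i)‖ₑ ≤ C * (weight (2 * n) t * weight (2 * n) x) := by
  by_cases h : κ * (t * x i) ≤ 0
  · rw [enorm_mul]
    refine (mul_le_of_le_one_right' ?_).trans (hK.rapid _ _ h)
    have := enorm_le_iff_norm_le.2 ((norm_cutoffError_le κ t (x i)).trans_eq (norm_one (α := ℂ)).symm)
    simpa using this
  · rw [cutoffError_eq_zero (not_le.1 h)]; simp

/-- Used with b = x_i - y on the slice {z_i = y}. The condition s ≤ t couples both points, whereas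
the first indicator on the right sees only x and the second only s. -/
lemma timeCutoff_eq (κ a s b : ℝ) (t : ℝ) (h : a = t - s) : (timeCutoff t s : ℂ) =
    (if 0 < κ * b then 1 else 0) - (if s ≤ 0 then 1 else 0) + cutoffError κ a b := by
  subst h
  unfold cutoffError timeCutoff
  simp only [Complex.ofReal_sub, apply_ite Complex.ofReal, Complex.ofReal_one,
      Complex.ofReal_zero, sub_nonneg]
  ring

/-- The three terms of `timeCutoff_eq` give the factor 3. The first restricts g to `P`, the second
restricts f to `N`, and neither increases the right-hand side of the T T* bound. The third is
handled by `lintegral_mul_weight_le`. -/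
lemma enorm_integral_timeCutoff_slice_le {ε : Fin n → ℝ} {m : 𝓢(Space n, ℂ)} {w : Space n → ℝ}
    (hw : ∀ ξ, 0 ≤ w ξ) (hmw : ∀ ξ, m ξ = w ξ) {κ : ℝ} {C : ℝ≥0}
    (hK : KernelBounds ε m i κ C) {ρ : Measure R} [SFinite ρ] {g : R → ℂ} (hg : Integrable g ρ)
    {t : R → ℝ} {x : R → Space n} (ht : Measurable t) (hx : Measurable x) (y : ℝ)
    {f : ℝ × (ℝ ∙ coordVec i)ᗮ → ℂ} (hf : Integrable f (sliceMeasure i)) :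
    ‖∫ p, g p.1 * f p.2 * (timeCutoff (t p.1) p.2.1 *
        kernel ε m (t p.1 - p.2.1) (x p.1 - (y • coordVec i + (p.2.2 : Space n))))
        ∂(ρ.prod (sliceMeasure i))‖ₑ ≤
      3 * C * ((∫⁻ z, ‖f z‖ₑ ^ 2 ∂(sliceMeasure i)) ^ (1 / 2 : ℝ) *
        (dispEnergy ρ g x * ∫⁻ z, sliceWeight z ∂(sliceMeasure i)) ^ (1 / 2 : ℝ)) := by
  have hs : Measurable fun z : ℝ × (ℝ ∙ coordVec i)ᗮ => z.1 := measurable_fst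
  have hz : Measurable fun z : ℝ × (ℝ ∙ coordVec i)ᗮ => y • coordVec i + (z.2 : Space n) := by fun_prop
  have hxi : Measurable fun r => x r i := by fun_prop
  obtain ⟨P, hPdef⟩ : ∃ P : Set R, P = {r | 0 < κ * (x r i - y)} := ⟨_, rfl⟩
  have hP : MeasurableSet P := by
    rw [hPdef]; exact measurableSet_lt measurable_const ((hxi.sub_const y).const_mul κ)
  obtain ⟨N, hNdef⟩ : ∃ N : Set (ℝ × (ℝ ∙ coordVec i)ᗮ), N = {z | z.1 ≤ 0} := ⟨_, rfl⟩
  have hN : MeasurableSet N := by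
    rw [hNdef]; exact measurableSet_le measurable_fst measurable_const
  have hgP : Integrable (P.indicator g) ρ := hg.indicator hP
  have hfN : Integrable (N.indicator f) (sliceMeasure i) := hf.indicator hN
  have hI1 := integrable_mul_mul_kernel (ε := ε) (m := m) hgP hf ht hx hs hz
  have hI2 := integrable_mul_mul_kernel (ε := ε) (m := m) hg hfN ht hx hs hz
  have hI0 := integrable_mul_mul_kernel (ε := ε) (m := m) hg hf ht hx hs hz
  have hEm : Measurable fun p : R × (ℝ × (ℝ ∙ coordVec i)ᗮ) =>
      cutoffError κ (t p.1 - p.2.1) (x p.1 i - y) := by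
    have h : Measurable fun p : R × (ℝ × (ℝ ∙ coordVec i)ᗮ) => (t p.1 - p.2.1, x p.1 i - y) := by
      fun_prop
    exact (measurable_cutoffError κ).comp h
  have hI3 := hI0.mul_bdd hEm.aestronglyMeasurable
    (Filter.Eventually.of_forall fun p => norm_cutoffError_le _ _ _)
  obtain ⟨Q, hQ⟩ : ∃ Q, Q = (∫⁻ z, ‖f z‖ₑ ^ 2 ∂(sliceMeasure i)) ^ (1 / 2 : ℝ) *
        (dispEnergy ρ g x * ∫⁻ z, sliceWeight z ∂(sliceMeasure i)) ^ (1 / 2 : ℝ) := ⟨_, rfl⟩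
  have b1 := enorm_integral_slice_le hw hmw hK hgP ht hx y hf
  have b2 := enorm_integral_slice_le hw hmw hK hg ht hx y hfN
  have b1' : (∫⁻ z, ‖f z‖ₑ ^ 2 ∂(sliceMeasure i)) ^ (1 / 2 : ℝ) *
        (dispEnergy ρ (P.indicator g) x * ∫⁻ z, sliceWeight z ∂(sliceMeasure i)) ^ (1 / 2 : ℝ) ≤
      Q := by
    have := dispEnergy_mono (ρ := ρ) x (fun r => norm_indicator_le_norm_self g (s := P) r)
    rw [hQ]
    gcongr
  have b2' : (∫⁻ z, ‖N.indicator f z‖ₑ ^ 2 ∂(sliceMeasure i)) ^ (1 / 2 : ℝ) *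
        (dispEnergy ρ g x * ∫⁻ z, sliceWeight z ∂(sliceMeasure i)) ^ (1 / 2 : ℝ) ≤ Q := by
    rw [hQ]
    gcongr with z
    exact enorm_le_iff_norm_le.2 (norm_indicator_le_norm_self f z)
  rw [← hQ, show 3 * (C : ℝ≥0∞) * Q = C * Q + C * Q + C * Q by ring]
  refine enorm_integral_le_of_eq_sub_add (fun p => ?_) hI1 hI2
    (b1.trans (mul_le_mul_right b1' _)) (b2.trans (mul_le_mul_right b2' _)) hI3 ?_
  · have hNi : N.indicator f p.2 = f p.2 * (if p.2.1 ≤ 0 then 1 else 0) := by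
      simp only [Set.indicator_apply, hNdef, Set.mem_ofPred_eq]
      split_ifs <;> simp
    have hPi : P.indicator g p.1 = g p.1 * (if 0 < κ * (x p.1 i - y) then 1 else 0) := by
      simp only [Set.indicator_apply, hPdef, Set.mem_ofPred_eq]
      split_ifs <;> simp
    rw [hNi, hPi, timeCutoff_eq κ _ _ (x p.1 i - y) _ rfl]
    ring
  · have h := lintegral_mul_weight_le (e := coordVec i) hg.1.aemeasurable ht hx y hf.1.aemeasurable
    rw [hQ]
    refine le_trans ?_ (mul_le_mul_right h (C : ℝ≥0∞))
    rw [← lintegral_const_mul' _ _ ENNReal.coe_ne_top]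
    refine lintegral_mono fun p => ?_
    have hc : (x p.1 - (y • coordVec i + (p.2.2 : Space n))) i = x p.1 i - y := by
      rw [PiLp.sub_apply, coord_slice]
    have hKE := hK.enorm_mul_cutoffError_le (t p.1 - p.2.1)
      (x p.1 - (y • coordVec i + (p.2.2 : Space n)))
    rw [hc, enorm_mul] at hKE
    simp only [enorm_mul]
    calc _ = ‖g p.1‖ₑ * ‖f p.2‖ₑ * (‖kernel ε m (t p.1 - p.2.1) (x p.1 - (y • coordVec i +
          (p.2.2 : Space n)))‖ₑ * ‖cutoffError κ (t p.1 - p.2.1) (x p.1 i - y)‖ₑ) := by ring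
      _ ≤ _ := mul_le_mul_right hKE _
      _ = _ := by ring

end

end

/-! ### Summing the slices: the norm in a coordinate direction. -/

section

variable {n : ℕ}

lemma measurePreserving_prod_leftComm {α β γ : Type*} [MeasurableSpace α] [MeasurableSpace β]
    [MeasurableSpace γ] (μ : Measure α) (ν : Measure β) (τ : Measure γ) [SFinite μ] [SFinite ν]
    [SFinite τ] :
    MeasurePreserving (fun p : α × β × γ => (p.2.1, p.1, p.2.2)) (μ.prod (ν.prod τ))
      (ν.prod (μ.prod τ)) :=
  (measurePreserving_prodAssoc ν μ τ).comp
    ((Measure.measurePreserving_swap.prod (MeasurePreserving.id τ)).comp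
      (measurePreserving_prodAssoc μ ν τ).symm)

/-- The map `(y, s, v) ↦ (s, y e + v)`. -/
def sliceMap (e : Space n) (p : ℝ × ℝ × (ℝ ∙ e)ᗮ) : ℝ × Space n :=
  (p.2.1, p.1 • e + (p.2.2 : Space n))

lemma continuous_sliceMap (e : Space n) : Continuous (sliceMap e) := by
  unfold sliceMap
  fun_prop

lemma exists_measurePreserving_sliceMap {e : Space n} (he : ‖e‖ = 1) :
    ∃ (c : ℝ≥0) (μ : Measure (ℝ × Space n)), c ≠ 0 ∧ SFinite μ ∧ volume = c • μ ∧
      MeasurePreserving (sliceMap e)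
        ((volume : Measure ℝ).prod ((volume : Measure ℝ).prod (hyperplaneMeasure e))) μ := by
  obtain ⟨c, hc, h⟩ := exists_volume_eq_smul_map he
  have hm : Measurable (sliceEquiv he) := (sliceEquiv he).continuous.measurable
  refine ⟨c, (volume : Measure ℝ).prod
    (((volume : Measure ℝ).prod (hyperplaneMeasure e)).map (sliceEquiv he)), hc, inferInstance, ?_, ?_⟩
  · rw [Measure.volume_eq_prod, h, Measure.prod_smul_right]
  · exact ((MeasurePreserving.id (volume : Measure ℝ)).prod (hm.measurePreserving _)).comp
      (measurePreserving_prod_leftComm _ _ _)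

/-- Integration over `ρ × ℝ × ℝⁿ`, slice by slice. -/
lemma exists_integral_prod_eq_slices {R : Type*} [MeasurableSpace R] {e : Space n} (he : ‖e‖ = 1) :
    ∃ c : ℝ≥0, ∀ (ρ : Measure R) [SFinite ρ] (F : R × ℝ × Space n → ℂ), Integrable F (ρ.prod volume) →
      ∫ p, F p ∂(ρ.prod volume) = c • ∫ y : ℝ, ∫ p : R × ℝ × (ℝ ∙ e)ᗮ, F (p.1, sliceMap e (y, p.2))
        ∂(ρ.prod ((volume : Measure ℝ).prod (hyperplaneMeasure e))) := by
  obtain ⟨c, μ, hc, hμ, hv, hS⟩ := exists_measurePreserving_sliceMap he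
  refine ⟨c, fun ρ _ F hF => ?_⟩
  have hmp : MeasurePreserving (fun p : ℝ × R × ℝ × (ℝ ∙ e)ᗮ => (p.2.1, sliceMap e (p.1, p.2.2)))
      ((volume : Measure ℝ).prod (ρ.prod ((volume : Measure ℝ).prod (hyperplaneMeasure e))))
      (ρ.prod μ) :=
    ((MeasurePreserving.id ρ).prod hS).comp (measurePreserving_prod_leftComm _ _ _)
  rw [hv, Measure.prod_smul_right] at hF ⊢
  have hF' : Integrable F (ρ.prod μ) :=
    (integrable_smul_measure (c := (c : ℝ≥0∞)) (by exact_mod_cast hc) ENNReal.coe_ne_top).1 hF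
  rw [integral_smul_nnreal_measure]
  congr 1
  have hF2 : AEStronglyMeasurable F (Measure.map (fun p : ℝ × R × ℝ × (ℝ ∙ e)ᗮ =>
      (p.2.1, sliceMap e (p.1, p.2.2))) ((volume : Measure ℝ).prod (ρ.prod ((volume : Measure ℝ).prod
        (hyperplaneMeasure e))))) := by rw [hmp.map_eq]; exact hF'.1
  rw [← hmp.map_eq, integral_map hmp.aemeasurable hF2]
  exact integral_prod (fun p : ℝ × R × ℝ × (ℝ ∙ e)ᗮ => F (p.2.1, sliceMap e (p.1, p.2.2)))
    (hmp.integrable_comp_of_integrable hF')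

lemma ae_integrable_slice {e : Space n} (he : ‖e‖ = 1) {G : ℝ × Space n → ℂ} (hG : Integrable G) :
    ∀ᵐ y : ℝ, Integrable (fun z => G (sliceMap e (y, z)))
      ((volume : Measure ℝ).prod (hyperplaneMeasure e)) := by
  obtain ⟨c, μ, hc, hμ, hv, hS⟩ := exists_measurePreserving_sliceMap he
  rw [hv] at hG
  have hG' : Integrable G μ :=
    (integrable_smul_measure (c := (c : ℝ≥0∞)) (by exact_mod_cast hc) ENNReal.coe_ne_top).1 hG
  exact (hS.integrable_comp_of_integrable hG').prod_right_ae

/-- The `L^{1,2}_e` norm for the `i`-th coordinate vector `e`, written with lower integrals. -/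
lemma anisoNorm_one_two (e : Space n) (G : ℝ → Space n → ℂ) : anisoNorm 1 2 e G =
    ∫⁻ y : ℝ, (∫⁻ z, ‖G z.1 (y • e + (z.2 : Space n))‖ₑ ^ 2
      ∂((volume : Measure ℝ).prod (hyperplaneMeasure e))) ^ (1 / 2 : ℝ) := by
  unfold anisoNorm
  rw [eLpNorm_one_eq_lintegral_enorm]
  refine lintegral_congr fun y => ?_
  rw [enorm_eq_self, eLpNorm_eq_lintegral_rpow_enorm_toReal (by norm_num) (by norm_num)]
  simp

lemma integrable_mul_mul_timeCutoff_kernel {R : Type*} [MeasurableSpace R] {ε : Fin n → ℝ}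
    {m : 𝓢(Space n, ℂ)} {ρ : Measure R} [SFinite ρ] {g : R → ℂ} (hg : Integrable g ρ)
    {t : R → ℝ} {x : R → Space n} (ht : Measurable t) (hx : Measurable x) {G : ℝ × Space n → ℂ}
    (hG : Integrable G) :
    Integrable (fun p : R × ℝ × Space n => g p.1 * G p.2 * (timeCutoff (t p.1) p.2.1 *
      kernel ε m (t p.1 - p.2.1) (x p.1 - p.2.2))) (ρ.prod volume) := by
  have hsi := integrable_mul_mul_kernel (ε := ε) (m := m) hg hG ht hx (s := Prod.fst) (z := Prod.snd)
    measurable_fst measurable_snd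
  have hth : Measurable fun p : R × ℝ × Space n => (timeCutoff (t p.1) p.2.1 : ℂ) := by
    have h : Measurable fun p : R × ℝ × Space n => (t p.1, p.2.1) := by fun_prop
    exact Complex.measurable_ofReal.comp (measurable_timeCutoff.comp h)
  refine (hsi.mul_bdd (c := 1) hth.aestronglyMeasurable
      (Filter.Eventually.of_forall fun p => ?_)).congr (Filter.Eventually.of_forall fun p => ?_)
  · rw [Complex.norm_real]; exact abs_timeCutoff_le _ _
  · ring

/-- Fubini over the slices and the triangle inequality in y turn the L² norms of the slices into the
L^{1,2} norm. The constant sees the kernel only through C, hence is uniform in the signs, the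
measure ρ and the chosen points. -/
lemma exists_enorm_integral_timeCutoff_le (hn : 2 ≤ n) (i : Fin n) {R : Type*} [MeasurableSpace R]
    (C : ℝ≥0) :
    ∃ D : ℝ≥0, ∀ (ε : Fin n → ℝ) (m : 𝓢(Space n, ℂ)) (w : Space n → ℝ) (_ : ∀ ξ, 0 ≤ w ξ)
      (_ : ∀ ξ, m ξ = w ξ) (κ : ℝ) (_ : KernelBounds ε m i κ C) (ρ : Measure R) (_ : SFinite ρ)
      (g : R → ℂ) (_ : Integrable g ρ) (t : R → ℝ) (x : R → Space n) (_ : Measurable t)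
      (_ : Measurable x) (G : ℝ × Space n → ℂ) (_ : Integrable G) (_ : Continuous G),
      ‖∫ p, g p.1 * G p.2 * (timeCutoff (t p.1) p.2.1 * kernel ε m (t p.1 - p.2.1) (x p.1 - p.2.2))
        ∂(ρ.prod volume)‖ₑ ≤
      D * (dispEnergy ρ g x ^ (1 / 2 : ℝ) *
        anisoNorm 1 2 (coordVec i) (fun s z => G (s, z))) := by
  have he : ‖coordVec i‖ = 1 := by simp
  obtain ⟨c, hc⟩ := exists_integral_prod_eq_slices (R := R) he
  have hW := lintegral_sliceWeight_lt_top hn he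
  obtain ⟨W, hWe⟩ : ∃ W : ℝ≥0, (W : ℝ≥0∞) = (∫⁻ z, sliceWeight z ∂(sliceMeasure i)) ^ (1 / 2 : ℝ) :=
    ⟨_, ENNReal.coe_toNNReal (ENNReal.rpow_lt_top_of_nonneg (by norm_num) hW.ne).ne⟩
  -- Here c normalises Lebesgue measure in slice coordinates, 3C is the single-slice constant, and W
  -- is the square root of the mass of `sliceWeight`.
  refine ⟨c * (3 * C) * W, fun ε m w hw hmw κ hK ρ _ g hg t x ht hx G hG hGc => ?_⟩
  have hF := integrable_mul_mul_timeCutoff_kernel (ε := ε) (m := m) hg ht hx hG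
  rw [hc ρ _ hF, anisoNorm_one_two, NNReal.smul_def, enorm_smul]
  have hmeas : Measurable fun y : ℝ => (∫⁻ z, ‖G (z.1, y • coordVec i + (z.2 : Space n))‖ₑ ^ 2
      ∂((volume : Measure ℝ).prod (hyperplaneMeasure (coordVec i)))) ^ (1 / 2 : ℝ) := by
    have h : Measurable fun p : ℝ × ℝ × (ℝ ∙ coordVec i)ᗮ => ‖G (sliceMap (coordVec i) p)‖ₑ ^ 2 :=
      ((hGc.comp (continuous_sliceMap _)).measurable.enorm).pow_const 2
    exact h.lintegral_prod_right'.pow_const _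
  have hb : ‖∫ y : ℝ, ∫ p : R × ℝ × (ℝ ∙ coordVec i)ᗮ,
      (fun p : R × ℝ × Space n => g p.1 * G p.2 * (timeCutoff (t p.1) p.2.1 *
      kernel ε m (t p.1 - p.2.1) (x p.1 - p.2.2))) (p.1, sliceMap (coordVec i) (y, p.2))
        ∂(ρ.prod ((volume : Measure ℝ).prod (hyperplaneMeasure (coordVec i))))‖ₑ ≤
      ∫⁻ y : ℝ, (3 * C * W * dispEnergy ρ g x ^ (1 / 2 : ℝ)) *
        (∫⁻ z, ‖G (z.1, y • coordVec i + (z.2 : Space n))‖ₑ ^ 2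
      ∂((volume : Measure ℝ).prod (hyperplaneMeasure (coordVec i)))) ^ (1 / 2 : ℝ) := by
    refine (enorm_integral_le_lintegral_enorm _).trans (lintegral_mono_ae ?_)
    filter_upwards [ae_integrable_slice he hG] with y hy
    refine (enorm_integral_timeCutoff_slice_le hw hmw hK hg ht hx y hy).trans_eq ?_
    rw [ENNReal.mul_rpow_of_nonneg _ _ (by norm_num), hWe]
    unfold sliceMeasure sliceMap
    ring
  rw [lintegral_const_mul _ hmeas] at hb
  refine (mul_le_mul_right hb _).trans_eq ?_
  have : ‖(c : ℝ)‖ₑ = c := by simp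
  rw [this]
  push_cast
  ring

end

/-! ### Frequency decomposition into half-spaces. -/

section

variable {n : ℕ}

/-- Otherwise ‖ξ‖ ≤ ∑ |ξ_i| ≤ 1/4. This provides the constant c of the half-spaces that cover the
annulus. -/
lemma exists_lt_abs_coord {ξ : Space n} (hξ : 1 / 2 ≤ ‖ξ‖) : ∃ i, 1 / (4 * (n : ℝ)) < |ξ i| := by
  by_contra h
  push Not at h
  have h1 : ∑ i, |ξ i| ≤ ∑ _i : Fin n, 1 / (4 * (n : ℝ)) := Finset.sum_le_sum fun i _ => h i
  have h2 := norm_le_sum_abs ξ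
  rcases Nat.eq_zero_or_pos n with rfl | hn
  · rw [Subsingleton.elim ξ 0, norm_zero] at hξ; norm_num at hξ
  · have : ((n : ℝ)) ≠ 0 := by positivity
    have h3 : ∑ _i : Fin n, 1 / (4 * (n : ℝ)) = 1 / 4 := by
      rw [Finset.sum_const, Finset.card_univ, Fintype.card_fin, nsmul_eq_mul]; field_simp
    linarith

/-- The sign `±1` attached to a Boolean. -/
def boolSign (b : Bool) : ℝ := if b then 1 else -1

lemma abs_boolSign (b : Bool) : |boolSign b| = 1 := by cases b <;> simp [boolSign]

lemma exists_kernelBounds {i : Fin n} {c σ : ℝ} (hc : 0 < c) (hσ : |σ| = 1) (m : 𝓢(Space n, ℂ))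
    (hm : tsupport m ⊆ {ξ | c ≤ σ * ξ i}) :
    ∃ C, ∀ ε, IsSigns ε → KernelBounds ε m i (ε i * σ) C := by
  obtain ⟨C₁, h₁, H₁⟩ := exists_norm_kernel_le_uniform m
  obtain ⟨C₂, h₂, H₂⟩ := exists_norm_kernel_le_rapid hc hσ (2 * n) m hm
  have h0 : 0 ≤ C₁ + C₂ := by positivity
  refine ⟨(C₁ + C₂).toNNReal, fun ε hε => ⟨fun t x => ?_, fun t x h => ?_⟩⟩
  · rw [dispWeight, ← ofReal_norm, ENNReal.ofNNReal_toNNReal, ← ENNReal.ofReal_mul h0]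
    refine ENNReal.ofReal_le_ofReal ((H₁ ε hε t x).trans ?_)
    gcongr
    linarith
  · rw [weight, weight, ← ofReal_norm, ENNReal.ofNNReal_toNNReal,
      ← ENNReal.ofReal_mul (by positivity), ← ENNReal.ofReal_mul h0]
    refine ENNReal.ofReal_le_ofReal ((H₂ ε hε t x h).trans ?_)
    simp only [Real.norm_eq_abs]
    gcongr
    linarith

/-- A smooth partition of unity on the annulus `{1/2 ≤ |ξ| ≤ 2}`, subordinate to half spaces. -/
lemma exists_symbols (n : ℕ) (hn : 0 < n) :
    ∃ (w : Fin n × Bool → Space n → ℝ) (m : Fin n × Bool → 𝓢(Space n, ℂ)) (C : ℝ≥0),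
      (∀ a ξ, 0 ≤ w a ξ) ∧ (∀ a ξ, m a ξ = w a ξ) ∧
      (∀ ξ : Space n, 1 / 2 ≤ ‖ξ‖ → ‖ξ‖ ≤ 2 → ∑ a, m a ξ = 1) ∧
      ∀ ε, IsSigns ε → ∀ a, KernelBounds ε (m a) a.1 (ε a.1 * boolSign a.2) C := by
  have hn' : (0 : ℝ) < n := by exact_mod_cast hn
  set s : Set (Space n) := {ξ | 1 / 2 ≤ ‖ξ‖} ∩ {ξ | ‖ξ‖ ≤ 2} with hs
  -- The ball of radius 3 only serves to make the pieces compactly supported, hence Schwartz.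
  set U : Fin n × Bool → Set (Space n) := fun a =>
    {ξ | 1 / (4 * (n : ℝ)) < boolSign a.2 * ξ a.1} ∩ Metric.ball 0 3 with hUdef
  have hsc : IsClosed s := (isClosed_le continuous_const continuous_norm).inter
    (isClosed_le continuous_norm continuous_const)
  have hUo : ∀ a, IsOpen (U a) := fun a =>
    (isOpen_lt continuous_const (by fun_prop)).inter Metric.isOpen_ball
  have hsU : s ⊆ ⋃ a, U a := by
    rintro ξ ⟨h1, h2⟩
    obtain ⟨i, hi⟩ := exists_lt_abs_coord h1
    have h2' : ‖ξ‖ ≤ 2 := h2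
    rw [Set.mem_iUnion]
    refine ⟨(i, decide (0 ≤ ξ i)), ?_, by rw [mem_ball_zero_iff]; linarith⟩
    show 1 / (4 * (n : ℝ)) < boolSign (decide (0 ≤ ξ i)) * ξ i
    by_cases h : 0 ≤ ξ i
    · simpa [boolSign, h, abs_of_nonneg h] using hi
    · rw [abs_of_neg (not_le.1 h)] at hi
      simpa [boolSign, h] using hi
  obtain ⟨f, hf⟩ := SmoothPartitionOfUnity.exists_isSubordinate
    (modelWithCornersSelf ℝ (Space n)) hsc U hUo hsU
  have hcs : ∀ a, HasCompactSupport (fun ξ => ((f a ξ : ℝ) : ℂ)) := fun a => by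
    have h : HasCompactSupport (f a) := by
      refine (isCompact_closedBall (0 : Space n) 3).of_isClosed_subset (isClosed_tsupport _) ?_
      exact (hf a).trans (Set.inter_subset_right.trans Metric.ball_subset_closedBall)
    exact h.comp_left (g := fun r : ℝ => (r : ℂ)) Complex.ofReal_zero
  have hsm : ∀ a, ContDiff ℝ ∞ (fun ξ => ((f a ξ : ℝ) : ℂ)) := fun a =>
    Complex.ofRealCLM.contDiff.comp (f a).contMDiff.contDiff
  let m : Fin n × Bool → 𝓢(Space n, ℂ) := fun a => (hcs a).toSchwartzMap (hsm a)
  have hm : ∀ a ξ, m a ξ = (f a ξ : ℝ) := fun a ξ => rfl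
  have hb : ∀ a, ∃ C, ∀ ε, IsSigns ε → KernelBounds ε (m a) a.1 (ε a.1 * boolSign a.2) C := fun a =>
    exists_kernelBounds (c := 1 / (4 * (n : ℝ))) (by positivity) (abs_boolSign a.2) (m a) (by
      refine (closure_minimal ?_ (isClosed_tsupport (f a))).trans
        ((hf a).trans fun ξ hξ => Set.mem_ofPred.2 (le_of_lt (Set.mem_ofPred.1 hξ.1)))
      intro ξ hξ
      refine subset_tsupport _ ?_
      rw [Function.mem_support] at hξ ⊢
      rw [hm] at hξ
      exact_mod_cast hξ)
  choose C hC using hb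
  refine ⟨fun a => f a, m, ∑ a, C a, fun a ξ => f.nonneg a ξ, hm, fun ξ h1 h2 => ?_,
    fun ε hε a => ?_⟩
  · have h := f.sum_eq_one (x := ξ) ⟨h1, h2⟩
    rw [finsum_eq_sum_of_fintype] at h
    simp only [hm]
    exact_mod_cast h
  · have hle : (C a : ℝ≥0∞) ≤ ((∑ a, C a : ℝ≥0) : ℝ≥0∞) :=
      ENNReal.coe_le_coe.2 (Finset.single_le_sum (fun _ _ => zero_le) (Finset.mem_univ a))
    exact ⟨fun t x => ((hC a ε hε).disp t x).trans (by gcongr),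
      fun t x h => ((hC a ε hε).rapid t x h).trans (by gcongr)⟩

lemma kernel_sum {ι : Type*} (s : Finset ι) (m : ι → 𝓢(Space n, ℂ)) (ε : Fin n → ℝ) (t : ℝ)
    (x : Space n) : kernel ε (∑ a ∈ s, m a : 𝓢(Space n, ℂ)) t x = ∑ a ∈ s, kernel ε (m a) t x := by
  unfold kernel
  rw [← integral_finsetSum _ fun a _ => integrable_wave_mul ε t x (m a).integrable]
  refine integral_congr_ae (Filter.Eventually.of_forall fun ξ => ?_)
  simp [Finset.mul_sum]

/-- The supremum over all directions of the `L^{1,2}_e` norms. -/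
def sourceNorm (G : ℝ → Space n → ℂ) : ℝ≥0∞ :=
  ⨆ (e : Space n) (_ : ‖e‖ = 1), anisoNorm 1 2 e G

/-- Sum over the 2n half-space pieces, each with its own coordinate direction. The measure ρ is left
free because Lebesgue measure serves finite p and a Dirac mass serves p = ∞. -/
lemma exists_enorm_integral_mul_kernel_le (n : ℕ) (hn : 2 ≤ n) :
    ∃ (M : 𝓢(Space n, ℂ)) (D : ℝ≥0), (∀ ξ : Space n, 1 / 2 ≤ ‖ξ‖ → ‖ξ‖ ≤ 2 → M ξ = 1) ∧
      ∀ (ε : Fin n → ℝ) (_ : IsSigns ε) (ρ : Measure ℝ) (_ : SFinite ρ)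
        (g : ℝ → ℂ) (_ : Integrable g ρ) (t : ℝ → ℝ) (x : ℝ → Space n) (_ : Measurable t)
        (_ : Measurable x) (G : ℝ × Space n → ℂ) (_ : Integrable G) (_ : Continuous G),
      ‖∫ p, g p.1 * G p.2 * (timeCutoff (t p.1) p.2.1 * kernel ε M (t p.1 - p.2.1) (x p.1 - p.2.2))
        ∂(ρ.prod volume)‖ₑ ≤
      D * (dispEnergy ρ g x ^ (1 / 2 : ℝ) * sourceNorm (fun s z => G (s, z))) := by
  obtain ⟨w, m, C, hw, hmw, hsum, hK⟩ := exists_symbols n (by omega)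
  choose D hD using fun i : Fin n => exists_enorm_integral_timeCutoff_le hn i (R := ℝ) C
  refine ⟨∑ a, m a, ∑ a : Fin n × Bool, D a.1, fun ξ h1 h2 => ?_,
    fun ε hε ρ _ g hg t x ht hx G hG hGc => ?_⟩
  · rw [← hsum ξ h1 h2]; simp
  simp only [kernel_sum, Finset.mul_sum]
  rw [integral_finsetSum _ fun a _ => integrable_mul_mul_timeCutoff_kernel hg ht hx hG]
  refine (enorm_sum_le _ _).trans ?_
  push_cast
  rw [Finset.sum_mul]
  refine Finset.sum_le_sum fun a _ => ?_
  refine (hD a.1 ε (m a) (w a) (hw a) (hmw a) _ (hK ε hε a) ρ ‹_› g hg t x ht hx G hG hGc).trans ?_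
  gcongr
  exact le_iSup₂_of_le (coordVec a.1) (by simp) le_rfl

end

/-! ### The truncated convolution, measurable selection and duality. -/

section

variable {n : ℕ}

/-- The function `∬ 1_{[0,t]}(s) K_M(t - s, x - z) G(s, z) ds dz`. -/
def forcedWave (ε : Fin n → ℝ) (M : 𝓢(Space n, ℂ)) (G : ℝ × Space n → ℂ) (t : ℝ) (x : Space n) : ℂ :=
  ∫ q : ℝ × Space n, G q * (timeCutoff t q.1 * kernel ε M (t - q.1) (x - q.2))

lemma measurable_timeCutoff_left (t : ℝ) : Measurable fun q : ℝ × Space n => (timeCutoff t q.1 : ℂ) := by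
  have h : Measurable fun q : ℝ × Space n => (t, q.1) := by fun_prop
  exact Complex.measurable_ofReal.comp (measurable_timeCutoff.comp h)

lemma norm_timeCutoff_mul_kernel_le (ε : Fin n → ℝ) (M : 𝓢(Space n, ℂ)) (t s τ : ℝ) (x : Space n) :
    ‖(timeCutoff t s : ℂ) * kernel ε M τ x‖ ≤ ∫ ξ, ‖M ξ‖ := by
  rw [norm_mul, Complex.norm_real]
  calc _ ≤ 1 * ∫ ξ, ‖M ξ‖ := mul_le_mul (abs_timeCutoff_le _ _) (norm_kernel_le _ _ _ _)
        (norm_nonneg _) zero_le_one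
    _ = _ := one_mul _

lemma continuous_kernel_sub (ε : Fin n → ℝ) (M : 𝓢(Space n, ℂ)) :
    Continuous fun p : (ℝ × Space n) × (ℝ × Space n) =>
      kernel ε M (p.1.1 - p.2.1) (p.1.2 - p.2.2) := by
  have h : Continuous fun p : (ℝ × Space n) × (ℝ × Space n) =>
    (p.1.1 - p.2.1, p.1.2 - p.2.2) := by fun_prop
  exact (continuous_kernel ε M).comp h

lemma integrable_forcedWave (ε : Fin n → ℝ) (M : 𝓢(Space n, ℂ)) {G : ℝ × Space n → ℂ}
    (hG : Integrable G) (t : ℝ) (x : Space n) :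
    Integrable fun q : ℝ × Space n => G q * (timeCutoff t q.1 * kernel ε M (t - q.1) (x - q.2)) := by
  refine hG.mul_bdd (c := ∫ ξ, ‖M ξ‖) ?_
    (Filter.Eventually.of_forall fun q => norm_timeCutoff_mul_kernel_le _ _ _ _ _ _)
  have h : Continuous fun q : ℝ × Space n => kernel ε M (t - q.1) (x - q.2) :=
    (continuous_kernel_sub ε M).comp (g := _) (f := fun q => ((t, x), q)) (by fun_prop)
  exact ((measurable_timeCutoff_left t).mul h.measurable).aestronglyMeasurable

lemma norm_forcedWave_le (ε : Fin n → ℝ) (M : 𝓢(Space n, ℂ)) {G : ℝ × Space n → ℂ}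
    (hG : Integrable G) (t : ℝ) (x : Space n) :
    ‖forcedWave ε M G t x‖ ≤ (∫ q, ‖G q‖) * ∫ ξ, ‖M ξ‖ := by
  rw [← integral_mul_const]
  refine norm_integral_le_of_norm_le (hG.norm.mul_const _) (Filter.Eventually.of_forall fun q => ?_)
  rw [norm_mul]
  exact mul_le_mul_of_nonneg_left (norm_timeCutoff_mul_kernel_le _ _ _ _ _ _) (norm_nonneg _)

lemma continuousAt_timeCutoff {t s : ℝ} (h : s ≠ t) : ContinuousAt (fun t => timeCutoff t s) t := by
  unfold timeCutoff
  refine ContinuousAt.sub ?_ continuousAt_const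
  rcases lt_or_gt_of_ne h with h | h
  · refine (continuousAt_const (y := (1 : ℝ))).congr ?_
    filter_upwards [lt_mem_nhds h] with u hu
    rw [if_pos hu.le]
  · refine (continuousAt_const (y := (0 : ℝ))).congr ?_
    filter_upwards [gt_mem_nhds h] with u hu
    rw [if_neg (by linarith)]

/-- Dominated convergence: as t varies, the cutoff jumps only on the null set {s = t}. Continuity
lets suprema over slices be taken along a dense sequence. -/
lemma continuous_forcedWave (ε : Fin n → ℝ) (M : 𝓢(Space n, ℂ)) {G : ℝ × Space n → ℂ}
    (hG : Integrable G) : Continuous fun p : ℝ × Space n => forcedWave ε M G p.1 p.2 := by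
  rw [continuous_iff_continuousAt]
  intro p
  refine continuousAt_of_dominated (bound := fun q => ‖G q‖ * ∫ ξ, ‖M ξ‖)
    (Filter.Eventually.of_forall fun p => (integrable_forcedWave ε M hG p.1 p.2).1)
    (Filter.Eventually.of_forall fun p => Filter.Eventually.of_forall fun q => ?_)
    (hG.norm.mul_const _) ?_
  · rw [norm_mul]
    exact mul_le_mul_of_nonneg_left (norm_timeCutoff_mul_kernel_le _ _ _ _ _ _) (norm_nonneg _)
  · have hne : ∀ᵐ q : ℝ × Space n, q.1 ≠ p.1 :=
      Measure.quasiMeasurePreserving_fst.ae (Measure.ae_ne volume p.1)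
    filter_upwards [hne] with q hq
    have h1 : ContinuousAt (fun p' : ℝ × Space n => (timeCutoff p'.1 q.1 : ℂ)) p :=
      Complex.continuous_ofReal.continuousAt.comp
        (ContinuousAt.comp (continuousAt_timeCutoff hq) continuousAt_fst)
    have h2 : ContinuousAt (fun p' : ℝ × Space n => kernel ε M (p'.1 - q.1) (p'.2 - q.2)) p :=
      ((continuous_kernel_sub ε M).comp (g := _) (f := fun p' => (p', q)) (by fun_prop)).continuousAt
    exact continuousAt_const.mul (h1.mul h2)

lemma integral_mul_forcedWave {ε : Fin n → ℝ} {M : 𝓢(Space n, ℂ)} {R : Type*} [MeasurableSpace R]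
    {ρ : Measure R} [SFinite ρ] {g : R → ℂ} (hg : Integrable g ρ) {t : R → ℝ} {x : R → Space n}
    (ht : Measurable t) (hx : Measurable x) {G : ℝ × Space n → ℂ} (hG : Integrable G) :
    ∫ p : R × ℝ × Space n, g p.1 * G p.2 * (timeCutoff (t p.1) p.2.1 *
      kernel ε M (t p.1 - p.2.1) (x p.1 - p.2.2)) ∂(ρ.prod volume) =
    ∫ r, g r * forcedWave ε M G (t r) (x r) ∂ρ := by
  rw [integral_prod (fun p : R × ℝ × Space n => g p.1 * G p.2 * (timeCutoff (t p.1) p.2.1 *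
      kernel ε M (t p.1 - p.2.1) (x p.1 - p.2.2))) (integrable_mul_mul_timeCutoff_kernel hg ht hx hG)]
  refine integral_congr_ae (Filter.Eventually.of_forall fun r => ?_)
  simp only [forcedWave, mul_assoc]
  rw [integral_const_mul]

/-- A maximising choice among the first `N` elements of a sequence, made measurably. -/
lemma exists_measurable_argmax {R Z : Type*} [MeasurableSpace R] [MeasurableSpace Z]
    {φ : R → Z → ℝ} (hφ : Measurable fun p : R × Z => φ p.1 p.2) (z : ℕ → Z) :
    ∃ ζ : ℕ → R → Z, (∀ N, Measurable (ζ N)) ∧ (∀ r, Monotone fun N => φ r (ζ N r)) ∧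
      ∀ N r, φ r (z N) ≤ φ r (ζ N r) := by
  classical
  let ζ : ℕ → R → Z := fun N => Nat.rec (fun _ => z 0)
    (fun N f r => if φ r (z (N + 1)) ≤ φ r (f r) then f r else z (N + 1)) N
  have hs : ∀ N r, ζ (N + 1) r = if φ r (z (N + 1)) ≤ φ r (ζ N r) then ζ N r else z (N + 1) :=
    fun N r => rfl
  refine ⟨ζ, fun N => ?_, fun r => monotone_nat_of_le_succ fun N => ?_, fun N r => ?_⟩
  · induction N with
    | zero => exact measurable_const
    | succ N ih =>
      have h1 : Measurable fun r => φ r (z (N + 1)) := hφ.comp (measurable_id.prodMk measurable_const)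
      have h2 : Measurable fun r => φ r (ζ N r) := hφ.comp (measurable_id.prodMk ih)
      exact Measurable.ite (measurableSet_le h1 h2) ih measurable_const
  · show φ r (ζ N r) ≤ φ r (ζ (N + 1) r)
    rw [hs]
    split_ifs with h
    · exact le_rfl
    · exact (not_le.1 h).le
  · cases N with
    | zero => exact le_rfl
    | succ N =>
      rw [hs]
      split_ifs with h
      · exact h
      · exact le_rfl

/-- A bound for an `L^p` norm by duality. -/
lemma lintegral_rpow_le_of_dual {R : Type*} [MeasurableSpace R] {ρ : Measure R} {p : ℝ} (hp : 2 ≤ p)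
    {V : R → ℂ} (hV : Measurable V) {b : ℝ} (hb : ∀ r, ‖V r‖ ≤ b) (hfin : ρ V.support ≠ ⊤) {B : ℝ≥0∞}
    (h : ∀ g : R → ℂ, Integrable g ρ →
      ‖∫ r, g r * V r ∂ρ‖ₑ ≤ B * (∫⁻ r, ‖g r‖ₑ ^ (p / (p - 1)) ∂ρ) ^ (1 - 1 / p)) :
    (∫⁻ r, ‖V r‖ₑ ^ p ∂ρ) ^ (1 / p) ≤ B := by
  have hp0 : 0 < p := by linarith
  have hp1 : 0 < p - 1 := by linarith
  have hS : MeasurableSet V.support := hV (measurableSet_singleton 0).compl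
  set S := V.support
  have hnV : Measurable fun r => ‖V r‖ := hV.norm
  -- The usual extremiser, with |g|^{p'} = |V|^p = gV. It is integrable because V is bounded with
  -- support of finite measure, which also makes ∫|V|^p finite and allows the final division by its
  -- power 1 - 1/p.
  set g : R → ℂ := S.indicator fun r => (starRingEnd ℂ) (V r) * ((‖V r‖ ^ (p - 2) : ℝ) : ℂ) with hg
  have hgm : Measurable g :=
    ((Complex.continuous_conj.measurable.comp hV).mul
      (Complex.measurable_ofReal.comp (hnV.pow_const _))).indicator hS
  have hgn : ∀ r, ‖g r‖ = ‖V r‖ ^ (p - 1) := by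
    intro r
    by_cases hr : r ∈ S
    · have h0 : 0 < ‖V r‖ := norm_pos_iff.2 hr
      rw [hg, Set.indicator_of_mem hr, norm_mul, RCLike.norm_conj, Complex.norm_real,
        Real.norm_of_nonneg (by positivity), show p - 1 = 1 + (p - 2) by ring, Real.rpow_add h0,
        Real.rpow_one]
    · have h0 : V r = 0 := Function.notMem_support.1 hr
      rw [hg, Set.indicator_of_notMem hr, h0, norm_zero, Real.zero_rpow hp1.ne']
  have hgV : ∀ r, g r * V r = ((‖V r‖ ^ p : ℝ) : ℂ) := by
    intro r
    by_cases hr : r ∈ S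
    · have h0 : 0 < ‖V r‖ := norm_pos_iff.2 hr
      rw [hg, Set.indicator_of_mem hr, mul_right_comm, Complex.conj_mul', ← Complex.ofReal_pow,
        ← Complex.ofReal_mul, ← Real.rpow_natCast, ← Real.rpow_add h0]
      congr 2
      push_cast
      ring
    · have h0 : V r = 0 := Function.notMem_support.1 hr
      rw [h0, mul_zero, norm_zero, Real.zero_rpow hp0.ne', Complex.ofReal_zero]
  have hind : ∀ a : ℝ, 0 < a → Integrable (fun r => ‖V r‖ ^ a) ρ := by
    intro a ha
    have h1 : Integrable (S.indicator fun _ => b ^ a) ρ :=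
      (integrable_indicator_iff hS).2 (integrableOn_const hfin)
    refine h1.mono' (hnV.pow_const _).aestronglyMeasurable (Filter.Eventually.of_forall fun r => ?_)
    by_cases hr : r ∈ S
    · rw [Set.indicator_of_mem hr, Real.norm_of_nonneg (by positivity)]
      exact Real.rpow_le_rpow (norm_nonneg _) (hb r) ha.le
    · have h0 : V r = 0 := Function.notMem_support.1 hr
      rw [Set.indicator_of_notMem hr, h0, norm_zero, Real.zero_rpow ha.ne', norm_zero]
  have hgi : Integrable g ρ :=
    (integrable_norm_iff hgm.aestronglyMeasurable).1 ((hind _ hp1).congr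
      (Filter.Eventually.of_forall fun r => (hgn r).symm))
  have hrp : ∀ (r : R) (a : ℝ), 0 ≤ a → ‖‖V r‖ ^ a‖ₑ = ‖V r‖ₑ ^ a := fun r a ha => by
    rw [Real.enorm_of_nonneg (by positivity), ← ENNReal.ofReal_rpow_of_nonneg (norm_nonneg _) ha,
      ofReal_norm]
  set I := ∫⁻ r, ‖V r‖ₑ ^ p ∂ρ with hI
  have hIfin : I ≠ ⊤ := by
    have := (hind p hp0).2
    rw [hasFiniteIntegral_iff_enorm] at this
    simp only [hrp _ _ hp0.le] at this
    exact this.ne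
  have hl : ‖∫ r, g r * V r ∂ρ‖ₑ = I := by
    simp only [hgV]
    rw [integral_complex_ofReal, ← ofReal_norm, Complex.norm_real, ofReal_norm,
      Real.enorm_of_nonneg (integral_nonneg fun r => by positivity),
      ofReal_integral_eq_lintegral_ofReal (hind p hp0)
        (Filter.Eventually.of_forall fun r => by positivity)]
    refine lintegral_congr fun r => ?_
    rw [← ENNReal.ofReal_rpow_of_nonneg (norm_nonneg _) hp0.le, ofReal_norm]
  have hr : ∫⁻ r, ‖g r‖ₑ ^ (p / (p - 1)) ∂ρ = I := by
    refine lintegral_congr fun r => ?_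
    rw [← ofReal_norm (g r), hgn, ← ENNReal.ofReal_rpow_of_nonneg (norm_nonneg _) hp1.le, ofReal_norm,
      ← ENNReal.rpow_mul]
    congr 1
    field_simp
  have key := h g hgi
  rw [hl, hr] at key
  rcases eq_or_ne I 0 with h0 | h0
  · rw [h0, ENNReal.zero_rpow_of_pos (by positivity)]; exact zero_le
  · have h1 : I ^ (1 - 1 / p) ≠ 0 := (ENNReal.rpow_pos (pos_iff_ne_zero.2 h0) hIfin).ne'
    have h2 : I ^ (1 - 1 / p) ≠ ⊤ := by
      refine (ENNReal.rpow_lt_top_of_nonneg ?_ hIfin).ne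
      rw [sub_nonneg, div_le_one hp0]; linarith
    rw [← ENNReal.mul_le_mul_iff_left h1 h2, ← ENNReal.rpow_add _ _ h0 hIfin]
    simpa using key

end

/-! ### The mixed-norm estimate at unit frequency. -/

section

variable {n : ℕ}

/-- The constant that controls the `L^{p/2}` norms of the dispersive weight on a line. -/
def lineConst : ℝ≥0∞ := ∫⁻ r : ℝ, ENNReal.ofReal ((1 + ‖r‖) ^ (-(3 / 2 : ℝ)))

lemma lineConst_lt_top : lineConst < ⊤ :=
  finite_integral_one_add_norm (by rw [Module.finrank_self]; norm_num)

/-- Points on different slices are at least |r - r'| apart, so the weight is dominated by a function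
of r - r' and Young's inequality on the line applies with that function in L^{p/2}. -/
lemma dispEnergy_line_le (hn : 2 ≤ n) {p : ℝ} (hp : 2 ≤ p) (hp' : n = 2 → 3 ≤ p) {g : ℝ → ℂ}
    (hg : AEMeasurable g) {x : ℝ → Space n} (hx : ∀ r r', ‖r - r'‖ ≤ ‖x r - x r'‖) :
    dispEnergy volume g x ^ (1 / 2 : ℝ) ≤
      (∫⁻ r, ‖g r‖ₑ ^ (p / (p - 1))) ^ (1 - 1 / p) * (1 + lineConst) := by
  have hp0 : 0 < p := by linarith
  -- The only use of the range of p beyond p ≥ 2: the L^{p/2} integrand decays like |r|^{-np/4}. The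
  -- bound 3/2 is attained at (n, p) = (3, 2) and (2, 3) and keeps the integral uniform in p.
  have hnp : 3 / 2 ≤ (n : ℝ) / 2 * (p / 2) := by
    rcases hn.eq_or_lt with h | h
    · have := hp' h.symm
      rw [← h]; push_cast; linarith
    · have h3 : (3 : ℝ) ≤ n := by exact_mod_cast h
      nlinarith
  set k : ℝ → ℝ≥0∞ := fun r => ENNReal.ofReal ((1 + ‖r‖) ^ (-((n : ℝ) / 2))) with hk
  have hkm : Measurable k := by
    have : Measurable fun r : ℝ => ‖r‖ := measurable_norm
    fun_prop
  have h1 : dispEnergy volume g x ≤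
      ∫⁻ z : ℝ × ℝ, ‖g z.1‖ₑ * ‖g z.2‖ₑ * k (z.1 - z.2) ∂((volume : Measure ℝ).prod volume) := by
    refine lintegral_mono fun z => mul_le_mul_right (ENNReal.ofReal_le_ofReal ?_) _
    refine Real.rpow_le_rpow_of_nonpos (by positivity) (by linarith [hx z.1 z.2]) ?_
    rw [neg_nonpos]; positivity
  have h2 := h1.trans (lintegral_mul_mul_sub_le hp hg.enorm hkm)
  have h3 : ∫⁻ r, k r ^ (p / 2) ≤ lineConst := by
    refine lintegral_mono fun r => ?_
    rw [hk, ENNReal.ofReal_rpow_of_nonneg (by positivity) (by positivity),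
      ← Real.rpow_mul (by positivity)]
    refine ENNReal.ofReal_le_ofReal (Real.rpow_le_rpow_of_exponent_le (by simp) ?_)
    linarith
  -- Removes the dependence of the constant on p.
  have h4 : lineConst ^ (1 / p) ≤ 1 + lineConst := by
    calc lineConst ^ (1 / p) ≤ (1 + lineConst) ^ (1 / p) :=
          ENNReal.rpow_le_rpow le_add_self (by positivity)
      _ ≤ (1 + lineConst) ^ (1 : ℝ) :=
          ENNReal.rpow_le_rpow_of_exponent_le le_self_add (by rw [div_le_one hp0]; linarith)
      _ = _ := ENNReal.rpow_one _
  calc _ ≤ ((∫⁻ r, ‖g r‖ₑ ^ (p / (p - 1))) ^ (2 - 2 / p) * lineConst ^ (2 / p)) ^ (1 / 2 : ℝ) := by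
        refine ENNReal.rpow_le_rpow (h2.trans ?_) (by norm_num)
        exact mul_le_mul_right (ENNReal.rpow_le_rpow h3 (by positivity)) _
    _ = (∫⁻ r, ‖g r‖ₑ ^ (p / (p - 1))) ^ (1 - 1 / p) * lineConst ^ (1 / p) := by
        rw [ENNReal.mul_rpow_of_nonneg _ _ (by norm_num), ← ENNReal.rpow_mul, ← ENNReal.rpow_mul]
        congr 2 <;> ring
    _ ≤ _ := by gcongr

lemma norm_sub_le_slice {e : Space n} (he : ‖e‖ = 1) (r r' : ℝ) (v v' : (ℝ ∙ e)ᗮ) :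
    ‖r - r'‖ ≤ ‖r • e + (v : Space n) - (r' • e + (v' : Space n))‖ := by
  have h : inner ℝ e (r • e + (v : Space n) - (r' • e + (v' : Space n))) = r - r' := by
    rw [inner_sub_right, inner_add_right, inner_add_right, inner_smul_right, inner_smul_right,
      inner_coe_orthogonal, inner_coe_orthogonal, real_inner_self_eq_norm_sq, he]
    ring
  rw [← h]
  simpa [he] using norm_inner_le_norm (𝕜 := ℝ) e (r • e + (v : Space n) - (r' • e + (v' : Space n)))

/-- The supremum of a family over the slice `r e + P_e`, along a dense sequence. -/
lemma eLpNorm_top_slice_le {e : Space n} {u : ℝ → Space n → ℂ}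
    (hu : Continuous fun p : ℝ × Space n => u p.1 p.2) (r : ℝ) :
    eLpNorm (fun z : ℝ × (ℝ ∙ e)ᗮ => u z.1 (r • e + (z.2 : Space n))) ⊤
      ((volume : Measure ℝ).prod (hyperplaneMeasure e)) ≤
    ⨆ k, ‖u (TopologicalSpace.denseSeq (ℝ × (ℝ ∙ e)ᗮ) k).1
      (r • e + ((TopologicalSpace.denseSeq (ℝ × (ℝ ∙ e)ᗮ) k).2 : Space n))‖ₑ := by
  rw [eLpNorm_exponent_top]
  refine eLpNormEssSup_le_of_ae_enorm_bound (Filter.Eventually.of_forall fun z => ?_)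
  have hc : Continuous fun z : ℝ × (ℝ ∙ e)ᗮ => ‖u z.1 (r • e + (z.2 : Space n))‖ₑ := by
    have h : Continuous fun z : ℝ × (ℝ ∙ e)ᗮ => (z.1, r • e + (z.2 : Space n)) := by fun_prop
    exact (hu.comp h).enorm
  exact (TopologicalSpace.denseRange_denseSeq (ℝ × (ℝ ∙ e)ᗮ)).induction_on
    (p := fun z => ‖u z.1 (r • e + (z.2 : Space n))‖ₑ ≤ _) z (isClosed_le hc continuous_const)
    fun k => le_iSup (fun k => ‖u (TopologicalSpace.denseSeq (ℝ × (ℝ ∙ e)ᗮ) k).1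
      (r • e + ((TopologicalSpace.denseSeq (ℝ × (ℝ ∙ e)ᗮ) k).2 : Space n))‖ₑ) k

lemma anisoNorm_top_le {e : Space n} {u : ℝ → Space n → ℂ} {B : ℝ≥0∞} (h : ∀ t x, ‖u t x‖ₑ ≤ B)
    : anisoNorm ⊤ ⊤ e u ≤ B := by
  unfold anisoNorm
  rw [eLpNorm_exponent_top]
  refine eLpNormEssSup_le_of_ae_enorm_bound (Filter.Eventually.of_forall fun r => ?_)
  rw [enorm_eq_self, eLpNorm_exponent_top]
  exact eLpNormEssSup_le_of_ae_enorm_bound (Filter.Eventually.of_forall fun z => h _ _)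

/-- Linearisation of the supremum over slices, and duality. -/
lemma anisoNorm_le_of_dual {e : Space n} (he : ‖e‖ = 1) {p : ℝ} (hp : 2 ≤ p)
    {u : ℝ → Space n → ℂ} (hu : Continuous fun p : ℝ × Space n => u p.1 p.2) {b : ℝ}
    (hb : ∀ t x, ‖u t x‖ ≤ b) {B : ℝ≥0∞}
    (h : ∀ (g : ℝ → ℂ) (t : ℝ → ℝ) (x : ℝ → Space n), Integrable g → Measurable t → Measurable x →
      (∀ r r', ‖r - r'‖ ≤ ‖x r - x r'‖) →
      ‖∫ r, g r * u (t r) (x r)‖ₑ ≤ B * (∫⁻ r, ‖g r‖ₑ ^ (p / (p - 1))) ^ (1 - 1 / p)) :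
    anisoNorm (ENNReal.ofReal p) ⊤ e u ≤ B := by
  have hp0 : 0 < p := by linarith
  set z := TopologicalSpace.denseSeq (ℝ × (ℝ ∙ e)ᗮ)
  set φ : ℝ → ℝ × (ℝ ∙ e)ᗮ → ℝ := fun r z => ‖u z.1 (r • e + (z.2 : Space n))‖ with hφd
  have hφc : Continuous fun q : ℝ × ℝ × (ℝ ∙ e)ᗮ => u q.2.1 (q.1 • e + (q.2.2 : Space n)) := by
    have h : Continuous fun q : ℝ × ℝ × (ℝ ∙ e)ᗮ => (q.2.1, q.1 • e + (q.2.2 : Space n)) := by fun_prop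
    exact hu.comp h
  -- For each r, ζ_N(r) maximises |u| on the slice among finitely many points of a dense sequence.
  -- The values increase with N to the supremum, so monotone convergence recovers the full norm.
  obtain ⟨ζ, hζm, hζ1, hζ2⟩ := exists_measurable_argmax (φ := φ) hφc.norm.measurable z
  have hVm : ∀ N, Measurable fun r => u (ζ N r).1 (r • e + ((ζ N r).2 : Space n)) := fun N =>
    hφc.measurable.comp (measurable_id.prodMk (hζm N))
  -- Truncation to |r| ≤ N provides the support of finite measure that the duality lemma requires.
  -- The truncation is transferred to g, as u itself is not truncated in `h`.
  set V : ℕ → ℝ → ℂ := fun N => (Set.Icc (-(N : ℝ)) N).indicator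
    fun r => u (ζ N r).1 (r • e + ((ζ N r).2 : Space n)) with hV
  have hV1 : ∀ N, (∫⁻ r, ‖V N r‖ₑ ^ p) ^ (1 / p) ≤ B := by
    intro N
    refine lintegral_rpow_le_of_dual hp ((hVm N).indicator measurableSet_Icc) (b := b)
      (fun r => (norm_indicator_le_norm_self _ _).trans (hb _ _)) ?_ fun g hg => ?_
    · exact ((measure_mono Set.support_indicator_subset).trans_lt measure_Icc_lt_top).ne
    · have hg' : Integrable ((Set.Icc (-(N : ℝ)) N).indicator g) := hg.indicator measurableSet_Icc
      have hxm : Measurable fun r => r • e + ((ζ N r).2 : Space n) := by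
        have h1 : Measurable fun r => ((ζ N r).2 : Space n) :=
          measurable_subtype_coe.comp (measurable_snd.comp (hζm N))
        exact (measurable_id.smul_const e).add h1
      have := h _ (fun r => (ζ N r).1) (fun r => r • e + ((ζ N r).2 : Space n)) hg'
        (measurable_fst.comp (hζm N)) hxm (fun r r' => norm_sub_le_slice he r r' _ _)
      have e1 : ∀ r, g r * V N r = (Set.Icc (-(N : ℝ)) N).indicator g r *
          u (ζ N r).1 (r • e + ((ζ N r).2 : Space n)) := by
        intro r
        simp only [hV, Set.indicator_apply]
        split_ifs <;> simp
      refine (congrArg enorm (integral_congr_ae (Filter.Eventually.of_forall e1))).trans_le ?_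
      refine this.trans (mul_le_mul_right (ENNReal.rpow_le_rpow (lintegral_mono fun r => ?_) ?_) _)
      · refine ENNReal.rpow_le_rpow (enorm_le_iff_norm_le.2 (norm_indicator_le_norm_self _ _)) ?_
        exact div_nonneg hp0.le (by linarith)
      · rw [sub_nonneg, div_le_one hp0]; linarith
  have hmono : Monotone fun N r => ‖V N r‖ₑ ^ p := by
    intro N N' hN r
    refine ENNReal.rpow_le_rpow (enorm_le_iff_norm_le.2 ?_) hp0.le
    simp only [hV]
    by_cases hr : r ∈ Set.Icc (-(N : ℝ)) N
    · have hNN : (N : ℝ) ≤ N' := by exact_mod_cast hN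
      have hr' : r ∈ Set.Icc (-(N' : ℝ)) N' := ⟨by linarith [hr.1], hr.2.trans hNN⟩
      rw [Set.indicator_of_mem hr, Set.indicator_of_mem hr']
      exact hζ1 r hN
    · rw [Set.indicator_of_notMem hr, norm_zero]; exact norm_nonneg _
  have hsup : ∀ r, (⨆ k, ‖u (z k).1 (r • e + ((z k).2 : Space n))‖ₑ) ^ p ≤ ⨆ N, ‖V N r‖ₑ ^ p := by
    intro r
    rw [← ENNReal.le_rpow_inv_iff hp0]
    refine iSup_le fun k => ?_
    rw [ENNReal.le_rpow_inv_iff hp0]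
    obtain ⟨N, hN⟩ := exists_nat_ge (max (k : ℝ) |r|)
    refine le_iSup_of_le N (ENNReal.rpow_le_rpow (enorm_le_iff_norm_le.2 ?_) hp0.le)
    have hr : r ∈ Set.Icc (-(N : ℝ)) N := abs_le.1 ((le_max_right _ _).trans hN)
    have hk : k ≤ N := by exact_mod_cast (le_max_left _ _).trans hN
    simp only [hV]
    rw [Set.indicator_of_mem hr]
    exact (hζ2 k r).trans (hζ1 r hk)
  unfold anisoNorm
  rw [eLpNorm_eq_lintegral_rpow_enorm_toReal (by simpa using hp0) ENNReal.ofReal_ne_top,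
    ENNReal.toReal_ofReal hp0.le]
  have hVmeas : ∀ N, Measurable fun r => ‖V N r‖ₑ ^ p := fun N =>
    ((hVm N).indicator measurableSet_Icc).enorm.pow_const _
  calc _ ≤ (∫⁻ r, ⨆ N, ‖V N r‖ₑ ^ p) ^ (1 / p) := by
        refine ENNReal.rpow_le_rpow (lintegral_mono fun r => ?_) (by positivity)
        rw [enorm_eq_self]
        exact (ENNReal.rpow_le_rpow (eLpNorm_top_slice_le hu r) hp0.le).trans (hsup r)
    _ = (⨆ N, ∫⁻ r, ‖V N r‖ₑ ^ p) ^ (1 / p) := by rw [lintegral_iSup hVmeas hmono]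
    _ ≤ B := by
        rw [one_div, ENNReal.rpow_inv_le_iff hp0]
        refine iSup_le fun N => ?_
        rw [← ENNReal.rpow_inv_le_iff hp0, ← one_div]
        exact hV1 N

theorem exists_anisoNorm_forcedWave_le (n : ℕ) (hn : 2 ≤ n) :
    ∃ (M : 𝓢(Space n, ℂ)) (D : ℝ≥0), (∀ ξ : Space n, 1 / 2 ≤ ‖ξ‖ → ‖ξ‖ ≤ 2 → M ξ = 1) ∧
      ∀ (ε : Fin n → ℝ) (_ : IsSigns ε) (p : ℝ≥0∞) (_ : 2 ≤ p) (_ : n = 2 → 3 ≤ p)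
        (G : ℝ × Space n → ℂ) (_ : Integrable G) (_ : Continuous G) (e : Space n) (_ : ‖e‖ = 1),
      anisoNorm p ⊤ e (forcedWave ε M G) ≤ D * sourceNorm (fun s z => G (s, z)) := by
  obtain ⟨M, D, hM, hD⟩ := exists_enorm_integral_mul_kernel_le n hn
  obtain ⟨L, hL⟩ : ∃ L : ℝ≥0, (L : ℝ≥0∞) = 1 + lineConst :=
    ⟨_, ENNReal.coe_toNNReal (ENNReal.add_lt_top.2 ⟨ENNReal.one_lt_top, lineConst_lt_top⟩).ne⟩
  have hL1 : 1 ≤ (L : ℝ≥0∞) := hL ▸ le_self_add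
  refine ⟨M, D * L, hM, fun ε hε p hp hp' G hG hGc e he => ?_⟩
  rcases eq_or_ne p ⊤ with rfl | hpt
  · refine anisoNorm_top_le fun t x => ?_
    -- For p = ∞ the bilinear estimate is tested on a point mass, which yields a pointwise bound for
    -- u(t, x).
    have h := hD ε hε (Measure.dirac 0) inferInstance (fun _ => 1) (integrable_const _) (fun _ => t)
      (fun _ => x) measurable_const measurable_const G hG hGc
    rw [integral_mul_forcedWave (integrable_const _) measurable_const measurable_const hG] at h
    have h1 : dispEnergy (Measure.dirac (0 : ℝ)) (fun _ => (1 : ℂ)) (fun _ => x) ≤ 1 := by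
      unfold dispEnergy
      calc _ ≤ ∫⁻ _p : ℝ × ℝ, 1 ∂((Measure.dirac (0 : ℝ)).prod (Measure.dirac 0)) := by
            refine lintegral_mono fun p => ?_
            simp [dispWeight]
        _ = 1 := by simp
    simp only [one_mul, integral_dirac] at h
    refine h.trans ?_
    push_cast
    calc _ ≤ D * (1 * sourceNorm fun s z => G (s, z)) := by
          gcongr
          exact ENNReal.rpow_le_one h1 (by norm_num)
      _ ≤ D * (L * sourceNorm fun s z => G (s, z)) := by gcongr
      _ = _ := by ring
  · have hp2 : 2 ≤ p.toReal := by
      simpa using ENNReal.toReal_mono hpt hp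
    have hp3 : n = 2 → 3 ≤ p.toReal := fun h => by
      simpa using ENNReal.toReal_mono hpt (hp' h)
    rw [← ENNReal.ofReal_toReal hpt]
    refine anisoNorm_le_of_dual he hp2 (continuous_forcedWave ε M hG) (norm_forcedWave_le ε M hG)
      fun g t x hg ht hx hxr => ?_
    rw [← integral_mul_forcedWave hg ht hx hG]
    refine (hD ε hε volume inferInstance g hg t x ht hx G hG hGc).trans ?_
    have := dispEnergy_line_le hn hp2 hp3 hg.1.aemeasurable hxr
    rw [← hL] at this
    calc _ ≤ D * ((∫⁻ r, ‖g r‖ₑ ^ (p.toReal / (p.toReal - 1))) ^ (1 - 1 / p.toReal) * L *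
          sourceNorm fun s z => G (s, z)) := by gcongr
      _ = _ := by push_cast; ring

end

/-! ### Bounded families of Schwartz functions and time slices. -/

section

variable {n : ℕ}

/-- A family of Schwartz functions, bounded in the Schwartz topology and jointly continuous. -/
structure IsBoundedFamily (f : ℝ → 𝓢(Space n, ℂ)) : Prop where
  bounded : Bornology.IsVonNBounded ℂ (Set.range f)
  continuous : Continuous fun p : ℝ × Space n => f p.1 p.2

lemma isVonNBounded_range_comp {f : ℝ → 𝓢(Space n, ℂ)} (hf : Bornology.IsVonNBounded ℂ (Set.range f))
    (T : 𝓢(Space n, ℂ) →L[ℂ] 𝓢(Space n, ℂ)) :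
    Bornology.IsVonNBounded ℂ (Set.range fun s => T (f s)) := by
  have h := hf.image T
  rwa [← Set.range_comp] at h

lemma exists_norm_le_of_isVonNBounded {f : ℝ → 𝓢(Space n, ℂ)}
    (hf : Bornology.IsVonNBounded ℂ (Set.range f)) (N : ℕ) :
    ∃ C : ℝ, 0 ≤ C ∧ ∀ s x, ‖f s x‖ ≤ C * ((1 + ‖x‖)⁻¹) ^ N := by
  obtain ⟨r, hr, h⟩ := ((schwartz_withSeminorms ℂ (Space n) ℂ).isVonNBounded_iff_finset_seminorm_bounded.1
    hf) (Finset.Iic (N, 0))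
  refine ⟨2 ^ N * r, by positivity, fun s x => ?_⟩
  have h1 := SchwartzMap.one_add_le_sup_seminorm_apply (𝕜 := ℂ) (m := (N, 0)) (k := N) (n := 0)
    le_rfl le_rfl (f s) x
  rw [norm_iteratedFDeriv_zero] at h1
  have h2 := (h (f s) ⟨s, rfl⟩).le
  have h3 : (1 + ‖x‖) ^ N * ‖f s x‖ ≤ 2 ^ N * r := h1.trans (by
    refine mul_le_mul_of_nonneg_left ?_ (by positivity)
    exact h2)
  rw [inv_pow, ← div_eq_mul_inv, le_div_iff₀ (by positivity)]
  linarith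

lemma integrable_inv_one_add_norm_pow (n : ℕ) :
    Integrable fun x : Space n => ((1 + ‖x‖)⁻¹) ^ (n + 1) := by
  have h := integrable_one_add_norm (E := Space n) (μ := volume) (r := (n + 1 : ℕ))
    (by rw [finrank_euclideanSpace, Fintype.card_fin]; push_cast; linarith)
  refine h.congr (Filter.Eventually.of_forall fun x => ?_)
  show (1 + ‖x‖) ^ (-((n + 1 : ℕ) : ℝ)) = ((1 + ‖x‖)⁻¹) ^ (n + 1)
  rw [Real.rpow_neg (by positivity), Real.rpow_natCast, inv_pow]

namespace IsBoundedFamily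

variable {f : ℝ → 𝓢(Space n, ℂ)}

lemma exists_norm_le (hf : IsBoundedFamily f) (N : ℕ) :
    ∃ C : ℝ, 0 ≤ C ∧ ∀ s x, ‖f s x‖ ≤ C * ((1 + ‖x‖)⁻¹) ^ N :=
  exists_norm_le_of_isVonNBounded hf.bounded N

lemma fourier (hf : IsBoundedFamily f) : IsBoundedFamily fun s => 𝓕 (f s) := by
  refine ⟨isVonNBounded_range_comp hf.bounded (fourierCLM ℂ 𝓢(Space n, ℂ)), ?_⟩
  obtain ⟨C, hC, h⟩ := hf.exists_norm_le (n + 1)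
  have e : ∀ p : ℝ × Space n, 𝓕 (f p.1) p.2 = ∫ v, Complex.exp (↑(-2 * Real.pi * inner ℝ v p.2) *
      Complex.I) • f p.1 v := fun p => by
    rw [SchwartzMap.fourier_coe, Real.fourier_eq']
  simp only [e]
  refine continuous_of_dominated (bound := fun v => C * ((1 + ‖v‖)⁻¹) ^ (n + 1)) (fun p => ?_)
    (fun p => Filter.Eventually.of_forall fun v => ?_)
    ((integrable_inv_one_add_norm_pow n).const_mul C) (Filter.Eventually.of_forall fun v => ?_)
  · exact Continuous.aestronglyMeasurable (by fun_prop)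
  · rw [norm_smul, Complex.norm_exp_ofReal_mul_I, one_mul]
    exact h _ _
  · have : Continuous fun p : ℝ × Space n => f p.1 v :=
      hf.continuous.comp (f := fun p : ℝ × Space n => (p.1, v)) (by fun_prop)
    have h2 : Continuous fun p : ℝ × Space n =>
        Complex.exp (↑(-2 * Real.pi * inner ℝ v p.2) * Complex.I) := by fun_prop
    exact h2.smul this

lemma fourierInv (hf : IsBoundedFamily f) : IsBoundedFamily fun s => 𝓕⁻ (f s) := by
  refine ⟨isVonNBounded_range_comp hf.bounded (fourierInvCLM ℂ 𝓢(Space n, ℂ)), ?_⟩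
  have e : ∀ p : ℝ × Space n, 𝓕⁻ (f p.1) p.2 = 𝓕 (f p.1) (-p.2) := fun p => by
    rw [SchwartzMap.fourierInv_coe, Real.fourierInv_eq_fourier_neg, SchwartzMap.fourier_coe]
  simp only [e]
  exact hf.fourier.continuous.comp (f := fun p : ℝ × Space n => (p.1, -p.2)) (by fun_prop)

lemma smulLeft (hf : IsBoundedFamily f) {σ : Space n → ℂ} (hσ : σ.HasTemperateGrowth) :
    IsBoundedFamily fun s => SchwartzMap.smulLeftCLM ℂ σ (f s) := by
  refine ⟨isVonNBounded_range_comp hf.bounded _, ?_⟩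
  simp only [SchwartzMap.smulLeftCLM_apply_apply hσ]
  have := hσ.1.continuous
  have h2 := hf.continuous
  fun_prop

end IsBoundedFamily

/-- The slice `F(s, ·)` of a Schwartz function on space-time. -/
def slice (s : ℝ) : 𝓢(ℝ × Space n, ℂ) →L[ℂ] 𝓢(Space n, ℂ) :=
  SchwartzMap.compCLM ℂ (g := fun x : Space n => (s, x))
    (by
      have h := (ContinuousLinearMap.inr ℝ ℝ (Space n)).hasTemperateGrowth.add
        (Function.HasTemperateGrowth.const (E := Space n) ((s, 0) : ℝ × Space n))
      convert h using 1
      ext x <;> simp)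
    ⟨1, 1, fun x => by
      have : ‖x‖ ≤ ‖(s, x)‖ := le_max_right _ _
      linarith [norm_nonneg (s, x)]⟩

@[simp] lemma slice_apply (s : ℝ) (F : 𝓢(ℝ × Space n, ℂ)) (x : Space n) : slice s F x = F (s, x) := rfl

/-- The slice is a translate of F composed with x ↦ (0, x), a linear map of norm at most 1, and ‖x‖
≤ ‖(s, x)‖. The bound is uniform in s, which gives boundedness of the whole family. -/
lemma seminorm_slice_le (F : 𝓢(ℝ × Space n, ℂ)) (k l : ℕ) (s : ℝ) :
    SchwartzMap.seminorm ℂ k l (slice s F) ≤ SchwartzMap.seminorm ℂ k l F := by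
  refine SchwartzMap.seminorm_le_bound ℂ k l _ (apply_nonneg _ _) fun x => ?_
  have e : (slice s F : Space n → ℂ) =
      (fun z => F (z + (s, 0))) ∘ (ContinuousLinearMap.inr ℝ ℝ (Space n)) := by
    ext x
    simp
  have hc : ContDiff ℝ l (fun z => F (z + ((s, 0) : ℝ × Space n))) :=
    (F.smooth l).comp (contDiff_id.add contDiff_const)
  rw [e, ContinuousLinearMap.iteratedFDeriv_comp_right _ hc x le_rfl, iteratedFDeriv_comp_add_right]
  have e2 : ContinuousLinearMap.inr ℝ ℝ (Space n) x + (s, 0) = (s, x) := by simp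
  rw [e2]
  refine le_trans ?_ (F.le_seminorm ℂ k l (s, x))
  have h1 : ‖x‖ ≤ ‖(s, x)‖ := le_max_right _ _
  refine mul_le_mul (by gcongr) ?_ (norm_nonneg _) (by positivity)
  refine (ContinuousMultilinearMap.norm_compContinuousLinearMap_le _ _).trans ?_
  refine mul_le_of_le_one_right (norm_nonneg _) (Finset.prod_le_one (fun _ _ => norm_nonneg _)
    fun _ _ => ContinuousLinearMap.norm_inr_le_one _ _ _)

lemma isBoundedFamily_slice (F : 𝓢(ℝ × Space n, ℂ)) : IsBoundedFamily fun s => slice s F := by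
  refine ⟨((schwartz_withSeminorms ℂ (Space n) ℂ).isVonNBounded_iff_seminorm_bounded).2 ?_, ?_⟩
  · rintro ⟨k, l⟩
    refine ⟨SchwartzMap.seminorm ℂ k l F + 1, by positivity, ?_⟩
    rintro _ ⟨s, rfl⟩
    exact (seminorm_slice_le F k l s).trans_lt (lt_add_one _)
  · simp only [slice_apply]
    exact F.continuous

end

/-! ### The Duhamel integral on the Fourier side. -/

section

variable {n : ℕ}

lemma wave_add (ε : Fin n → ℝ) (t s : ℝ) (x z ξ : Space n) :
    wave ε (t + s) (x + z) ξ = wave ε t x ξ * wave ε s z ξ := by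
  unfold wave
  rw [← Complex.exp_add]
  congr 1
  simp [phase, inner_add_left]
  ring

lemma hasDerivAt_wave (ε : Fin n → ℝ) (t a : ℝ) (x v ξ : Space n) (r : ℝ) :
    HasDerivAt (fun r : ℝ => wave ε (t + r * a) (x + r • v) ξ)
      (Complex.I * (inner ℝ v ξ - a * quadForm ε ξ : ℝ) * wave ε (t + r * a) (x + r • v) ξ) r := by
  have hp : ∀ r : ℝ, phase ε (t + r * a) (x + r • v) ξ =
      phase ε t x ξ + r * (inner ℝ v ξ - a * quadForm ε ξ) := by
    intro r
    simp only [phase, inner_add_left, real_inner_smul_left]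
    ring
  have h1 : HasDerivAt (fun r : ℝ => phase ε (t + r * a) (x + r • v) ξ)
      (inner ℝ v ξ - a * quadForm ε ξ) r := by
    simp only [hp]
    simpa using ((hasDerivAt_id r).mul_const (inner ℝ v ξ - a * quadForm ε ξ)).const_add (phase ε t x ξ)
  unfold wave
  convert (h1.ofReal_comp.mul_const Complex.I).cexp using 1
  ring

/-- The dilation factor for time that comes from the normalisation of the Fourier transform. -/
def timeScale : ℝ := (2 * Real.pi) ^ 2

/-- Reconciles the factor 2π in the exponent of `𝓕` with the kernels above: they are evaluated at
position 2πx and time (2π)² t. -/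
lemma wave_scale (ε : Fin n → ℝ) (t : ℝ) (x ξ : Space n) :
    wave ε (timeScale * t) ((2 * Real.pi) • x) ξ =
      Complex.exp (↑(2 * Real.pi * inner ℝ ξ x) * Complex.I) *
        Complex.exp (-Complex.I * t * quadForm ε ((2 * Real.pi) • ξ)) := by
  unfold wave
  rw [← Complex.exp_add]
  congr 1
  have hq : quadForm ε ((2 * Real.pi) • ξ) = timeScale * quadForm ε ξ := by
    simp only [quadForm, timeScale, Finset.mul_sum, PiLp.smul_apply, smul_eq_mul]
    refine Finset.sum_congr rfl fun i _ => ?_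
    ring
  rw [hq, phase, real_inner_smul_left, real_inner_comm]
  push_cast
  ring

lemma fourierInv_eq_kernel (ε : Fin n → ℝ) (f : Space n → ℂ) (x : Space n) :
    𝓕⁻ f x = kernel ε f 0 ((2 * Real.pi) • x) := by
  rw [Real.fourierInv_eq', kernel]
  refine integral_congr_ae (Filter.Eventually.of_forall fun ξ => ?_)
  have := wave_scale ε 0 x ξ
  simp only [mul_zero, Complex.ofReal_zero, zero_mul, Complex.exp_zero, mul_one] at this
  simp only [this, smul_eq_mul]

lemma kernel_timeScale (ε : Fin n → ℝ) (f : Space n → ℂ) (t : ℝ) (x : Space n) :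
    𝓕⁻ (fun ξ => wave ε (timeScale * t) 0 ξ * f ξ) x =
      kernel ε f (timeScale * t) ((2 * Real.pi) • x) := by
  rw [fourierInv_eq_kernel ε, kernel, kernel]
  refine integral_congr_ae (Filter.Eventually.of_forall fun ξ => ?_)
  simp only
  rw [← mul_assoc, ← wave_add, zero_add, add_zero]

lemma propagator_eq (ε : Fin n → ℝ) (t : ℝ) (f : Space n → ℂ) (x : Space n) :
    propagator ε t f x = kernel ε (𝓕 f) (timeScale * t) ((2 * Real.pi) • x) := by
  rw [← kernel_timeScale, propagator, fourierMult]
  refine congrArg (fun g : Space n → ℂ => 𝓕⁻ g x) (funext fun ξ => ?_)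
  have := wave_scale ε t 0 ξ
  rw [smul_zero, inner_zero_right, mul_zero, Complex.ofReal_zero, zero_mul, Complex.exp_zero,
    one_mul] at this
  rw [this]

/-- For t < 0 the cutoff equals -1 on (t, 0], which matches the orientation of the interval
integral; both signs of time are thus treated together. -/
lemma intervalIntegral_eq_timeCutoff (f : ℝ → ℂ) (t : ℝ) :
    ∫ s in (0 : ℝ)..t, f s = ∫ s, timeCutoff t s * f s := by
  rcases le_total 0 t with h | h
  · rw [intervalIntegral.integral_of_le h, ← integral_indicator measurableSet_Ioc]
    refine integral_congr_ae (Filter.Eventually.of_forall fun s => ?_)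
    simp only [Set.indicator_apply, Set.mem_Ioc, timeCutoff]
    by_cases h1 : s ≤ 0
    · rw [if_neg (fun h' => absurd h1 (not_le.2 h'.1)), if_pos (h1.trans h), if_pos h1]; simp
    · by_cases h2 : s ≤ t
      · rw [if_pos ⟨not_le.1 h1, h2⟩, if_pos h2, if_neg h1]; simp
      · rw [if_neg (fun h' => h2 h'.2), if_neg h2, if_neg h1]; simp
  · rw [intervalIntegral.integral_of_ge h, ← integral_indicator measurableSet_Ioc, ← integral_neg]
    refine integral_congr_ae (Filter.Eventually.of_forall fun s => ?_)
    simp only [Set.indicator_apply, Set.mem_Ioc, timeCutoff]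
    by_cases h1 : s ≤ t
    · rw [if_neg (fun h' => absurd h1 (not_le.2 h'.1)), if_pos (h1.trans h), if_pos h1]; simp
    · by_cases h2 : s ≤ 0
      · rw [if_pos ⟨not_le.1 h1, h2⟩, if_pos h2, if_neg h1]; simp
      · rw [if_neg (fun h' => h2 h'.2), if_neg h2, if_neg h1]; simp

lemma measurable_timeCutoff_right (t : ℝ) : Measurable fun s => (timeCutoff t s : ℂ) :=
  Complex.measurable_ofReal.comp (measurable_timeCutoff.comp (measurable_const.prodMk measurable_id))

lemma integrable_timeCutoff (t : ℝ) : Integrable fun s => (timeCutoff t s : ℂ) := by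
  have h : Integrable ((Set.Icc (-|t|) |t|).indicator fun _ : ℝ => (1 : ℝ)) :=
    (integrable_indicator_iff measurableSet_Icc).2 (integrableOn_const measure_Icc_lt_top.ne)
  refine h.mono' (measurable_timeCutoff_right t).aestronglyMeasurable
    (Filter.Eventually.of_forall fun s => ?_)
  rw [Complex.norm_real]
  by_cases hs : s ∈ Set.Icc (-|t|) |t|
  · rw [Set.indicator_of_mem hs]; exact abs_timeCutoff_le t s
  · rw [Set.indicator_of_notMem hs]
    have : timeCutoff t s = 0 := by
      unfold timeCutoff
      rw [Set.mem_Icc, not_and_or, not_le, not_le] at hs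
      have h1 := neg_abs_le t
      have h2 := le_abs_self t
      have h3 := abs_nonneg t
      rcases hs with hs | hs
      · rw [if_pos (by linarith), if_pos (by linarith), sub_self]
      · rw [if_neg (by linarith), if_neg (by linarith), sub_self]
    rw [this, norm_zero]

lemma intervalIntegral_integral_comm {Y : Type*} [MeasurableSpace Y] {ν : Measure Y} [SFinite ν]
    {A : ℝ → Y → ℂ} (hA : Measurable fun p : ℝ × Y => A p.1 p.2) {b : Y → ℝ} (hb : Integrable b ν)
    (h : ∀ s y, ‖A s y‖ ≤ b y) (t : ℝ) :
    ∫ s in (0 : ℝ)..t, (∫ y, A s y ∂ν) = ∫ y, (∫ s in (0 : ℝ)..t, A s y) ∂ν := by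
  simp only [intervalIntegral_eq_timeCutoff, ← integral_const_mul]
  refine integral_integral_swap ?_
  refine ((integrable_timeCutoff t).norm.mul_prod hb).mono'
    (((measurable_timeCutoff_right t).comp measurable_fst).mul hA).aestronglyMeasurable
    (Filter.Eventually.of_forall fun p => ?_)
  simp only [Function.uncurry, norm_mul]
  exact mul_le_mul_of_nonneg_left (h _ _) (norm_nonneg _)

/-- The Fourier transform of the Duhamel integral of a family `f`, conjugated by the flow. -/
def density (ε : Fin n → ℝ) (f : ℝ → 𝓢(Space n, ℂ)) (t : ℝ) (ξ : Space n) : ℂ :=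
  ∫ s in (0 : ℝ)..t, wave ε (-(timeScale * s)) 0 ξ * f s ξ

section

variable {f : ℝ → 𝓢(Space n, ℂ)} (ε : Fin n → ℝ)

lemma continuous_wave_mul_family (hf : IsBoundedFamily f) :
    Continuous fun p : ℝ × Space n => wave ε (-(timeScale * p.1)) 0 p.2 * f p.1 p.2 := by
  have h : Continuous fun p : ℝ × Space n => (-(timeScale * p.1), (0 : Space n), p.2) := by fun_prop
  exact ((continuous_wave ε).comp h).mul hf.continuous

lemma continuous_density (hf : IsBoundedFamily f) :
    Continuous fun p : ℝ × Space n => density ε f p.1 p.2 := by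
  unfold density
  refine intervalIntegral.continuous_parametric_intervalIntegral_of_continuous
    (f := fun (p : ℝ × Space n) s => wave ε (-(timeScale * s)) 0 p.2 * f s p.2) ?_ continuous_fst
  exact (continuous_wave_mul_family ε hf).comp
    (f := fun q : (ℝ × Space n) × ℝ => (q.2, q.1.2)) (by fun_prop)

lemma exists_norm_density_le (hf : IsBoundedFamily f) (N : ℕ) :
    ∃ C : ℝ, 0 ≤ C ∧ ∀ t ξ, ‖density ε f t ξ‖ ≤ C * ((1 + ‖ξ‖)⁻¹) ^ N * |t| := by
  obtain ⟨C, hC, h⟩ := hf.exists_norm_le N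
  refine ⟨C, hC, fun t ξ => ?_⟩
  have := intervalIntegral.norm_integral_le_of_norm_le_const (a := 0) (b := t)
    (f := fun s => wave ε (-(timeScale * s)) 0 ξ * f s ξ) (C := C * ((1 + ‖ξ‖)⁻¹) ^ N)
    fun s _ => by rw [norm_mul, norm_wave, one_mul]; exact h s ξ
  rwa [sub_zero] at this

lemma hasDerivAt_density (hf : IsBoundedFamily f) (t : ℝ) (ξ : Space n) :
    HasDerivAt (fun t => density ε f t ξ) (wave ε (-(timeScale * t)) 0 ξ * f t ξ) t := by
  have hc : Continuous fun s => wave ε (-(timeScale * s)) 0 ξ * f s ξ :=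
    (continuous_wave_mul_family ε hf).comp (f := fun s => (s, ξ)) (by fun_prop)
  exact (hc.integral_hasStrictDerivAt 0 t).hasDerivAt

/-- By the group law the phase at time t - s splits; the factor in t leaves the s-integral and the
rest is `density`. -/
lemma integral_kernel_eq (hf : IsBoundedFamily f) (t : ℝ) (x : Space n) :
    ∫ s in (0 : ℝ)..t, kernel ε (f s) (timeScale * (t - s)) ((2 * Real.pi) • x) =
      kernel ε (density ε f t) (timeScale * t) ((2 * Real.pi) • x) := by
  obtain ⟨C, hC, h⟩ := hf.exists_norm_le (n + 1)
  unfold kernel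
  rw [intervalIntegral_integral_comm (b := fun ξ => C * ((1 + ‖ξ‖)⁻¹) ^ (n + 1))]
  · refine integral_congr_ae (Filter.Eventually.of_forall fun ξ => ?_)
    simp only [density]
    rw [← intervalIntegral.integral_const_mul]
    apply intervalIntegral.integral_congr
    intro s _
    beta_reduce
    rw [← mul_assoc, ← wave_add, add_zero]
    congr 2
    ring
  · have h : Continuous fun p : ℝ × Space n =>
        (timeScale * (t - p.1), (2 * Real.pi) • x, p.2) := by fun_prop
    exact (((continuous_wave ε).comp h).mul hf.continuous).measurable
  · exact (integrable_inv_one_add_norm_pow n).const_mul C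
  · intro s ξ
    rw [norm_mul, norm_wave, one_mul]
    exact h s ξ

end

/-- The Duhamel integral of a family of Schwartz functions, through its Fourier transform. -/
lemma duhamel_eq {f : ℝ → 𝓢(Space n, ℂ)} (hf : IsBoundedFamily f) (ε : Fin n → ℝ) (t : ℝ) (x : Space n) :
    duhamel ε (fun s => f s) t x = -Complex.I *
      kernel ε (density ε (fun s => 𝓕 (f s)) t) (timeScale * t) ((2 * Real.pi) • x) := by
  rw [← integral_kernel_eq ε hf.fourier, duhamel]
  simp only [propagator_eq, SchwartzMap.fourier_coe]

end

/-! ### The Duhamel integral is a classical solution. -/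

section

variable {n : ℕ}

lemma norm_quadForm_le {ε : Fin n → ℝ} (hε : IsSigns ε) (ξ : Space n) :
    ‖quadForm ε ξ‖ ≤ (1 + ‖ξ‖) ^ 2 := by
  have h1 : ‖quadForm ε ξ‖ ≤ ‖ξ‖ ^ 2 := by
    rw [EuclideanSpace.norm_sq_eq]
    refine (norm_sum_le _ _).trans (Finset.sum_le_sum fun i _ => ?_)
    rw [norm_mul, norm_pow]
    rcases hε i with h | h <;> simp [h]
  refine h1.trans ?_
  gcongr
  linarith

/-- Continuous functions of rapid decay. -/
structure IsRapid (h : Space n → ℂ) : Prop where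
  continuous : Continuous h
  decay : ∀ N : ℕ, ∃ C : ℝ, 0 ≤ C ∧ ∀ ξ, ‖h ξ‖ ≤ C * ((1 + ‖ξ‖)⁻¹) ^ N

namespace IsRapid

variable {h : Space n → ℂ}

lemma integrable (hh : IsRapid h) : Integrable h := by
  obtain ⟨C, hC, H⟩ := hh.decay (n + 1)
  exact ((integrable_inv_one_add_norm_pow n).const_mul C).mono' hh.continuous.aestronglyMeasurable
    (Filter.Eventually.of_forall H)

lemma mul_of_norm_le (hh : IsRapid h) {g : Space n → ℂ} (hg : Continuous g) {A : ℝ} (hA : 0 ≤ A)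
    {k : ℕ} (hgA : ∀ ξ, ‖g ξ‖ ≤ A * (1 + ‖ξ‖) ^ k) : IsRapid fun ξ => g ξ * h ξ := by
  refine ⟨hg.mul hh.continuous, fun N => ?_⟩
  obtain ⟨C, hC, H⟩ := hh.decay (k + N)
  refine ⟨A * C, by positivity, fun ξ => ?_⟩
  rw [norm_mul]
  calc _ ≤ A * (1 + ‖ξ‖) ^ k * (C * ((1 + ‖ξ‖)⁻¹) ^ (k + N)) :=
        mul_le_mul (hgA ξ) (H ξ) (norm_nonneg _) (by positivity)
    _ = _ := by rw [pow_add, inv_pow]; field_simp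

lemma coord_mul (hh : IsRapid h) (k : Fin n) :
    IsRapid fun ξ : Space n => (Complex.I * (2 * Real.pi * ξ k : ℝ)) * h ξ := by
  refine hh.mul_of_norm_le (A := 2 * Real.pi) (k := 1) ?_ (by positivity) fun ξ => ?_
  · fun_prop
  · rw [norm_mul, Complex.norm_I, one_mul, Complex.norm_real, norm_mul,
      Real.norm_of_nonneg (by positivity), pow_one]
    gcongr
    linarith [PiLp.norm_apply_le ξ k]

lemma quadForm_mul (hh : IsRapid h) {ε : Fin n → ℝ} (hε : IsSigns ε) :
    IsRapid fun ξ : Space n => (quadForm ε ξ : ℂ) * h ξ := by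
  refine hh.mul_of_norm_le (A := 1) (k := 2) ?_ zero_le_one fun ξ => ?_
  · exact Complex.continuous_ofReal.comp (continuous_quadForm ε)
  · rw [Complex.norm_real, one_mul]
    exact norm_quadForm_le hε ξ

lemma hasLineDerivAt_kernel (hh : IsRapid h) (ε : Fin n → ℝ) (τ : ℝ) (k : Fin n) (x : Space n) :
    HasLineDerivAt ℝ (fun x => kernel ε h τ ((2 * Real.pi) • x))
      (kernel ε (fun ξ => (Complex.I * (2 * Real.pi * ξ k : ℝ)) * h ξ) τ ((2 * Real.pi) • x)) x
      (EuclideanSpace.single k 1) := by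
  have hw : ∀ (r : ℝ) (ξ : Space n), HasDerivAt
      (fun r : ℝ => wave ε τ ((2 * Real.pi) • (x + r • EuclideanSpace.single k (1 : ℝ))) ξ)
      (Complex.I * (2 * Real.pi * ξ k : ℝ) *
        wave ε τ ((2 * Real.pi) • (x + r • EuclideanSpace.single k (1 : ℝ))) ξ) r := by
    intro r ξ
    have := hasDerivAt_wave ε τ 0 ((2 * Real.pi) • x)
      ((2 * Real.pi) • EuclideanSpace.single k (1 : ℝ)) ξ r
    simp only [mul_zero, add_zero, zero_mul, sub_zero, real_inner_smul_left,
      EuclideanSpace.inner_single_left] at this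
    simp only [smul_add, smul_comm (2 * Real.pi) _ (EuclideanSpace.single k (1 : ℝ))]
    simpa using this
  obtain ⟨C, hC, H⟩ := (hh.coord_mul k).decay (n + 1)
  have key := hasDerivAt_integral_of_dominated_loc_of_deriv_le (μ := volume) (x₀ := (0 : ℝ))
    (s := Set.univ)
    (F := fun r ξ => wave ε τ ((2 * Real.pi) • (x + r • EuclideanSpace.single k (1 : ℝ))) ξ * h ξ)
    (F' := fun r ξ => (Complex.I * (2 * Real.pi * ξ k : ℝ) *
        wave ε τ ((2 * Real.pi) • (x + r • EuclideanSpace.single k (1 : ℝ))) ξ) * h ξ)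
    (bound := fun ξ => C * ((1 + ‖ξ‖)⁻¹) ^ (n + 1)) Filter.univ_mem
    (Filter.Eventually.of_forall fun r => (integrable_wave_mul ε _ _ hh.integrable).1)
    (integrable_wave_mul ε _ _ hh.integrable) ?_
    (Filter.Eventually.of_forall fun ξ r _ => ?_)
    ((integrable_inv_one_add_norm_pow n).const_mul C)
    (Filter.Eventually.of_forall fun ξ r _ => (hw r ξ).mul_const (h ξ))
  · refine HasDerivAt.congr_deriv key.2 ?_
    unfold kernel
    refine integral_congr_ae (Filter.Eventually.of_forall fun ξ => ?_)
    simp only [zero_smul, add_zero]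
    ring
  · refine ((integrable_wave_mul ε τ ((2 * Real.pi) • (x + (0 : ℝ) • EuclideanSpace.single k (1 : ℝ)))
      (hh.coord_mul k).integrable).1).congr (Filter.Eventually.of_forall fun ξ => ?_)
    simp only
    ring
  · have := H ξ
    rw [norm_mul] at this ⊢
    rwa [norm_mul _ (wave _ _ _ _), norm_wave, mul_one]

/-- As a function of x this is a reflected Fourier transform of a rapidly decaying function, so
moments of the symbol control its derivatives. -/
lemma contDiff_kernel (hh : IsRapid h) (ε : Fin n → ℝ) (τ : ℝ) :
    ContDiff ℝ 2 fun x : Space n => kernel ε h (timeScale * τ) ((2 * Real.pi) • x) := by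
  have hc : ContDiff ℝ ((2 : ℕ∞) : ℕ∞ω) (𝓕 fun ξ => wave ε (timeScale * τ) 0 ξ * h ξ) := by
    refine Real.contDiff_fourier fun k _ => ?_
    obtain ⟨C, hC, H⟩ := hh.decay (k + (n + 1))
    refine ((integrable_inv_one_add_norm_pow n).const_mul C).mono' ?_
      (Filter.Eventually.of_forall fun ξ => ?_)
    · have := continuous_wave_right ε (timeScale * τ) 0
      have h2 := hh.continuous
      exact Continuous.aestronglyMeasurable (by fun_prop)
    · rw [norm_mul, norm_pow, norm_norm, norm_norm, norm_mul, norm_wave, one_mul]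
      calc _ ≤ (1 + ‖ξ‖) ^ k * (C * ((1 + ‖ξ‖)⁻¹) ^ (k + (n + 1))) := by
            refine mul_le_mul ?_ (H ξ) (norm_nonneg _) (by positivity)
            gcongr
            linarith
        _ = _ := by rw [pow_add, inv_pow _ k]; field_simp
  have e : (fun x : Space n => kernel ε h (timeScale * τ) ((2 * Real.pi) • x)) =
      fun x => 𝓕 (fun ξ => wave ε (timeScale * τ) 0 ξ * h ξ) (-x) := by
    ext x
    rw [← kernel_timeScale, Real.fourierInv_eq_fourier_neg]
  rw [e]
  exact hc.comp contDiff_neg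

lemma ultraLaplacian_kernel (hh : IsRapid h) (ε : Fin n → ℝ) (τ : ℝ) (x : Space n) (c : ℂ) :
    ultraLaplacian ε (fun x => c * kernel ε h τ ((2 * Real.pi) • x)) x =
      -(c * timeScale) * kernel ε (fun ξ => (quadForm ε ξ : ℂ) * h ξ) τ ((2 * Real.pi) • x) := by
  have h1 : ∀ (g : Space n → ℂ) (_ : IsRapid g) (k : Fin n) (y : Space n),
      lineDeriv ℝ (fun x => c * kernel ε g τ ((2 * Real.pi) • x)) y (EuclideanSpace.single k 1) =
      c * kernel ε (fun ξ => (Complex.I * (2 * Real.pi * ξ k : ℝ)) * g ξ) τ ((2 * Real.pi) • y) :=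
    fun g hg k y => (HasDerivAt.const_mul c (hg.hasLineDerivAt_kernel ε τ k y)).deriv
  unfold ultraLaplacian
  simp only [h1 h hh, h1 _ (hh.coord_mul _)]
  unfold kernel
  simp only [← integral_const_mul]
  rw [← integral_finsetSum]
  · refine integral_congr_ae (Filter.Eventually.of_forall fun ξ => ?_)
    simp only [quadForm, timeScale]
    push_cast
    simp only [Finset.sum_mul, Finset.mul_sum]
    refine Finset.sum_congr rfl fun k _ => ?_
    linear_combination (ε k * c * wave ε τ ((2 * Real.pi) • x) ξ * (2 * Real.pi * ξ k) ^ 2 * h ξ) *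
      Complex.I_sq
  · intro k _
    exact ((integrable_wave_mul ε _ _ ((hh.coord_mul k).coord_mul k).integrable).const_mul c).const_mul _

end IsRapid

lemma IsBoundedFamily.isRapid_density {f : ℝ → 𝓢(Space n, ℂ)} (hf : IsBoundedFamily f)
    (ε : Fin n → ℝ) (t : ℝ) : IsRapid (density ε f t) := by
  refine ⟨(continuous_density ε hf).comp (f := fun ξ => (t, ξ)) (by fun_prop), fun N => ?_⟩
  obtain ⟨C, hC, h⟩ := exists_norm_density_le ε hf N
  refine ⟨C * |t|, by positivity, fun ξ => (h t ξ).trans_eq (by ring)⟩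

/-- Product rule under the integral. Differentiating the wave produces the quadratic form;
differentiating `density` produces the source times a phase that cancels the outer one, hence the
kernel at time 0. -/
lemma hasDerivAt_kernel_density {f : ℝ → 𝓢(Space n, ℂ)} (hf : IsBoundedFamily f) {ε : Fin n → ℝ}
    (hε : IsSigns ε) (t : ℝ) (X : Space n) :
    HasDerivAt (fun t => kernel ε (density ε f t) (timeScale * t) X)
      (-(Complex.I * timeScale) *
        kernel ε (fun ξ => (quadForm ε ξ : ℂ) * density ε f t ξ) (timeScale * t) X +
        kernel ε (f t) 0 X) t := by
  -- Two powers compensate the quadratic form and n + 1 remain for an integrable majorant.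
  obtain ⟨C₁, hC₁, H₁⟩ := exists_norm_density_le ε hf (n + 3)
  obtain ⟨C₂, hC₂, H₂⟩ := hf.exists_norm_le (n + 1)
  have hw : ∀ (t : ℝ) (ξ : Space n), HasDerivAt (fun t : ℝ => wave ε (timeScale * t) X ξ)
      (-(Complex.I * timeScale) * (quadForm ε ξ * wave ε (timeScale * t) X ξ)) t := by
    intro t ξ
    have := hasDerivAt_wave ε 0 timeScale X 0 ξ t
    simp only [zero_add, smul_zero, add_zero, inner_zero_left, zero_sub, mul_comm _ timeScale] at this
    refine this.congr_deriv ?_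
    push_cast
    ring
  have hφ : ∀ (t : ℝ) (ξ : Space n), HasDerivAt
      (fun t => wave ε (timeScale * t) X ξ * density ε f t ξ)
      (-(Complex.I * timeScale) * (wave ε (timeScale * t) X ξ * (quadForm ε ξ * density ε f t ξ)) +
        wave ε 0 X ξ * f t ξ) t := by
    intro t ξ
    refine ((hw t ξ).mul (hasDerivAt_density ε hf t ξ)).congr_deriv ?_
    have : wave ε 0 X ξ = wave ε (timeScale * t) X ξ * wave ε (-(timeScale * t)) 0 ξ := by
      rw [← wave_add]; simp
    rw [this]
    ring
  have hi1 := integrable_wave_mul ε (timeScale * t) X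
    ((hf.isRapid_density ε t).quadForm_mul hε).integrable
  have hi2 := integrable_wave_mul ε 0 X (f t).integrable
  have hts : 0 ≤ timeScale := by unfold timeScale; positivity
  have key := hasDerivAt_integral_of_dominated_loc_of_deriv_le (μ := volume) (x₀ := t)
    (s := Metric.ball t 1)
    (F := fun t ξ => wave ε (timeScale * t) X ξ * density ε f t ξ)
    (F' := fun t ξ => -(Complex.I * timeScale) *
      (wave ε (timeScale * t) X ξ * (quadForm ε ξ * density ε f t ξ)) + wave ε 0 X ξ * f t ξ)
    (bound := fun ξ => (timeScale * (C₁ * (|t| + 1)) + C₂) * ((1 + ‖ξ‖)⁻¹) ^ (n + 1))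
    (Metric.ball_mem_nhds t one_pos)
    (Filter.Eventually.of_forall fun t =>
      (integrable_wave_mul ε _ _ (hf.isRapid_density ε t).integrable).1)
    (integrable_wave_mul ε _ _ (hf.isRapid_density ε t).integrable)
    ((hi1.const_mul _).add hi2).1
    (Filter.Eventually.of_forall fun ξ r hr => ?_)
    ((integrable_inv_one_add_norm_pow n).const_mul _)
    (Filter.Eventually.of_forall fun ξ r _ => hφ r ξ)
  · refine key.2.congr_deriv ?_
    unfold kernel
    rw [integral_add (hi1.const_mul _) hi2, integral_const_mul]
  · refine (norm_add_le _ _).trans ?_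
    rw [norm_mul, norm_neg, norm_mul, Complex.norm_I, one_mul, Complex.norm_real,
      Real.norm_of_nonneg hts, norm_mul, norm_wave, one_mul, norm_mul _ (f r ξ), norm_wave, one_mul,
      norm_mul, Complex.norm_real, add_mul, mul_assoc]
    refine add_le_add (mul_le_mul_of_nonneg_left ?_ hts) (H₂ r ξ)
    have hr' : |r| ≤ |t| + 1 := by
      rw [Metric.mem_ball, Real.dist_eq] at hr
      have := abs_sub_abs_le_abs_sub r t
      linarith
    calc _ ≤ (1 + ‖ξ‖) ^ 2 * (C₁ * ((1 + ‖ξ‖)⁻¹) ^ (n + 3) * (|t| + 1)) := by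
          refine mul_le_mul (norm_quadForm_le hε ξ) ((H₁ r ξ).trans ?_) (norm_nonneg _) (by positivity)
          gcongr
      _ = _ := by
          rw [show n + 3 = (n + 1) + 2 by ring, pow_add _ (n + 1) 2, inv_pow _ 2]
          field_simp

lemma kernel_fourier_zero (ε : Fin n → ℝ) (f : 𝓢(Space n, ℂ)) (x : Space n) :
    kernel ε (𝓕 f : 𝓢(Space n, ℂ)) 0 ((2 * Real.pi) • x) = f x := by
  rw [← fourierInv_eq_kernel, ← SchwartzMap.fourierInv_coe, fourierInv_fourier_eq]

theorem solvesIVP_duhamel {ε : Fin n → ℝ} (hε : IsSigns ε) {f : ℝ → 𝓢(Space n, ℂ)}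
    (hf : IsBoundedFamily f) : SolvesIVP ε (fun t x => f t x) (duhamel ε fun t x => f t x) := by
  have hr := fun t => hf.fourier.isRapid_density ε t
  have hu : duhamel ε (fun t x => f t x) = fun t x => -Complex.I *
      kernel ε (density ε (fun s => 𝓕 (f s)) t) (timeScale * t) ((2 * Real.pi) • x) :=
    funext fun t => funext fun x => duhamel_eq hf ε t x
  have hd := fun (t : ℝ) (x : Space n) =>
    (hasDerivAt_kernel_density hf.fourier hε t ((2 * Real.pi) • x)).const_mul (-Complex.I)
  rw [hu]
  refine ⟨fun t => contDiff_const.mul ((hr t).contDiff_kernel ε t),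
    fun x t => (hd t x).differentiableAt, fun t x => ?_, fun x => ?_⟩
  · rw [(hd t x).deriv, (hr t).ultraLaplacian_kernel, kernel_fourier_zero]
    linear_combination (-f t x) * Complex.I_sq +
      (timeScale * kernel ε (fun ξ => (quadForm ε ξ : ℂ) * density ε (fun s => 𝓕 (f s)) t ξ)
        (timeScale * t) ((2 * Real.pi) • x) * Complex.I) * Complex.I_sq
  · have : density ε (fun s => 𝓕 (f s)) 0 = 0 := by
      ext ξ
      simp [density]
    rw [this]
    simp [kernel]

end

/-! ### Dyadic projections and their commutation with the Duhamel integral. -/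

section

variable {n : ℕ}

lemma IsCutoff.eq_zero {χ : ℝ → ℝ} (hχ : IsCutoff χ) {s : ℝ} (hs : 2 ≤ s) : χ s = 0 := by
  by_contra h
  have := hχ.support (subset_tsupport χ (Function.mem_support.2 h))
  linarith [this.2]

lemma psi_eq_zero {χ : ℝ → ℝ} (hχ : IsCutoff χ) {ξ : Space n} (h : ¬(1 / 2 ≤ ‖ξ‖ ∧ ‖ξ‖ ≤ 2)) :
    psi χ ξ = 0 := by
  have h0 := norm_nonneg ξ
  rw [not_and_or, not_le, not_le] at h
  unfold psi
  rcases h with h | h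
  · rw [hχ.eq_one _ (by rw [abs_of_nonneg h0]; linarith),
      hχ.eq_one _ (by rw [abs_of_nonneg (by positivity)]; linarith), sub_self]
  · rw [hχ.eq_zero h.le, hχ.eq_zero (by linarith), sub_self]

/-- The norm is not smooth at the origin, but χ = 1 on [-1, 1] makes the composition constant near
it. -/
lemma IsCutoff.contDiff_comp_norm {χ : ℝ → ℝ} (hχ : IsCutoff χ) :
    ContDiff ℝ ∞ fun ξ : Space n => χ ‖ξ‖ := by
  rw [contDiff_iff_contDiffAt]
  intro ξ
  rcases eq_or_ne ξ 0 with rfl | h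
  · refine (contDiffAt_const (c := (1 : ℝ))).congr_of_eventuallyEq ?_
    filter_upwards [Metric.ball_mem_nhds (0 : Space n) one_pos] with ξ hξ
    rw [mem_ball_zero_iff] at hξ
    exact hχ.eq_one _ (by rw [abs_of_nonneg (norm_nonneg ξ)]; exact hξ.le)
  · exact hχ.smooth.contDiffAt.comp ξ (contDiffAt_norm ℝ h)

lemma contDiff_psi {χ : ℝ → ℝ} (hχ : IsCutoff χ) : ContDiff ℝ ∞ (psi χ : Space n → ℝ) := by
  have h1 := hχ.contDiff_comp_norm (n := n)
  have h2 : (psi χ : Space n → ℝ) = fun ξ => χ ‖ξ‖ - χ ‖(2 : ℝ) • ξ‖ := by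
    ext ξ
    rw [psi, norm_smul, Real.norm_of_nonneg zero_le_two]
  rw [h2]
  exact h1.sub (h1.comp (contDiff_const_smul (2 : ℝ)))

/-- The symbol of `P_j`, in the normalisation of the Fourier transform of Mathlib. -/
def dyadicSymbol (χ : ℝ → ℝ) (j : ℤ) (ξ : Space n) : ℂ :=
  (psi χ ((2 : ℝ) ^ (-j) • (2 * Real.pi) • ξ) : ℝ)

lemma hasTemperateGrowth_dyadicSymbol {χ : ℝ → ℝ} (hχ : IsCutoff χ) (j : ℤ) :
    (dyadicSymbol χ j : Space n → ℂ).HasTemperateGrowth := by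
  have ha : 0 < (2 : ℝ) ^ (-j) * (2 * Real.pi) := by positivity
  refine HasCompactSupport.hasTemperateGrowth ?_ ?_
  · refine HasCompactSupport.intro (isCompact_closedBall (0 : Space n)
      (2 / ((2 : ℝ) ^ (-j) * (2 * Real.pi)))) fun ξ hξ => ?_
    rw [mem_closedBall_zero_iff, not_le, div_lt_iff₀ ha] at hξ
    rw [dyadicSymbol, psi_eq_zero hχ, Complex.ofReal_zero]
    rintro ⟨-, h⟩
    rw [smul_smul, norm_smul, Real.norm_of_nonneg ha.le] at h
    linarith
  · unfold dyadicSymbol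
    exact Complex.ofRealCLM.contDiff.comp ((contDiff_psi hχ).comp
      ((contDiff_const_smul _).comp (contDiff_const_smul _)))

/-- The frequency projection `P_j` on Schwartz functions. -/
def schwartzProj (χ : ℝ → ℝ) (j : ℤ) (f : 𝓢(Space n, ℂ)) : 𝓢(Space n, ℂ) :=
  𝓕⁻ (SchwartzMap.smulLeftCLM ℂ (dyadicSymbol χ j) (𝓕 f))

lemma coe_schwartzProj {χ : ℝ → ℝ} (hχ : IsCutoff χ) (j : ℤ) (f : 𝓢(Space n, ℂ)) :
    (schwartzProj χ j f : Space n → ℂ) = dyadicProj χ j f := by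
  rw [schwartzProj, SchwartzMap.fourierInv_coe, dyadicProj, fourierMult]
  congr 1
  ext ξ
  rw [SchwartzMap.smulLeftCLM_apply_apply (hasTemperateGrowth_dyadicSymbol hχ j),
    SchwartzMap.fourier_coe]
  rfl

lemma fourier_schwartzProj_apply {χ : ℝ → ℝ} (hχ : IsCutoff χ) (j : ℤ) (f : 𝓢(Space n, ℂ))
    (ξ : Space n) : 𝓕 (schwartzProj χ j f) ξ = dyadicSymbol χ j ξ * 𝓕 f ξ := by
  rw [schwartzProj, fourier_fourierInv_eq,
    SchwartzMap.smulLeftCLM_apply_apply (hasTemperateGrowth_dyadicSymbol hχ j), smul_eq_mul]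

lemma IsBoundedFamily.schwartzProj {f : ℝ → 𝓢(Space n, ℂ)} (hf : IsBoundedFamily f) {χ : ℝ → ℝ}
    (hχ : IsCutoff χ) (j : ℤ) : IsBoundedFamily fun s => schwartzProj χ j (f s) :=
  (hf.fourier.smulLeft (hasTemperateGrowth_dyadicSymbol hχ j)).fourierInv

/-- Bounded families are stable under continuous linear maps, so the integration by parts argument
runs uniformly in s. The outcome is the spatial decay of the Duhamel integral. -/
lemma exists_pow_mul_norm_kernel_family_le {f : ℝ → 𝓢(Space n, ℂ)} (hf : IsBoundedFamily f) (N : ℕ) :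
    ∃ C : ℝ, 0 ≤ C ∧ ∀ s ε t x, IsSigns ε →
      ‖x‖ ^ N * ‖kernel ε (f s) t x‖ ≤ C * (1 + |t|) ^ N := by
  obtain ⟨C, h⟩ := exists_pow_mul_norm_kernel_le
    (S := {f : ℝ → 𝓢(Space n, ℂ) | Bornology.IsVonNBounded ℂ (Set.range f)})
    (fun f hf k => isVonNBounded_range_comp hf (coordDeriv k))
    (fun f hf k => isVonNBounded_range_comp hf (coordMul k))
    (R := fun ε _ _ => IsSigns ε) (fun _ _ _ h => h) (w := fun _ => 1) (fun _ => zero_le_one)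
    (fun f hf => by
      obtain ⟨C, hC, h⟩ := exists_norm_le_of_isVonNBounded hf (n + 1)
      refine ⟨∫ ξ : Space n, C * ((1 + ‖ξ‖)⁻¹) ^ (n + 1), fun s ε t x _ => ?_⟩
      rw [mul_one]
      exact (norm_kernel_le _ _ _ _).trans (integral_mono (f s).integrable.norm
        ((integrable_inv_one_add_norm_pow n).const_mul C) (h s)))
    N f hf.bounded
  refine ⟨max C 0, le_max_right _ _, fun s ε t x hε => (h s ε t x hε).trans ?_⟩
  rw [mul_one]
  exact mul_le_mul_of_nonneg_right (le_max_left _ _) (by positivity)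

section

variable {f : ℝ → 𝓢(Space n, ℂ)} {ε : Fin n → ℝ}

lemma exists_pow_mul_norm_duhamel_le (hf : IsBoundedFamily f) (hε : IsSigns ε) (t : ℝ) (N : ℕ) :
    ∃ C : ℝ, ∀ x, ‖x‖ ^ N * ‖duhamel ε (fun s => f s) t x‖ ≤ C := by
  obtain ⟨C, hC, h⟩ := exists_pow_mul_norm_kernel_family_le hf.fourier N
  have hT : 0 ≤ timeScale := by unfold timeScale; positivity
  refine ⟨C * (1 + timeScale * |t|) ^ N * |t|, fun x => ?_⟩
  rw [duhamel, norm_mul, norm_neg, Complex.norm_I, one_mul]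
  have hx : ‖x‖ ^ N = ‖((‖x‖ ^ N : ℝ) : ℂ)‖ := by
    rw [Complex.norm_real, Real.norm_of_nonneg (by positivity)]
  rw [hx, ← norm_mul, ← intervalIntegral.integral_const_mul]
  have := intervalIntegral.norm_integral_le_of_norm_le_const (a := 0) (b := t)
    (f := fun s => ((‖x‖ ^ N : ℝ) : ℂ) * propagator ε (t - s) (f s) x)
    (C := C * (1 + timeScale * |t|) ^ N) fun s hs => ?_
  · rwa [sub_zero] at this
  · rw [norm_mul, ← hx, propagator_eq, ← SchwartzMap.fourier_coe]
    have hs' : |t - s| ≤ |t| := by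
      rcases Set.mem_uIoc.1 hs with ⟨h1, h2⟩ | ⟨h1, h2⟩
      · rw [abs_of_nonneg (by linarith), abs_of_nonneg (by linarith)]; linarith
      · rw [abs_of_nonpos (by linarith), abs_of_nonpos (by linarith)]; linarith
    have hpi : 1 ≤ 2 * Real.pi := by linarith [Real.two_le_pi]
    calc _ ≤ ‖(2 * Real.pi) • x‖ ^ N *
          ‖kernel ε (𝓕 (f s) : 𝓢(Space n, ℂ)) (timeScale * (t - s)) ((2 * Real.pi) • x)‖ := by
          gcongr
          rw [norm_smul, Real.norm_of_nonneg (by positivity)]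
          exact le_mul_of_one_le_left (norm_nonneg _) hpi
      _ ≤ C * (1 + |timeScale * (t - s)|) ^ N := h s ε _ _ hε
      _ ≤ _ := by
          rw [abs_mul, abs_of_nonneg hT]
          gcongr

lemma duhamel_eq_fourierInv (hf : IsBoundedFamily f) (t : ℝ) :
    duhamel ε (fun s => f s) t = 𝓕⁻ fun ξ => wave ε (timeScale * t) 0 ξ *
      (-Complex.I * density ε (fun s => 𝓕 (f s)) t ξ) := by
  ext x
  rw [duhamel_eq hf, kernel_timeScale, kernel, kernel, ← integral_const_mul]
  refine integral_congr_ae (Filter.Eventually.of_forall fun ξ => ?_)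
  simp only
  ring

lemma integrable_duhamel (hf : IsBoundedFamily f) (hε : IsSigns ε) (t : ℝ) :
    Integrable (duhamel ε (fun s => f s) t) := by
  obtain ⟨C₁, h₁⟩ := exists_pow_mul_norm_duhamel_le hf hε t 0
  obtain ⟨C₂, h₂⟩ := exists_pow_mul_norm_duhamel_le hf hε t (0 + (volume : Measure (Space n)).integrablePower)
  have hm : AEStronglyMeasurable (duhamel ε (fun s => f s) t) volume :=
    ((solvesIVP_duhamel hε hf).contDiff_space t).continuous.aestronglyMeasurable
  have := integrable_of_le_of_pow_mul_le (k := 0) (by simpa using h₁) h₂ hm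
  simp only [pow_zero, one_mul] at this
  exact (integrable_norm_iff hm).1 this

/-- `duhamel` is known as an inverse Fourier transform; applying `𝓕` to it requires integrability in
x, which is what `integrable_duhamel` supplies. -/
lemma fourier_duhamel (hf : IsBoundedFamily f) (hε : IsSigns ε) (t : ℝ) :
    𝓕 (duhamel ε (fun s => f s) t) = fun ξ => wave ε (timeScale * t) 0 ξ *
      (-Complex.I * density ε (fun s => 𝓕 (f s)) t ξ) := by
  have hd := hf.fourier.isRapid_density ε t
  have hi := integrable_duhamel hf hε t
  rw [duhamel_eq_fourierInv hf] at hi ⊢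
  refine Continuous.fourier_fourierInv_eq ?_ ?_ ?_
  · have h1 := continuous_wave_right ε (timeScale * t) 0
    have h2 := hd.continuous
    fun_prop
  · exact integrable_wave_mul ε _ _ (hd.integrable.const_mul _)
  · refine hi.comp_neg.congr (Filter.Eventually.of_forall fun x => ?_)
    simp only [Real.fourierInv_eq_fourier_neg, neg_neg]

/-- The frequency projections commute with the Duhamel integral. -/
lemma dyadicProj_duhamel (hf : IsBoundedFamily f) (hε : IsSigns ε) {χ : ℝ → ℝ} (hχ : IsCutoff χ)
    (j : ℤ) (t : ℝ) : dyadicProj χ j (duhamel ε (fun s => f s) t) =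
      duhamel ε (fun s => schwartzProj χ j (f s)) t := by
  rw [duhamel_eq_fourierInv (hf.schwartzProj hχ j), dyadicProj, fourierMult, fourier_duhamel hf hε]
  congr 1
  ext ξ
  have : density ε (fun s => 𝓕 (schwartzProj χ j (f s))) t ξ =
      dyadicSymbol χ j ξ * density ε (fun s => 𝓕 (f s)) t ξ := by
    unfold density
    rw [← intervalIntegral.integral_const_mul]
    apply intervalIntegral.integral_congr
    intro s _
    beta_reduce
    rw [fourier_schwartzProj_apply hχ]
    ring
  rw [this, dyadicSymbol]
  ring

end

end

/-! ### Scaling of the norms and the frequency-localised kernel representation. -/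

section

variable {n : ℕ}

section Scaling

lemma map_prod_smul {E : Type*} [NormedAddCommGroup E] [NormedSpace ℝ E] [FiniteDimensional ℝ E]
    [MeasurableSpace E] [BorelSpace E] (ν : Measure E) [ν.IsAddHaarMeasure] {a b : ℝ} (ha : 0 < a)
    (hb : 0 < b) :
    ((volume : Measure ℝ).prod ν).map (fun z : ℝ × E => (a * z.1, b • z.2)) =
      ENNReal.ofReal ((a * b ^ Module.finrank ℝ E)⁻¹) • (volume : Measure ℝ).prod ν := by
  have h1 : (volume : Measure ℝ).map (fun s => a * s) = ENNReal.ofReal a⁻¹ • volume := by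
    have := Measure.map_addHaar_smul (volume : Measure ℝ) ha.ne'
    simpa [Module.finrank_self, abs_of_pos ha] using this
  have h2 : ν.map (fun x => b • x) = ENNReal.ofReal (b ^ Module.finrank ℝ E)⁻¹ • ν := by
    have := Measure.map_addHaar_smul ν hb.ne'
    rwa [abs_of_pos (by positivity)] at this
  have h := Measure.map_prod_map (volume : Measure ℝ) ν (measurable_const_mul a)
    (measurable_const_smul b : Measurable fun x : E => b • x)
  rw [h1, h2, Measure.prod_smul_left, Measure.prod_smul_right, smul_smul,
    ← ENNReal.ofReal_mul (by positivity), ← mul_inv] at h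
  exact h.symm

lemma measurableEmbedding_prod_smul {E : Type*} [NormedAddCommGroup E] [NormedSpace ℝ E]
    [FiniteDimensional ℝ E] [MeasurableSpace E] [BorelSpace E] {a b : ℝ} (ha : a ≠ 0) (hb : b ≠ 0) :
    MeasurableEmbedding fun z : ℝ × E => (a * z.1, b • z.2) :=
  ((Homeomorph.mulLeft₀ a ha).prodCongr (Homeomorph.smulOfNeZero b hb)).measurableEmbedding

lemma eLpNorm_comp_prod_smul {E : Type*} [NormedAddCommGroup E] [NormedSpace ℝ E]
    [FiniteDimensional ℝ E] [MeasurableSpace E] [BorelSpace E] (ν : Measure E) [ν.IsAddHaarMeasure]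
    {a b : ℝ} (ha : 0 < a) (hb : 0 < b) (q : ℝ≥0∞) (w : ℝ × E → ℂ) :
    eLpNorm (fun z : ℝ × E => w (a * z.1, b • z.2)) q ((volume : Measure ℝ).prod ν) =
      ENNReal.ofReal ((a * b ^ Module.finrank ℝ E) ^ (-(1 / q).toReal)) *
        eLpNorm w q ((volume : Measure ℝ).prod ν) := by
  have hp : 0 < a * b ^ Module.finrank ℝ E := by positivity
  have h := (measurableEmbedding_prod_smul (E := E) ha.ne' hb.ne').eLpNorm_map_measure
    (μ := (volume : Measure ℝ).prod ν) (p := q) (g := w)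
  rw [map_prod_smul ν ha hb, eLpNorm_smul_measure_of_ne_zero (ENNReal.ofReal_pos.2 (inv_pos.2 hp)).ne', smul_eq_mul,
    ENNReal.ofReal_rpow_of_pos (by positivity), Real.inv_rpow hp.le, ← Real.rpow_neg hp.le] at h
  exact h.symm

lemma eLpNorm_comp_mul {b : ℝ} (hb : 0 < b) (p : ℝ≥0∞) (w : ℝ → ℝ≥0∞) :
    eLpNorm (fun r => w (b * r)) p volume =
      ENNReal.ofReal (b ^ (-(1 / p).toReal)) * eLpNorm w p volume := by
  have h := (Homeomorph.mulLeft₀ b hb.ne').measurableEmbedding.eLpNorm_map_measure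
    (μ := (volume : Measure ℝ)) (p := p) (g := w)
  have h1 : (volume : Measure ℝ).map (Homeomorph.mulLeft₀ b hb.ne') = ENNReal.ofReal b⁻¹ • volume := by
    have := Measure.map_addHaar_smul (volume : Measure ℝ) hb.ne'
    simpa [Module.finrank_self, abs_of_pos hb] using this
  rw [h1, eLpNorm_smul_measure_of_ne_zero (by simpa using hb), smul_eq_mul,
    ENNReal.ofReal_rpow_of_pos (by positivity), Real.inv_rpow hb.le, ← Real.rpow_neg hb.le] at h
  exact h.symm

lemma finrank_orthogonal {e : Space n} (he : ‖e‖ = 1) : Module.finrank ℝ (ℝ ∙ e)ᗮ = n - 1 := by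
  have h1 := Submodule.finrank_add_finrank_orthogonal (ℝ ∙ e)
  rw [finrank_euclideanSpace, Fintype.card_fin, finrank_span_singleton
    (by rintro rfl; simp at he)] at h1
  omega

lemma anisoNorm_comp_smul_le {e : Space n} (he : ‖e‖ = 1) {a b : ℝ} (ha : 0 < a) (hb : 0 < b)
    (p q : ℝ≥0∞) (c : ℂ) (u : ℝ → Space n → ℂ) :
    anisoNorm p q e (fun t x => c * u (a * t) (b • x)) ≤
      ENNReal.ofReal (‖c‖ * (a * b ^ (n - 1)) ^ (-(1 / q).toReal) * b ^ (-(1 / p).toReal)) *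
        anisoNorm p q e u := by
  have hin : ∀ r : ℝ, eLpNorm (fun z : ℝ × (ℝ ∙ e)ᗮ => c * u (a * z.1) (b • (r • e + (z.2 : Space n)))) q
      ((volume : Measure ℝ).prod (hyperplaneMeasure e)) =
      ((‖c‖ * (a * b ^ (n - 1)) ^ (-(1 / q).toReal)).toNNReal : ℝ≥0∞) *
        eLpNorm (fun z : ℝ × (ℝ ∙ e)ᗮ => u z.1 ((b * r) • e + (z.2 : Space n))) q
      ((volume : Measure ℝ).prod (hyperplaneMeasure e)) := by
    intro r
    have h1 := eLpNorm_comp_prod_smul (hyperplaneMeasure e) ha hb q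
      fun z : ℝ × (ℝ ∙ e)ᗮ => u z.1 ((b * r) • e + (z.2 : Space n))
    rw [finrank_orthogonal he] at h1
    have h2 := eLpNorm_const_smul c (fun z : ℝ × (ℝ ∙ e)ᗮ =>
      u (a * z.1) ((b * r) • e + ((b • z.2 : (ℝ ∙ e)ᗮ) : Space n))) q
      ((volume : Measure ℝ).prod (hyperplaneMeasure e))
    rw [h1] at h2
    change _ = ENNReal.ofReal _ * _
    rw [ENNReal.ofReal_mul (norm_nonneg c), ofReal_norm, mul_assoc, ← h2]
    refine congrArg (fun w => eLpNorm w q _) (funext fun z => ?_)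
    simp [smul_add, smul_smul]
  unfold anisoNorm
  simp only [hin]
  refine (eLpNorm_le_nnreal_smul_eLpNorm_of_ae_le_mul' (c := (‖c‖ * (a * b ^ (n - 1)) ^
    (-(1 / q).toReal)).toNNReal) (g := fun r => eLpNorm (fun z : ℝ × (ℝ ∙ e)ᗮ =>
      u z.1 ((b * r) • e + (z.2 : Space n))) q ((volume : Measure ℝ).prod (hyperplaneMeasure e)))
    (Filter.Eventually.of_forall fun r => le_rfl) p).trans_eq ?_
  rw [eLpNorm_comp_mul hb p fun r => eLpNorm (fun z : ℝ × (ℝ ∙ e)ᗮ =>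
      u z.1 (r • e + (z.2 : Space n))) q ((volume : Measure ℝ).prod (hyperplaneMeasure e)),
    ENNReal.ofReal_mul (by positivity), mul_assoc]
  rfl

lemma integrable_comp_smul {G : ℝ × Space n → ℂ} (hG : Integrable G) {a b : ℝ} (ha : 0 < a)
    (hb : 0 < b) : Integrable fun z : ℝ × Space n => G (a * z.1, b • z.2) := by
  have h := (measurableEmbedding_prod_smul (E := Space n) ha.ne' hb.ne').integrable_map_iff
    (μ := (volume : Measure ℝ).prod (volume : Measure (Space n))) (g := G)
  rw [map_prod_smul volume ha hb] at h
  exact h.1 (hG.smul_measure ENNReal.ofReal_ne_top)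

end Scaling

/-- Decay in x is uniform over a bounded family, but decay in s must be produced separately. The
projection acts only in x and commutes with multiplication by 1 + s², so the same uniform bound for
(1 + s²)F gives the integrable factor (1 + s²)^{-1}. -/
lemma integrable_schwartzProj_slice (χ : ℝ → ℝ) (hχ : IsCutoff χ) (j : ℤ) (F : 𝓢(ℝ × Space n, ℂ)) :
    Integrable fun z : ℝ × Space n => schwartzProj χ j (slice z.1 F) z.2 := by
  have hσ : (fun z : ℝ × Space n => ((1 + z.1 ^ 2 : ℝ) : ℂ)).HasTemperateGrowth := by
    have h1 : (fun z : ℝ × Space n => (1 + z.1 ^ 2 : ℝ)).HasTemperateGrowth :=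
      (Function.HasTemperateGrowth.const 1).add
        ((ContinuousLinearMap.fst ℝ ℝ (Space n)).hasTemperateGrowth.pow 2)
    exact Function.HasTemperateGrowth.comp Function.Complex.hasTemperateGrowth_ofReal h1
  set F' := SchwartzMap.smulLeftCLM ℂ (fun z : ℝ × Space n => ((1 + z.1 ^ 2 : ℝ) : ℂ)) F
  have hF' : ∀ s, slice s F' = ((1 + s ^ 2 : ℝ) : ℂ) • slice s F := by
    intro s
    ext x
    rw [slice_apply, SchwartzMap.smulLeftCLM_apply_apply hσ]
    rfl
  have hb := (isBoundedFamily_slice F).schwartzProj hχ j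
  obtain ⟨C, hC, h⟩ := ((isBoundedFamily_slice F').schwartzProj hχ j).exists_norm_le (n + 1)
  have hi := integrable_inv_one_add_sq.mul_prod ((integrable_inv_one_add_norm_pow n).const_mul C)
  refine hi.mono' hb.continuous.aestronglyMeasurable (Filter.Eventually.of_forall fun z => ?_)
  have h1 := h z.1 z.2
  have h2 : schwartzProj χ j (slice z.1 F') = ((1 + z.1 ^ 2 : ℝ) : ℂ) • schwartzProj χ j (slice z.1 F) := by
    rw [hF']
    unfold schwartzProj
    rw [FourierTransform.fourier_smul, map_smul, FourierTransform.fourierInv_smul]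
  have h3 : 0 < 1 + z.1 ^ 2 := by positivity
  rw [h2, smul_apply, norm_smul, Complex.norm_real, Real.norm_of_nonneg h3.le] at h1
  rw [inv_mul_eq_div, le_div_iff₀ h3]
  linarith

/-- The kernel representation of the propagator on functions that are localised in frequency. -/
lemma kernel_eq_integral {ε : Fin n → ℝ} (M g : 𝓢(Space n, ℂ)) {L : ℝ} (hL : 0 < L)
    (hM : ∀ ξ, 𝓕 g ξ = M ((L⁻¹ * (2 * Real.pi)) • ξ) * 𝓕 g ξ) (τ : ℝ) (x : Space n) :
    kernel ε (𝓕 g : 𝓢(Space n, ℂ)) (timeScale * τ) ((2 * Real.pi) • x) =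
      ((L / (2 * Real.pi)) ^ n : ℝ) * ∫ z, g z * kernel ε M (L ^ 2 * τ) (L • (x - z)) := by
  have ha : 0 < L⁻¹ * (2 * Real.pi) := by positivity
  set a := L⁻¹ * (2 * Real.pi) with had
  have hMi : Integrable fun ξ : Space n => M (a • ξ) := M.integrable.comp_smul ha.ne'
  have hw1 : ∀ z ξ : Space n, Complex.exp (↑(-2 * Real.pi * inner ℝ z ξ) * Complex.I) =
      wave ε 0 (-((2 * Real.pi) • z)) ξ := by
    intro z ξ
    unfold wave
    rw [phase, inner_neg_left, real_inner_smul_left]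
    congr 2
    push_cast
    ring
  have hw2 : ∀ y ξ : Space n, wave ε (timeScale * τ) ((2 * Real.pi) • y) ξ =
      wave ε (L ^ 2 * τ) (L • y) (a • ξ) := by
    intro y ξ
    have hq : quadForm ε (a • ξ) = a ^ 2 * quadForm ε ξ := by
      simp only [quadForm, Finset.mul_sum, PiLp.smul_apply, smul_eq_mul]
      refine Finset.sum_congr rfl fun i _ => ?_
      ring
    unfold wave
    rw [phase, phase, hq, real_inner_smul_left, real_inner_smul_left, real_inner_smul_right, had,
      timeScale]
    congr 2
    push_cast
    have : (L : ℂ) ≠ 0 := by exact_mod_cast hL.ne'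
    field_simp
  have hin : ∀ z : Space n, ∫ ξ, wave ε (timeScale * τ) ((2 * Real.pi) • (x - z)) ξ * M (a • ξ) =
      ((L / (2 * Real.pi)) ^ n : ℝ) * kernel ε M (L ^ 2 * τ) (L • (x - z)) := by
    intro z
    simp only [hw2]
    rw [Measure.integral_comp_smul volume (fun η => wave ε (L ^ 2 * τ) (L • (x - z)) η * M η) a,
      finrank_euclideanSpace, Fintype.card_fin, abs_of_pos (by positivity), Complex.real_smul, kernel]
    congr 2
    rw [had, ← inv_pow, mul_inv, inv_inv, div_eq_mul_inv]
  have e1 : ∀ ξ : Space n, wave ε (timeScale * τ) ((2 * Real.pi) • x) ξ * 𝓕 g ξ =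
      ∫ z, g z * (wave ε (timeScale * τ) ((2 * Real.pi) • (x - z)) ξ * M (a • ξ)) := by
    intro ξ
    rw [hM ξ, SchwartzMap.fourier_coe, Real.fourier_eq', ← mul_assoc, ← integral_const_mul]
    refine integral_congr_ae (Filter.Eventually.of_forall fun z => ?_)
    simp only [smul_eq_mul, hw1]
    rw [smul_sub, sub_eq_add_neg, ← add_zero (timeScale * τ), wave_add, add_zero]
    ring
  have hc : Continuous fun p : Space n × Space n =>
      g p.2 * (wave ε (timeScale * τ) ((2 * Real.pi) • (x - p.2)) p.1 * M (a • p.1)) := by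
    have h1 : Continuous fun p : Space n × Space n =>
      (timeScale * τ, (2 * Real.pi) • (x - p.2), p.1) := by fun_prop
    have h2 := (continuous_wave ε).comp h1
    have h3 : Continuous fun p : Space n × Space n => g p.2 := g.continuous.comp continuous_snd
    have h4 : Continuous fun p : Space n × Space n => M (a • p.1) := M.continuous.comp (by fun_prop)
    exact h3.mul (h2.mul h4)
  rw [kernel]
  simp only [e1]
  rw [integral_integral_swap]
  · rw [← integral_const_mul]
    refine integral_congr_ae (Filter.Eventually.of_forall fun z => ?_)
    simp only
    rw [integral_const_mul, hin]
    ring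
  · refine (hMi.norm.mul_prod g.integrable.norm).mono' hc.aestronglyMeasurable
      (Filter.Eventually.of_forall fun p => ?_)
    simp only [Function.uncurry]
    rw [norm_mul, norm_mul, norm_wave, one_mul, mul_comm]

end

/-! ### Reduction to unit frequency and conclusion. -/

section

variable {n : ℕ}

lemma timeCutoff_mul {a : ℝ} (ha : 0 < a) (t s : ℝ) : timeCutoff (a * t) (a * s) = timeCutoff t s := by
  unfold timeCutoff
  have h1 : a * s ≤ a * t ↔ s ≤ t := mul_le_mul_iff_right₀ ha
  have h2 : a * s ≤ 0 ↔ s ≤ 0 := mul_nonpos_iff_pos_imp_nonpos.trans (by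
    constructor
    · intro h; exact h.1 ha
    · intro h; exact ⟨fun _ => h, fun h' => by nlinarith⟩)
  simp only [h1, h2]

/-- The Duhamel integral of a family that is localised at frequency `L`, rescaled to frequency `1`. -/
lemma duhamel_eq_forcedWave (ε : Fin n → ℝ) (M : 𝓢(Space n, ℂ)) {g : ℝ → 𝓢(Space n, ℂ)}
    (hG : Integrable fun z : ℝ × Space n => g z.1 z.2) {L : ℝ} (hL : 0 < L)
    (hM : ∀ s ξ, 𝓕 (g s) ξ = M ((L⁻¹ * (2 * Real.pi)) • ξ) * 𝓕 (g s) ξ) (t : ℝ) (x : Space n) :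
    duhamel ε (fun s => g s) t x = (-Complex.I * (((2 * Real.pi)⁻¹ ^ n * (L ^ 2)⁻¹ : ℝ) : ℂ)) *
      forcedWave ε M (fun z => g ((L ^ 2)⁻¹ * z.1) (L⁻¹ • z.2)) (L ^ 2 * t) (L • x) := by
  have hL2 : 0 < L ^ 2 := by positivity
  -- Parabolic rescaling, the one that preserves the phase; the substitutions z ↦ Lz and s ↦ L²s
  -- below contribute L^n and L².
  set G' : ℝ × Space n → ℂ := fun z => g ((L ^ 2)⁻¹ * z.1) (L⁻¹ • z.2) with hG'
  have hG'i : Integrable G' := integrable_comp_smul hG (inv_pos.2 hL2) (inv_pos.2 hL)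
  have hG's : ∀ s z, G' (L ^ 2 * s, L • z) = g s z := by
    intro s z
    simp only [hG']
    rw [inv_mul_cancel_left₀ hL2.ne', inv_smul_smul₀ hL.ne']
  have hz : ∀ s : ℝ, ∫ z : Space n, G' (L ^ 2 * s, z) * (timeCutoff (L ^ 2 * t) (L ^ 2 * s) *
      kernel ε M (L ^ 2 * t - L ^ 2 * s) (L • x - z)) =
      (L ^ n : ℝ) * (timeCutoff t s * ∫ z, g s z * kernel ε M (L ^ 2 * (t - s)) (L • (x - z))) := by
    intro s
    have h := Measure.integral_comp_smul (volume : Measure (Space n)) (fun z => G' (L ^ 2 * s, z) *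
      (timeCutoff (L ^ 2 * t) (L ^ 2 * s) * kernel ε M (L ^ 2 * t - L ^ 2 * s) (L • x - z))) L
    rw [finrank_euclideanSpace, Fintype.card_fin, abs_of_pos (by positivity),
      ← inv_smul_eq_iff₀ (by positivity), inv_inv] at h
    rw [← h, Complex.real_smul]
    congr 1
    rw [← integral_const_mul]
    refine integral_congr_ae (Filter.Eventually.of_forall fun z => ?_)
    simp only [hG's, timeCutoff_mul hL2]
    rw [mul_sub, smul_sub]
    ring
  have hf : forcedWave ε M G' (L ^ 2 * t) (L • x) = (L ^ 2 * L ^ n : ℝ) *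
      ∫ s : ℝ, timeCutoff t s * ∫ z, g s z * kernel ε M (L ^ 2 * (t - s)) (L • (x - z)) := by
    have h := Measure.integral_comp_mul_left (fun s : ℝ => ∫ z : Space n, G' (s, z) *
      (timeCutoff (L ^ 2 * t) s * kernel ε M (L ^ 2 * t - s) (L • x - z))) (L ^ 2)
    rw [abs_of_pos (by positivity), ← inv_smul_eq_iff₀ (by positivity), inv_inv] at h
    rw [forcedWave, Measure.volume_eq_prod, integral_prod
      (fun q : ℝ × Space n => G' q * (timeCutoff (L ^ 2 * t) q.1 *
        kernel ε M (L ^ 2 * t - q.1) (L • x - q.2))) (integrable_forcedWave ε M hG'i _ _), ← h]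
    simp only [hz]
    rw [integral_const_mul, Complex.real_smul]
    push_cast
    ring
  rw [hf, duhamel, intervalIntegral_eq_timeCutoff]
  simp only [propagator_eq, ← SchwartzMap.fourier_coe]
  simp only [kernel_eq_integral M _ hL (hM _)]
  have e : ∀ s : ℝ, (timeCutoff t s : ℂ) * (((L / (2 * Real.pi)) ^ n : ℝ) *
      ∫ z, g s z * kernel ε M (L ^ 2 * (t - s)) (L • (x - z))) = ((L / (2 * Real.pi)) ^ n : ℝ) *
      (timeCutoff t s * ∫ z, g s z * kernel ε M (L ^ 2 * (t - s)) (L • (x - z))) := fun s => by ring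
  simp only [e]
  have ec : (L / (2 * Real.pi)) ^ n = ((2 * Real.pi)⁻¹ ^ n * (L ^ 2)⁻¹) * (L ^ 2 * L ^ n) := by
    rw [div_pow, inv_pow]
    field_simp
  rw [integral_const_mul, ec, Complex.ofReal_mul]
  ring

lemma sourceNorm_comp_smul_le {a b : ℝ} (ha : 0 < a) (hb : 0 < b) (G : ℝ → Space n → ℂ) :
    sourceNorm (fun s z => G (a * s) (b • z)) ≤
      ENNReal.ofReal ((a * b ^ (n - 1)) ^ (-(1 / 2) : ℝ) * b ^ (-1 : ℝ)) * sourceNorm G := by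
  refine iSup₂_le fun e he => ?_
  have h := anisoNorm_comp_smul_le he ha hb 1 2 1 G
  simp only [one_mul, norm_one, div_one, ENNReal.toReal_one, ENNReal.toReal_div,
    ENNReal.toReal_ofNat] at h
  have hs : anisoNorm 1 2 e G ≤ sourceNorm G :=
    le_iSup₂_of_le (f := fun e (_ : ‖e‖ = 1) => anisoNorm 1 2 e G) e he le_rfl
  exact h.trans (mul_le_mul_right hs _)

/-- Here p stands for the reciprocal of the exponent. The count is -n/2 + p - 2 - p + (n+1)/2 + 1 =
-1/2, and the surplus (2π)^{-n} is at most 1. -/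
lemma scaling_exponents_le (hn : 2 ≤ n) {L p : ℝ} (hL : 0 < L) :
    L ^ (-((n : ℝ) / 2 - p)) * (((2 * Real.pi)⁻¹ ^ n * (L ^ 2)⁻¹) * L ^ (-p) *
      (((L ^ 2)⁻¹ * L⁻¹ ^ (n - 1)) ^ (-(1 / 2) : ℝ) * L⁻¹ ^ (-1 : ℝ))) ≤ L ^ (-(1 / 2) : ℝ) := by
  have h1 : (2 * Real.pi)⁻¹ ^ n ≤ 1 :=
    pow_le_one₀ (by positivity) (inv_le_one_of_one_le₀ (by linarith [Real.two_le_pi]))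
  have e1 : (L ^ 2)⁻¹ = L ^ (-2 : ℝ) := by
    rw [Real.rpow_neg hL.le, Real.rpow_two]
  have e2 : (L⁻¹) ^ (n - 1) = L ^ (-((n : ℝ) - 1)) := by
    rw [inv_pow, Real.rpow_neg hL.le, ← Real.rpow_natCast, Nat.cast_sub (by omega), Nat.cast_one]
  have e3 : L⁻¹ ^ (-1 : ℝ) = L ^ (1 : ℝ) := by
    rw [Real.inv_rpow hL.le, Real.rpow_neg hL.le, inv_inv]
  have key : L ^ (-((n : ℝ) / 2 - p)) * ((1 * (L ^ 2)⁻¹) * L ^ (-p) *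
      (((L ^ 2)⁻¹ * L⁻¹ ^ (n - 1)) ^ (-(1 / 2) : ℝ) * L⁻¹ ^ (-1 : ℝ))) = L ^ (-(1 / 2) : ℝ) := by
    rw [e1, e2, e3, ← Real.rpow_add hL, ← Real.rpow_mul hL.le, one_mul, ← Real.rpow_add hL,
      ← Real.rpow_add hL, ← Real.rpow_add hL, ← Real.rpow_add hL]
    congr 1
    ring
  rw [← key]
  gcongr

theorem exists_anisoNorm_dyadicProj_duhamel_le (hn : 2 ≤ n) {χ : ℝ → ℝ} (hχ : IsCutoff χ) :
    ∃ C : ℝ≥0, ∀ ε : Fin n → ℝ, IsSigns ε → ∀ p : ℝ≥0∞, 2 ≤ p → (n = 2 → 3 ≤ p) →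
      ∀ (j : ℤ) (F : 𝓢(ℝ × Space n, ℂ)) (e' : Space n), ‖e'‖ = 1 →
        ENNReal.ofReal ((2 : ℝ) ^ (-((n : ℝ) / 2 - 1 / p.toReal) * (j : ℝ))) *
            anisoNorm p ∞ e' (fun t => dyadicProj χ j (duhamel ε (fun t x => F (t, x)) t)) ≤
          (C : ℝ≥0∞) * ENNReal.ofReal ((2 : ℝ) ^ (-(j : ℝ) / 2)) *
            sourceNorm (fun t => dyadicProj χ j (fun x => F (t, x))) := by
  obtain ⟨M, D, hM, hD⟩ := exists_anisoNorm_forcedWave_le n hn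
  refine ⟨D, fun ε hε p hp hp' j F e' he' => ?_⟩
  have hL : (0 : ℝ) < (2 : ℝ) ^ j := by positivity
  set L : ℝ := (2 : ℝ) ^ j with hLdef
  have hF := isBoundedFamily_slice F
  set g : ℝ → 𝓢(Space n, ℂ) := fun s => schwartzProj χ j (slice s F) with hg
  have hgF := hF.schwartzProj hχ j
  have hGi : Integrable fun z : ℝ × Space n => g z.1 z.2 := integrable_schwartzProj_slice χ hχ j F
  -- M equals 1 on the annulus that carries ψ, so inserting it changes nothing. M and the constant D
  -- were fixed before j and χ entered.
  have hgM : ∀ s ξ, 𝓕 (g s) ξ = M ((L⁻¹ * (2 * Real.pi)) • ξ) * 𝓕 (g s) ξ := by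
    intro s ξ
    rw [hg, fourier_schwartzProj_apply hχ, dyadicSymbol, smul_smul, zpow_neg]
    by_cases h : 1 / 2 ≤ ‖(L⁻¹ * (2 * Real.pi)) • ξ‖ ∧ ‖(L⁻¹ * (2 * Real.pi)) • ξ‖ ≤ 2
    · rw [hM _ h.1 h.2, one_mul]
    · rw [psi_eq_zero hχ h]; simp
  have hu : (fun t => dyadicProj χ j (duhamel ε (fun t x => F (t, x)) t)) = fun t x =>
      (-Complex.I * (((2 * Real.pi)⁻¹ ^ n * (L ^ 2)⁻¹ : ℝ) : ℂ)) *
      forcedWave ε M (fun z => g ((L ^ 2)⁻¹ * z.1) (L⁻¹ • z.2)) (L ^ 2 * t) (L • x) := by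
    funext t x
    rw [← duhamel_eq_forcedWave ε M hGi hL hgM]
    exact congrFun (dyadicProj_duhamel hF hε hχ j t) x
  have hG : (fun t => dyadicProj χ j (fun x => F (t, x))) = fun s => (g s : Space n → ℂ) :=
    funext fun s => (coe_schwartzProj hχ j (slice s F)).symm
  have hc : ‖-Complex.I * (((2 * Real.pi)⁻¹ ^ n * (L ^ 2)⁻¹ : ℝ) : ℂ)‖ =
      (2 * Real.pi)⁻¹ ^ n * (L ^ 2)⁻¹ := by
    rw [norm_mul, norm_neg, Complex.norm_I, one_mul, Complex.norm_real,
      Real.norm_of_nonneg (by positivity)]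
  have hL2 : 0 < L ^ 2 := by positivity
  have h1 := anisoNorm_comp_smul_le he' hL2 hL p ⊤
    (-Complex.I * (((2 * Real.pi)⁻¹ ^ n * (L ^ 2)⁻¹ : ℝ) : ℂ))
    (forcedWave ε M (fun z => g ((L ^ 2)⁻¹ * z.1) (L⁻¹ • z.2)))
  have h2 := hD ε hε p hp hp' (fun z => g ((L ^ 2)⁻¹ * z.1) (L⁻¹ • z.2))
    (integrable_comp_smul hGi (inv_pos.2 hL2) (inv_pos.2 hL))
    (hgF.continuous.comp (f := fun z : ℝ × Space n => ((L ^ 2)⁻¹ * z.1, L⁻¹ • z.2)) (by fun_prop)) e' he'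
  have h3 := sourceNorm_comp_smul_le (inv_pos.2 hL2) (inv_pos.2 hL) fun s => (g s : Space n → ℂ)
  -- The inner exponent ∞ contributes no power of L. For p = ∞ the conventions `⊤.toReal = 0` and
  -- `0⁻¹ = 0` give the intended 1/∞ = 0.
  rw [hc, ENNReal.div_top, ENNReal.toReal_zero, neg_zero, Real.rpow_zero, mul_one, one_div,
    ENNReal.toReal_inv] at h1
  have e1 : (2 : ℝ) ^ (-((n : ℝ) / 2 - 1 / p.toReal) * (j : ℝ)) =
      L ^ (-((n : ℝ) / 2 - p.toReal⁻¹)) := by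
    rw [mul_comm, Real.rpow_mul zero_le_two, Real.rpow_intCast, one_div]
  have e2 : (2 : ℝ) ^ (-(j : ℝ) / 2) = L ^ (-(1 / 2) : ℝ) := by
    rw [show -(j : ℝ) / 2 = j * (-(1 / 2)) by ring, Real.rpow_mul zero_le_two, Real.rpow_intCast]
  rw [hu, hG, e1, e2]
  have hfin := ENNReal.ofReal_le_ofReal (scaling_exponents_le hn (p := p.toReal⁻¹) hL)
  rw [ENNReal.ofReal_mul (by positivity), ENNReal.ofReal_mul (by positivity)] at hfin
  calc _ ≤ ENNReal.ofReal (L ^ (-((n : ℝ) / 2 - p.toReal⁻¹))) *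
        (ENNReal.ofReal ((2 * Real.pi)⁻¹ ^ n * (L ^ 2)⁻¹ * L ^ (-p.toReal⁻¹)) *
        (D * (ENNReal.ofReal (((L ^ 2)⁻¹ * L⁻¹ ^ (n - 1)) ^ (-(1 / 2) : ℝ) * L⁻¹ ^ (-1 : ℝ)) *
          sourceNorm fun s => (g s : Space n → ℂ)))) := by
        refine mul_le_mul_right (h1.trans (mul_le_mul_right (h2.trans (mul_le_mul_right ?_ _)) _)) _
        exact h3
    _ = D * (ENNReal.ofReal (L ^ (-((n : ℝ) / 2 - p.toReal⁻¹))) *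
        (ENNReal.ofReal ((2 * Real.pi)⁻¹ ^ n * (L ^ 2)⁻¹ * L ^ (-p.toReal⁻¹)) *
        ENNReal.ofReal (((L ^ 2)⁻¹ * L⁻¹ ^ (n - 1)) ^ (-(1 / 2) : ℝ) * L⁻¹ ^ (-1 : ℝ)))) *
          sourceNorm fun s => (g s : Space n → ℂ) := by ring
    _ ≤ _ := by gcongr

end

end UltraSchrodinger

end

theorem lemma2p6 (n : ℕ) (hn : 2 ≤ n) (χ : ℝ → ℝ) (hχ : UltraSchrodinger.IsCutoff χ) :
    (∀ ε : Fin n → ℝ, UltraSchrodinger.IsSigns ε →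
      ∀ F : 𝓢(ℝ × UltraSchrodinger.Space n, ℂ),
        UltraSchrodinger.SolvesIVP ε (fun t x => F (t, x))
          (UltraSchrodinger.duhamel ε (fun t x => F (t, x)))) ∧
    ∃ C : ℝ≥0, ∀ ε : Fin n → ℝ, UltraSchrodinger.IsSigns ε →
      ∀ p : ℝ≥0∞, 2 ≤ p → (n = 2 → 3 ≤ p) →
      ∀ (j : ℤ) (F : 𝓢(ℝ × UltraSchrodinger.Space n, ℂ)) (e' : UltraSchrodinger.Space n),
        ‖e'‖ = 1 →
        ENNReal.ofReal ((2 : ℝ) ^ (-((n : ℝ) / 2 - 1 / p.toReal) * (j : ℝ))) *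
            UltraSchrodinger.anisoNorm p ∞ e' (fun t => UltraSchrodinger.dyadicProj χ j
              (UltraSchrodinger.duhamel ε (fun t x => F (t, x)) t)) ≤
          (C : ℝ≥0∞) * ENNReal.ofReal ((2 : ℝ) ^ (-(j : ℝ) / 2)) *
            ⨆ (e : UltraSchrodinger.Space n) (_ : ‖e‖ = 1),
              UltraSchrodinger.anisoNorm 1 2 e (fun t => UltraSchrodinger.dyadicProj χ j
                (fun x => F (t, x))) := by
  exact ⟨fun ε hε F => UltraSchrodinger.solvesIVP_duhamel hε (UltraSchrodinger.isBoundedFamily_slice F),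
    UltraSchrodinger.exists_anisoNorm_dyadicProj_duhamel_le hn hχ⟩
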